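/- Let $m$ be Lebesgue measure on $\mathbb R$, $p\in(1,\infty)$, $K\in\mathbb R$, $N\in(-\infty,0]\cup(1,\infty]$ and $D\in(0,\infty]$. For $N<\infty$ put $\delta=\frac{K}{N-1}$, and let $\mathfrak s_\delta(x)=\frac{\sin(\sqrt\delta x)}{\sqrt\delta},\ x,\ \frac{\sinh(\sqrt{-\delta}x)}{\sqrt{-\delta}}$ and $\mathfrak c_\delta(x)=\cos(\sqrt\delta x),\ 1,\ \cosh(\sqrt{-\delta}x)$ according as $\delta>0$, $\delta=0$, $\delta<0$. For $\mathfrak h\in\mathbb R$ define the model density $J_{K,N,\mathfrak h}:\mathbb R\to[0,\infty]$ by $$J_{K,N,\mathfrak h}(x)=\Bigl(\mathfrak c_\delta(x)+\tfrac{\mathfrak h}{N-1}\mathfrak s_\delta(x)\Bigr)_+^{N-1}\ (N<\infty),\qquad J_{K,\infty,\mathfrak h}(x)=\exp\bigl(\mathfrak hx-\tfrac K2x^2\bigr),$$ where $f_+$ denotes $f$ replaced by $0$ outside the interval $[\sup\{x\le 0:f(x)=0\},\ \inf\{x>0:f(x)=0\}]$ (with $\sup\emptyset=-\infty$, $\inf\emptyset=+\infty$),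 and $0^{N-1}=+\infty$ if $N<1$. Put $\mathfrak{supp}(J)=\mathrm{supp}(J\,m)\cap\mathrm{supp}(J^{-1}m)$. The regular parameter domain is $$\mathcal D^{reg}_{(K,N,D)}=\Bigl\{(\mathfrak h,d)\in\mathbb R\times(0,D]:\ d<\infty,\ [-\tfrac d2,\tfrac d2]\subset\mathrm{int}\bigl(\mathfrak{supp}(J_{K,N,\mathfrak h})\bigr)\Bigr\},$$ and for $(\mathfrak h,d)\in\mathcal D^{reg}_{(K,N,D)}$ we set $\xi_{(K,N)}(\mathfrak h,d)=J_{K,N,\mathfrak h}1_{[-d/2,d/2]}\cdot m$ and $$\lambda^{(1,p)}(\mathfrak h,d)=\Lambda^{(p)}_{Poi}\bigl(\xi_{(K,N)}(\mathfrak h,d)\bigr),\qquad \Lambda^{(p)}_{Poi}(\xi)=\inf_f\frac{\int|f'|^p\,d\xi}{\int|f|^p\,d\xi},$$ the infimum being over all $0\not\equiv f\in C_c^\infty(\mathbb R)$ with $\int|f|^{p-2}f\,d\xi=0$, where the quotient is $+\infty$ if $\int|f|^p\,d\xi=0$. Then $\lambda^{(1,p)}$ is finite on $\mathcal D^{reg}_{(K,N,D)}$,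 and: 1. For every $\mathfrak h_0$ the function $d\mapsto\lambda^{(1,p)}(\mathfrak h_0,d)$ is non-increasing on $\{d:(\mathfrak h_0,d)\in\mathcal D^{reg}_{(K,N,D)}\}$. 2. If $N\in(1,\infty]$ and $(\mathfrak h_1,d_0),(\mathfrak h_2,d_0)\in\mathcal D^{reg}_{(K,N,D)}$ with $|\mathfrak h_1|\le|\mathfrak h_2|$, then $\lambda^{(1,p)}(\mathfrak h_1,d_0)\le\lambda^{(1,p)}(\mathfrak h_2,d_0)$. In particular, whenever $(\mathfrak h,d_0)\in\mathcal D^{reg}_{(K,N,D)}$, also $(0,d_0)\in\mathcal D^{reg}_{(K,N,D)}$ and $\lambda^{(1,p)}(0,d_0)\le\lambda^{(1,p)}(\mathfrak h,d_0)$. No assumption on the dependence of the eigenvalues of the associated $p$-Sturm–Liouville problem on the weight is made. -/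

import Mathlib

open MeasureTheory Set
open scoped ENNReal ContDiff

noncomputable section

/-- `δ(K, N) = K / (N - 1)` for `N ≠ 1`, and `0` for `N = 1`. -/
def modelDelta (K N : ℝ) : ℝ := if N = 1 then 0 else K / (N - 1)

/-- The generalized sine `𝔰_δ`. -/
def modelSin (δ x : ℝ) : ℝ :=
  if 0 < δ then Real.sin (√δ * x) / √δ
  else if δ = 0 then x
  else Real.sinh (√(-δ) * x) / √(-δ)

/-- The generalized cosine `𝔠_δ`. -/
def modelCos (δ x : ℝ) : ℝ :=
  if 0 < δ then Real.cos (√δ * x)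
  else if δ = 0 then 1
  else Real.cosh (√(-δ) * x)

/-- `sup {x ≤ 0 : f x = 0}`, which is `-∞` if there is no such zero. -/
def zeroLeft (f : ℝ → ℝ) : EReal :=
  sSup ((fun x : ℝ => (x : EReal)) '' {x : ℝ | x ≤ 0 ∧ f x = 0})

/-- `inf {x > 0 : f x = 0}`, which is `+∞` if there is no such zero. -/
def zeroRight (f : ℝ → ℝ) : EReal :=
  sInf ((fun x : ℝ => (x : EReal)) '' {x : ℝ | 0 < x ∧ f x = 0})

/-- `f₊`: the function `f` cut off to `0` outside the interval around `0` delimited by its nearest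
zeros. -/
def cutAtZeros (f : ℝ → ℝ) : ℝ → ℝ :=
  indicator {x : ℝ | zeroLeft f ≤ (x : EReal) ∧ (x : EReal) ≤ zeroRight f} f

/-- The model density `J_{K,N,h}` with values in `[0, ∞]`, for `K, h ∈ ℝ` and `N ∈ (-∞, ∞]`. For
`N < 1` the exponent `N - 1` is negative, so that the density is `+∞` where the base is `0`. -/
def modelDensity (K : ℝ) (N : WithTop ℝ) (h : ℝ) (x : ℝ) : ℝ≥0∞ :=
  match N with
  | ⊤ => ENNReal.ofReal (Real.exp (h * x - K / 2 * x ^ 2))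
  | (n : ℝ) =>
    if n = 1 then 1
    else
      ENNReal.ofReal (cutAtZeros (fun y => modelCos (modelDelta K n) y
        + h / (n - 1) * modelSin (modelDelta K n) y) x) ^ (n - 1)

/-- The support of a density `J : ℝ → [0, ∞]` in the two-sided sense: the support of `J dx`
intersected with the support of `J⁻¹ dx`. -/
def densitySupport (J : ℝ → ℝ≥0∞) : Set ℝ :=
  (volume.withDensity J).support ∩ (volume.withDensity (fun x => (J x)⁻¹)).support

/-- The parametric domain of regularity: the pairs `(h, d)` with `0 < d < ∞`, `d ≤ D` and
`[-d/2, d/2]` contained in the interior of the support of `J_{K,N,h}`. -/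
def regDomain (K : ℝ) (N D : WithTop ℝ) : Set (ℝ × ℝ) :=
  {q | 0 < q.2 ∧ (q.2 : WithTop ℝ) ≤ D ∧
    Icc (-(q.2 / 2)) (q.2 / 2) ⊆ interior (densitySupport (modelDensity K N q.1))}

/-- The model measure `ξ_{(K,N)}(h, d) = J_{K,N,h} 1_{[-d/2, d/2]} dx`. -/
def modelMeasure (K : ℝ) (N : WithTop ℝ) (h d : ℝ) : Measure ℝ :=
  volume.withDensity (indicator (Icc (-(d / 2)) (d / 2)) (modelDensity K N h))

/-- The test functions of the `p`-Poincaré inequality for a measure `ξ` on `ℝ`: the functions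
`0 ≢ f ∈ C_c^∞(ℝ)` with `∫ |f|^{p-2} f dξ = 0`. -/
def pTestFunctions (p : ℝ) (ξ : Measure ℝ) : Set (ℝ → ℝ) :=
  {f | f ≠ 0 ∧ ContDiff ℝ ∞ f ∧ HasCompactSupport f ∧ ∫ x, |f x| ^ (p - 2) * f x ∂ξ = 0}

/-- The quotient `∫ |f'|^p dξ / ∫ |f|^p dξ`, with value `+∞` if the denominator vanishes. -/
def pRayleigh (p : ℝ) (ξ : Measure ℝ) (f : ℝ → ℝ) : ℝ≥0∞ :=
  if ∫⁻ x, ‖f x‖ₑ ^ p ∂ξ = 0 then ⊤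
  else (∫⁻ x, ‖deriv f x‖ₑ ^ p ∂ξ) / ∫⁻ x, ‖f x‖ₑ ^ p ∂ξ

/-- The `p`-Poincaré constant of a measure on `ℝ`. -/
def pPoincareConst (p : ℝ) (ξ : Measure ℝ) : ℝ≥0∞ :=
  ⨅ f ∈ pTestFunctions p ξ, pRayleigh p ξ f

/-- `λ^{(1,p)}(h, d)`: the `p`-Poincaré constant of the model measure `ξ_{(K,N)}(h, d)`. -/
def modelLambda (p K : ℝ) (N : WithTop ℝ) (h d : ℝ) : ℝ≥0∞ :=
  pPoincareConst p (modelMeasure K N h d)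

end

/-!
Lower bounds for the `p`-Poincaré constant amount to the Poincaré inequality `PoincareBound` for
`C¹` functions on the closed interval (`ofReal_le_pPoincareConst_iff`), and both monotonicity
statements transfer such inequalities from one weight to another; no existence or regularity of
minimizers is used. Finiteness follows from one explicit test function. On the regular parameter
domain the model density is smooth and positive, and its logarithmic derivative `ψ`
solves the Riccati equation `ψ' = -K - ψ² / (N - 1)` with `ψ 0 = h` (`exists_modelDensity_eq`).

*Monotonicity in the diameter* holds for every positive continuous weight: a function on the smaller
interval is extended to the larger one by constants, and translating it to `p`-mean zero there only
helps (`PoincareBound.mono_interval`).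

*Monotonicity in `|h|`.* By reflection let `0 ≤ ψ₁ 0 ≤ ψ₂ 0`. If `f` solves the eigenvalue equation
`(J |f'| ^ (p - 2) f')' = -ν ^ p J |f| ^ (p - 2) f`, then `σ = ν f / f'` solves the first order
equation `σ' = sigmaField p ν (ψ x) σ`, and the Neumann condition becomes `σ = ±∞` at the ends. For
large `S`, shooting in `ν` gives a solution for the first weight with `σ (±a) = ±S`
(`exists_sigma_solution`). It is strictly increasing (`sigmaField_pos`), so that the position can be
regarded as a function `X` of the variable `s = σ`.

In this variable the two weights can be compared. Let `Y` be the trajectory for the second weight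
with `Y S = a`, followed back from `S` to `0`, and let the left half of a new trajectory be given by
letting the two points with variables `s` and `-s` have the same distance as for the first weight.
As `ψ₂ ≥ ψ₁` the right half moves to the right, and the damping in the Riccati equation makes the
gap of the logarithmic derivatives larger at the left point than at the right one
(`riccati_gap_le`). By convexity of `k ↦ 1 / k` the left half is then a subsolution
(`mul_add_one_div_sub_le`, `exists_comparison_trajectory`). Picone's inequality along such a
trajectory gives the Poincaré inequality with constant `ν ^ p` for functions vanishing at the common
end point `Y 0` (`mul_integral_le_of_sigmaField_mul_le`), hence for the second weight
(`PoincareBound.of_trajectory`).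

It remains to see that `ν ^ p` is not much smaller than the Poincaré constant `μ` of the first
weight. The solution `σ` gives a test function whose boundary terms are of relative order
`S ^ (1 - p)`, so that `μ ≤ ν ^ p + o(1)` as `S → ∞` (`PoincareBound.le_eigenvalue_add`). Letting
`S → ∞` finishes the comparison (`PoincareBound.of_riccati_le`).
-/

/-! ### Scalar comparison and existence for ordinary differential equations -/

/-- Comparison principle: a function that starts nonnegative and satisfies `D' ≥ L D` wherever it
is negative stays nonnegative. -/
theorem nonneg_of_deriv_ge {D D' : ℝ → ℝ} {L t₀ t₁ : ℝ} (hc : ContinuousOn D (Icc t₀ t₁))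
    (hd : ∀ t ∈ Ioo t₀ t₁, HasDerivAt D (D' t) t)
    (hL : ∀ t ∈ Ioo t₀ t₁, D t < 0 → L * D t ≤ D' t) (h₀ : 0 ≤ D t₀) :
    ∀ t ∈ Icc t₀ t₁, 0 ≤ D t := by
  intro t ht
  by_contra! hneg
  have hsub : Icc t₀ t ⊆ Icc t₀ t₁ := Icc_subset_Icc_right ht.2
  -- `s` is the last time before `t` at which `D` is nonnegative.
  have hcl : IsCompact (Icc t₀ t ∩ D ⁻¹' Ici 0) :=
    isCompact_Icc.of_isClosed_subset ((hc.mono hsub).preimage_isClosed_of_isClosed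
      isClosed_Icc isClosed_Ici) inter_subset_left
  obtain ⟨s, ⟨hs, hDs⟩, hmax⟩ := hcl.exists_isGreatest ⟨t₀, ⟨le_rfl, ht.1⟩, h₀⟩
  have hlt : ∀ r ∈ Ioc s t, D r < 0 := by
    intro r hr
    by_contra! h
    exact absurd (hmax ⟨⟨hs.1.trans hr.1.le, hr.2⟩, h⟩) (not_le.2 hr.1)
  have hmono : MonotoneOn (fun r => Real.exp (-L * r) * D r) (Icc s t) := by
    refine monotoneOn_of_hasDerivWithinAt_nonneg (convex_Icc s t)
      (f' := fun r => Real.exp (-L * r) * (-L) * D r + Real.exp (-L * r) * D' r)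
      ((by fun_prop : Continuous fun r => Real.exp (-L * r)).continuousOn.mul
        (hc.mono (Icc_subset_Icc hs.1 ht.2))) ?_ ?_
    · intro r hr
      rw [interior_Icc] at hr
      have h1 : HasDerivAt (fun r => Real.exp (-L * r)) (Real.exp (-L * r) * (-L)) r := by
        simpa using ((hasDerivAt_id r).const_mul (-L)).exp
      exact (h1.mul (hd r ⟨hs.1.trans_lt hr.1, hr.2.trans_le ht.2⟩)).hasDerivWithinAt
    · intro r hr
      rw [interior_Icc] at hr
      have := hL r ⟨hs.1.trans_lt hr.1, hr.2.trans_le ht.2⟩ (hlt r ⟨hr.1, hr.2.le⟩)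
      have hp := (Real.exp_pos (-L * r)).le
      nlinarith
  have := hmono ⟨le_rfl, hs.2⟩ ⟨hs.2, le_rfl⟩ hs.2
  have h2 : (0 : ℝ) ≤ Real.exp (-L * s) * D s := mul_nonneg (Real.exp_pos _).le hDs
  have h3 : Real.exp (-L * t) * D t < 0 := mul_neg_of_pos_of_neg (Real.exp_pos _) hneg
  simp only at this
  linarith

/-- The comparison principle `nonneg_of_deriv_ge` with time reversed. -/
theorem nonneg_of_deriv_le {D D' : ℝ → ℝ} {L t₀ t₁ : ℝ} (hc : ContinuousOn D (Icc t₀ t₁))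
    (hd : ∀ t ∈ Ioo t₀ t₁, HasDerivAt D (D' t) t)
    (hL : ∀ t ∈ Ioo t₀ t₁, D t < 0 → D' t ≤ L * D t) (h₁ : 0 ≤ D t₁) :
    ∀ t ∈ Icc t₀ t₁, 0 ≤ D t := by
  have key := nonneg_of_deriv_ge (D := fun t => D (-t)) (D' := fun t => -D' (-t)) (L := -L)
    (t₀ := -t₁) (t₁ := -t₀)
    (hc.comp continuousOn_neg fun t ht => ⟨by linarith [ht.2], by linarith [ht.1]⟩)
    (fun t ht => by
      have := (hd (-t) ⟨by linarith [ht.2], by linarith [ht.1]⟩).scomp t (hasDerivAt_neg t)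
      simpa [Function.comp_def] using this)
    (fun t ht h => by
      have := hL (-t) ⟨by linarith [ht.2], by linarith [ht.1]⟩ h
      linarith) (by simpa using h₁)
  intro t ht
  simpa using key (-t) ⟨by linarith [ht.2], by linarith [ht.1]⟩

/-- A solution of a scalar linear differential inequality `|D'| ≤ L |D|` keeps its sign. -/
theorem nonneg_of_abs_deriv_le {D D' : ℝ → ℝ} {L t₀ t₁ s : ℝ} (hc : ContinuousOn D (Icc t₀ t₁))
    (hd : ∀ t ∈ Ioo t₀ t₁, HasDerivAt D (D' t) t)
    (hL : ∀ t ∈ Ioo t₀ t₁, |D' t| ≤ L * |D t|) (hs : s ∈ Icc t₀ t₁) (h : 0 ≤ D s) :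
    ∀ t ∈ Icc t₀ t₁, 0 ≤ D t := by
  intro t ht
  rcases le_total s t with hst | hst
  · refine nonneg_of_deriv_ge (t₀ := s) (t₁ := t₁) (L := L) (hc.mono (Icc_subset_Icc_left hs.1))
      (fun r hr => hd r ⟨hs.1.trans_lt hr.1, hr.2⟩) (fun r hr hn => ?_) h t ⟨hst, ht.2⟩
    have := hL r ⟨hs.1.trans_lt hr.1, hr.2⟩
    rw [abs_of_neg hn] at this
    linarith [neg_abs_le (D' r)]
  · refine nonneg_of_deriv_le (t₀ := t₀) (t₁ := s) (L := -L) (hc.mono (Icc_subset_Icc_right hs.2))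
      (fun r hr => hd r ⟨hr.1, hr.2.trans_le hs.2⟩) (fun r hr hn => ?_) h t ⟨ht.1, hst⟩
    have := hL r ⟨hr.1, hr.2.trans_le hs.2⟩
    rw [abs_of_neg hn] at this
    linarith [le_abs_self (D' r)]

/-- Global existence for a bounded vector field that is uniformly Lipschitz in space. -/
theorem exists_hasDerivAt_of_bounded_lipschitz {F : ℝ → ℝ → ℝ} {M L : NNReal}
    (hlip : ∀ t, LipschitzWith L (F t)) (hcont : ∀ x, Continuous fun t => F t x)
    (hM : ∀ t x, |F t x| ≤ M) (t₀ x₀ : ℝ) {R : ℝ} (hR : 0 < R) :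
    ∃ y : ℝ → ℝ, y t₀ = x₀ ∧ ∀ t ∈ Ioo (t₀ - R) (t₀ + R), HasDerivAt y (F t (y t)) t := by
  have hPL : IsPicardLindelof F (tmin := t₀ - R) (tmax := t₀ + R)
      ⟨t₀, by constructor <;> linarith⟩ x₀ (M * R.toNNReal) 0 M L :=
    { lipschitzOnWith := fun t _ => (hlip t).lipschitzOnWith
      continuousOn := fun x _ => (hcont x).continuousOn
      norm_le := fun t _ x _ => hM t x
      mul_max_le := by
        have : ((R.toNNReal : NNReal) : ℝ) = R := Real.coe_toNNReal _ hR.le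
        simp [this] }
  obtain ⟨y, hy0, hy⟩ := hPL.exists_eq_forall_mem_Icc_hasDerivWithinAt₀
  exact ⟨y, hy0, fun t ht => (hy t ⟨ht.1.le, ht.2.le⟩).hasDerivAt (Icc_mem_nhds ht.1 ht.2)⟩

/-! ### Elementary inequalities for `p`-th powers -/

theorem continuous_abs_rpow_mul_self {p : ℝ} (hp : 1 < p) :
    Continuous fun t : ℝ => |t| ^ (p - 2) * t := by
  rw [continuous_iff_continuousAt]
  intro t
  rcases eq_or_ne t 0 with rfl | ht
  · have h0 : Filter.Tendsto (fun t : ℝ => |t| ^ (p - 1)) (nhds 0) (nhds 0) := by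
      have : Continuous fun t : ℝ => |t| ^ (p - 1) :=
        continuous_abs.rpow_const fun _ => Or.inr (by linarith)
      simpa [Real.zero_rpow (by linarith : p - 1 ≠ 0)] using this.tendsto 0
    have : Filter.Tendsto (fun t : ℝ => |t| ^ (p - 2) * t) (nhds 0) (nhds 0) := by
      refine squeeze_zero_norm (fun t => ?_) h0
      rcases eq_or_ne t 0 with rfl | ht
      · simpa using Real.rpow_nonneg (le_refl (0 : ℝ)) (p - 1)
      · have hpos := abs_pos.2 ht
        rw [norm_mul, Real.norm_eq_abs, Real.norm_eq_abs,
          abs_of_nonneg (Real.rpow_nonneg hpos.le _), ← Real.rpow_add_one hpos.ne']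
        exact le_of_eq (by ring_nf)
    simpa [ContinuousAt] using this
  · exact (continuousAt_id.abs.rpow_const (Or.inl (abs_pos.2 ht).ne')).mul continuousAt_id

theorem abs_rpow_mul_self_mul_self {p : ℝ} (hp : 1 < p) (t : ℝ) :
    |t| ^ (p - 2) * t * t = |t| ^ p := by
  rcases eq_or_ne t 0 with rfl | ht
  · simp [Real.zero_rpow (by linarith : p ≠ 0)]
  · have hpos := abs_pos.2 ht
    have : t * t = |t| ^ (2 : ℝ) := by rw [Real.rpow_two, sq_abs]; ring
    rw [mul_assoc, this, ← Real.rpow_add hpos]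
    ring_nf

theorem abs_abs_rpow_mul_self {p : ℝ} (hp : 1 < p) (t : ℝ) :
    |(|t| ^ (p - 2) * t)| = |t| ^ (p - 1) := by
  rcases eq_or_ne t 0 with rfl | ht
  · simp [Real.zero_rpow (by linarith : p - 1 ≠ 0)]
  · have hpos := abs_pos.2 ht
    rw [abs_mul, abs_of_nonneg (Real.rpow_nonneg hpos.le _), ← Real.rpow_add_one hpos.ne']
    ring_nf

/-- Young's inequality for the conjugate exponents `p` and `p / (p - 1)`. -/
theorem mul_rpow_sub_one_le {p A B : ℝ} (hp : 1 < p) (hA : 0 ≤ A) (hB : 0 ≤ B) :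
    p * (A * B ^ (p - 1)) ≤ A ^ p + (p - 1) * B ^ p := by
  have hp0 : p ≠ 0 := by linarith
  have hp1 : p - 1 ≠ 0 := by linarith
  have h := Real.young_inequality_of_nonneg hA (Real.rpow_nonneg hB (p - 1))
    (Real.HolderConjugate.conjExponent hp)
  rw [← Real.rpow_mul hB, Real.conjExponent, mul_div_cancel₀ _ hp1] at h
  have h2 := mul_le_mul_of_nonneg_left h (by linarith : (0 : ℝ) ≤ p)
  calc p * (A * B ^ (p - 1)) ≤ p * (A ^ p / p + B ^ p / (p / (p - 1))) := h2
    _ = A ^ p + (p - 1) * B ^ p := by field_simp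

/-- The tangent line inequality for the convex function `|·| ^ p`. -/
theorem abs_rpow_sub_le {p : ℝ} (hp : 1 < p) (x c : ℝ) :
    |x| ^ p - p * c * (|x| ^ (p - 2) * x) ≤ |x - c| ^ p := by
  have hy := mul_rpow_sub_one_le hp (abs_nonneg (x - c)) (abs_nonneg x)
  have h1 := abs_rpow_mul_self_mul_self hp x
  have h2 : (x - c) * (|x| ^ (p - 2) * x) ≤ |x - c| * |x| ^ (p - 1) := by
    rw [← abs_abs_rpow_mul_self hp x, ← abs_mul]
    exact le_abs_self _
  have h3 := mul_le_mul_of_nonneg_left h2 (by linarith : (0 : ℝ) ≤ p)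
  nlinarith

/-- A consequence of convexity: a small additive error `η` inside the power costs a factor close to
`1` and a small additive error outside. -/
theorem add_rpow_le {p x η : ℝ} (hp : 1 < p) (hx : 0 ≤ x) (hη : 0 ≤ η) :
    (x + η) ^ p ≤ (1 + η) ^ (p - 1) * (x ^ p + η) := by
  have h1 : 0 < 1 + η := by linarith
  have hc := (convexOn_rpow hp.le).2 (mem_Ici.2 hx) (mem_Ici.2 zero_le_one)
    (by positivity : 0 ≤ 1 / (1 + η)) (by positivity : 0 ≤ η / (1 + η)) (by field_simp)
  simp only [smul_eq_mul, mul_one, Real.one_rpow] at hc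
  have e1 : 1 / (1 + η) * x + η / (1 + η) = (x + η) / (1 + η) := by field_simp
  have e2 : 1 / (1 + η) * x ^ p + η / (1 + η) = (x ^ p + η) / (1 + η) := by field_simp
  rw [e1, e2, Real.div_rpow (by positivity) h1.le] at hc
  rw [Real.rpow_sub_one h1.ne', div_mul_eq_mul_div, mul_div_assoc]
  rwa [div_le_iff₀ (by positivity), mul_comm] at hc

/-! ### Poincaré inequalities on an interval with a continuous weight -/

/-- `PoincareBound p a μ J` is the `p`-Poincaré inequality with constant `μ` on `[-a, a]` for the
weight `J`, tested on `C¹` functions. -/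
def PoincareBound (p a μ : ℝ) (J : ℝ → ℝ) : Prop :=
  ∀ F : ℝ → ℝ, ContDiff ℝ 1 F → ∫ x in -a..a, |F x| ^ (p - 2) * F x * J x = 0 →
    μ * ∫ x in -a..a, |F x| ^ p * J x ≤ ∫ x in -a..a, |deriv F x| ^ p * J x

section weighted

variable {p a : ℝ} {J : ℝ → ℝ}

theorem ContinuousOn.intervalIntegrable_neg_self {g : ℝ → ℝ} (ha : 0 < a)
    (hg : ContinuousOn g (Icc (-a) a)) : IntervalIntegrable g volume (-a) a :=
  ContinuousOn.intervalIntegrable (by rwa [uIcc_of_le (by linarith)])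

theorem continuousOn_abs_rpow_mul (hp : 1 < p) (hJ : ContinuousOn J (Icc (-a) a)) {F : ℝ → ℝ}
    (hF : ContinuousOn F (Icc (-a) a)) : ContinuousOn (fun x => |F x| ^ p * J x) (Icc (-a) a) :=
  (hF.abs.rpow_const fun _ _ => Or.inr (by linarith)).mul hJ

theorem continuousOn_abs_rpow_mul_self_mul (hp : 1 < p) (hJ : ContinuousOn J (Icc (-a) a))
    {F : ℝ → ℝ} (hF : ContinuousOn F (Icc (-a) a)) :
    ContinuousOn (fun x => |F x| ^ (p - 2) * F x * J x) (Icc (-a) a) :=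
  ((continuous_abs_rpow_mul_self hp).comp_continuousOn hF).mul hJ

theorem integral_abs_rpow_mul_nonneg (ha : 0 < a) (hJ0 : ∀ x ∈ Icc (-a) a, 0 < J x) (F : ℝ → ℝ) :
    0 ≤ ∫ x in -a..a, |F x| ^ p * J x :=
  intervalIntegral.integral_nonneg (by linarith) fun x hx =>
    mul_nonneg (Real.rpow_nonneg (abs_nonneg _) _) (hJ0 x hx).le

/-- Subtracting a constant decreases the weighted `L^p` norm of a function by at most the amount
dictated by its `p`-mean. -/
theorem integral_abs_rpow_sub_le (hp : 1 < p) (ha : 0 < a) (hJ : ContinuousOn J (Icc (-a) a))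
    (hJ0 : ∀ x ∈ Icc (-a) a, 0 < J x) {F : ℝ → ℝ} (hF : ContinuousOn F (Icc (-a) a)) (c : ℝ) :
    (∫ x in -a..a, |F x| ^ p * J x) - p * c * ∫ x in -a..a, |F x| ^ (p - 2) * F x * J x ≤
      ∫ x in -a..a, |F x - c| ^ p * J x := by
  have h1 := (continuousOn_abs_rpow_mul hp hJ hF).intervalIntegrable_neg_self ha
  have h2 := (continuousOn_abs_rpow_mul_self_mul hp hJ hF).intervalIntegrable_neg_self ha
  have h3 := (continuousOn_abs_rpow_mul hp hJ
    (hF.sub (continuousOn_const (c := c)))).intervalIntegrable_neg_self ha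
  rw [← intervalIntegral.integral_const_mul, ← intervalIntegral.integral_sub h1 (h2.const_mul _)]
  refine intervalIntegral.integral_mono_on (by linarith) (h1.sub (h2.const_mul _)) h3
    fun x hx => ?_
  have := mul_le_mul_of_nonneg_right (abs_rpow_sub_le hp (F x) c) (hJ0 x hx).le
  calc _ = (|F x| ^ p - p * c * (|F x| ^ (p - 2) * F x)) * J x := by ring
    _ ≤ _ := this

/-- A function whose `p`-mean vanishes has minimal weighted `L^p` norm among its translates by
constants. -/
theorem integral_abs_rpow_le_sub (hp : 1 < p) (ha : 0 < a) (hJ : ContinuousOn J (Icc (-a) a))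
    (hJ0 : ∀ x ∈ Icc (-a) a, 0 < J x) {F : ℝ → ℝ} (hF : ContinuousOn F (Icc (-a) a))
    (hM : ∫ x in -a..a, |F x| ^ (p - 2) * F x * J x = 0) (c : ℝ) :
    ∫ x in -a..a, |F x| ^ p * J x ≤ ∫ x in -a..a, |F x - c| ^ p * J x := by
  simpa [hM] using integral_abs_rpow_sub_le hp ha hJ hJ0 hF c

/-- Every continuous function has a `p`-mean, bounded by any bound for the function. -/
theorem exists_pMean (hp : 1 < p) (ha : 0 < a) (hJ : ContinuousOn J (Icc (-a) a))
    (hJ0 : ∀ x ∈ Icc (-a) a, 0 < J x) {F : ℝ → ℝ} (hF : Continuous F) {B : ℝ}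
    (hB : ∀ x ∈ Icc (-a) a, |F x| ≤ B) :
    ∃ c, |c| ≤ B ∧ ∫ x in -a..a, |F x - c| ^ (p - 2) * (F x - c) * J x = 0 := by
  have haa : -a ≤ a := by linarith
  have hB0 : 0 ≤ B := (abs_nonneg _).trans (hB a ⟨haa, le_rfl⟩)
  set Jh : ℝ → ℝ := IccExtend haa ((Icc (-a) a).domRestrict J) with hJh
  have hJhc : Continuous Jh := hJ.domRestrict.Icc_extend'
  have hJhe : ∀ x ∈ Icc (-a) a, Jh x = J x := fun x hx => by
    rw [hJh, IccExtend_of_mem haa _ hx]; rfl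
  have hcong : ∀ c, ∫ x in -a..a, |F x - c| ^ (p - 2) * (F x - c) * J x =
      ∫ x in -a..a, |F x - c| ^ (p - 2) * (F x - c) * Jh x := fun c =>
    intervalIntegral.integral_congr fun x hx => by
      rw [uIcc_of_le haa] at hx
      simp only [hJhe x hx]
  have hcont : Continuous fun c => ∫ x in -a..a, |F x - c| ^ (p - 2) * (F x - c) * Jh x := by
    refine intervalIntegral.continuous_parametric_intervalIntegral_of_continuous' (f := fun c x =>
      |F x - c| ^ (p - 2) * (F x - c) * Jh x) ?_ _ _
    exact ((continuous_abs_rpow_mul_self hp).comp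
      ((hF.comp continuous_snd).sub continuous_fst)).mul (hJhc.comp continuous_snd)
  have hlo : 0 ≤ ∫ x in -a..a, |F x - (-B)| ^ (p - 2) * (F x - (-B)) * Jh x :=
    intervalIntegral.integral_nonneg haa fun x hx => by
      have := (abs_le.1 (hB x hx)).1
      rw [hJhe x hx]
      exact mul_nonneg (mul_nonneg (Real.rpow_nonneg (abs_nonneg _) _) (by linarith)) (hJ0 x hx).le
  have hhi : ∫ x in -a..a, |F x - B| ^ (p - 2) * (F x - B) * Jh x ≤ 0 := by
    rw [← neg_nonneg, ← intervalIntegral.integral_neg]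
    refine intervalIntegral.integral_nonneg haa fun x hx => ?_
    have := (abs_le.1 (hB x hx)).2
    rw [hJhe x hx, ← neg_mul, ← mul_neg]
    exact mul_nonneg (mul_nonneg (Real.rpow_nonneg (abs_nonneg _) _) (by linarith)) (hJ0 x hx).le
  obtain ⟨c, hc, h0⟩ := intermediate_value_Icc' (by linarith : -B ≤ B) hcont.continuousOn
    ⟨hhi, hlo⟩
  exact ⟨c, abs_le.2 hc, by rw [hcong]; exact h0⟩

/-- Passage to the limit in a Poincaré inequality: it suffices to approximate `F`, up to additive
constants, uniformly on `[-a, a]`. -/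
theorem mul_integral_le_of_forall_approx {μ E C : ℝ} (hp : 1 < p) (ha : 0 < a) (hμ : 0 ≤ μ)
    (hJ : ContinuousOn J (Icc (-a) a)) (hJ0 : ∀ x ∈ Icc (-a) a, 0 < J x) {F : ℝ → ℝ}
    (hF : ContinuousOn F (Icc (-a) a)) (hM : ∫ x in -a..a, |F x| ^ (p - 2) * F x * J x = 0)
    (h : ∀ ε : ℝ, 0 < ε → ∃ G : ℝ → ℝ, ContinuousOn G (Icc (-a) a) ∧
      (∃ k, ∀ x ∈ Icc (-a) a, |G x - (F x - k)| ≤ ε) ∧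
      μ * ∫ x in -a..a, |G x| ^ p * J x ≤ (1 + ε) ^ (p - 1) * (E + ε * C)) :
    μ * ∫ x in -a..a, |F x| ^ p * J x ≤ E := by
  set T := ∫ x in -a..a, J x
  have hlim : Filter.Tendsto
      (fun ε : ℝ => (1 + ε) ^ (p - 1) * ((1 + ε) ^ (p - 1) * (E + ε * C) + μ * (ε * T)))
      (nhdsWithin 0 (Ioi 0)) (nhds E) := by
    have hc : ContinuousAt
        (fun ε : ℝ => (1 + ε) ^ (p - 1) * ((1 + ε) ^ (p - 1) * (E + ε * C) + μ * (ε * T))) 0 := by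
      have : ContinuousAt (fun ε : ℝ => (1 + ε) ^ (p - 1)) 0 :=
        (continuousAt_const.add continuousAt_id).rpow_const (Or.inr (by linarith))
      exact this.mul ((this.mul (by fun_prop)).add (by fun_prop))
    have := hc.tendsto
    simp only [add_zero, Real.one_rpow, zero_mul, mul_zero, one_mul] at this
    exact this.mono_left nhdsWithin_le_nhds
  refine ge_of_tendsto hlim (Filter.eventually_of_mem self_mem_nhdsWithin fun ε hε => ?_)
  have hε : 0 < ε := hε
  obtain ⟨G, hG, ⟨k, hk⟩, hGE⟩ := h ε hε
  have hJi := hJ.intervalIntegrable_neg_self ha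
  have hGi := (continuousOn_abs_rpow_mul hp hJ hG).intervalIntegrable_neg_self ha
  have hFi := (continuousOn_abs_rpow_mul hp hJ
    (hF.sub (continuousOn_const (c := k)))).intervalIntegrable_neg_self ha
  have h1 : ∫ x in -a..a, |F x - k| ^ p * J x ≤
      (1 + ε) ^ (p - 1) * ((∫ x in -a..a, |G x| ^ p * J x) + ε * T) := by
    rw [← intervalIntegral.integral_const_mul, ← intervalIntegral.integral_add hGi
      (hJi.const_mul ε), ← intervalIntegral.integral_const_mul]
    refine intervalIntegral.integral_mono_on (by linarith) hFi
      ((hGi.add (hJi.const_mul ε)).const_mul _) fun x hx => ?_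
    have hx1 : |F x - k| ≤ |G x| + ε := by
      have := hk x hx
      rw [abs_sub_comm] at this
      calc |F x - k| = |(F x - k - G x) + G x| := by ring_nf
        _ ≤ |F x - k - G x| + |G x| := abs_add_le _ _
        _ ≤ |G x| + ε := by linarith
    have := mul_le_mul_of_nonneg_right
      ((Real.rpow_le_rpow (abs_nonneg _) hx1 (by linarith : (0 : ℝ) ≤ p)).trans
        (add_rpow_le hp (abs_nonneg (G x)) hε.le)) (hJ0 x hx).le
    calc _ ≤ _ := this
      _ = _ := by ring
  have h2 := (integral_abs_rpow_le_sub hp ha hJ hJ0 hF hM k).trans h1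
  have hpos : (0 : ℝ) ≤ (1 + ε) ^ (p - 1) := by positivity
  calc μ * ∫ x in -a..a, |F x| ^ p * J x
      ≤ μ * ((1 + ε) ^ (p - 1) * ((∫ x in -a..a, |G x| ^ p * J x) + ε * T)) :=
        mul_le_mul_of_nonneg_left h2 hμ
    _ = (1 + ε) ^ (p - 1) * (μ * (∫ x in -a..a, |G x| ^ p * J x) + μ * (ε * T)) := by ring
    _ ≤ _ := by gcongr

/-- Poincaré inequalities are reflected along with the weight. -/
theorem PoincareBound.comp_neg {μ : ℝ} (h : PoincareBound p a μ J) :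
    PoincareBound p a μ fun x => J (-x) := by
  intro F hF hM
  have hn : ∀ g : ℝ → ℝ, ∫ x in -a..a, g (-x) = ∫ x in -a..a, g x := fun g => by simp
  have hd : ∀ x, |deriv (fun y => F (-y)) x| = |deriv F (-x)| := fun x => by
    rw [deriv_comp_neg, abs_neg]
  have := h (fun x => F (-x)) (hF.comp contDiff_neg) (by
    rw [← hn]; simpa using hM)
  simp only [hd] at this
  rw [← hn fun x => |F (-x)| ^ p * J x, ← hn fun x => |deriv F (-x)| ^ p * J x] at this
  simpa using this

/-- Poincaré inequalities are inherited by smaller intervals: functions on the smaller interval are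
extended by constants. -/
theorem PoincareBound.mono_interval {b μ : ℝ} (hp : 1 < p) (ha : 0 < a) (hab : a ≤ b)
    (hμ : 0 ≤ μ) (hJ : ContinuousOn J (Icc (-b) b)) (hJ0 : ∀ x ∈ Icc (-b) b, 0 < J x)
    (h : PoincareBound p b μ J) : PoincareBound p a μ J := by
  intro F hF hM
  have hb : 0 < b := ha.trans_le hab
  have hsub : Icc (-a) a ⊆ Icc (-b) b := Icc_subset_Icc (by linarith) hab
  have hJa := hJ.mono hsub
  have hJa0 : ∀ x ∈ Icc (-a) a, 0 < J x := fun x hx => hJ0 x (hsub hx)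
  have hdF : Continuous (deriv F) := hF.continuous_deriv le_rfl
  obtain ⟨B, hB⟩ := isCompact_Icc.exists_bound_of_continuousOn (s := Icc (-a) a) hdF.continuousOn
  have hB0 : 0 ≤ B := (norm_nonneg _).trans (hB a ⟨by linarith, le_rfl⟩)
  refine mul_integral_le_of_forall_approx (C := 0) hp ha hμ hJa hJa0 hF.continuous.continuousOn hM
    fun ε hε => ?_
  -- The cutoff `χ x = (1 - (x / a) ^ (2 m + 2))₊` turns `F'` into a continuous
  -- function supported in `[-a, a]`.
  obtain ⟨m, hm⟩ := exists_nat_gt (2 * a * B / ε)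
  set χ : ℝ → ℝ := fun x => max 0 (1 - (x / a) ^ (2 * m + 2)) with hχ
  have hpow : ∀ x ∈ Icc (-a) a, (x / a) ^ (2 * m + 2) ≤ 1 := fun x hx => by
    rw [show 2 * m + 2 = 2 * (m + 1) by ring, pow_mul]
    exact pow_le_one₀ (sq_nonneg _) ((sq_le_one_iff_abs_le_one _).2 (by
      rw [abs_div, abs_of_pos ha, div_le_one ha]; exact abs_le.2 hx))
  have hpow0 : ∀ x, (0 : ℝ) ≤ (x / a) ^ (2 * m + 2) := fun x => by
    rw [show 2 * m + 2 = 2 * (m + 1) by ring, pow_mul]; positivity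
  have hχin : ∀ x ∈ Icc (-a) a, χ x = 1 - (x / a) ^ (2 * m + 2) := fun x hx =>
    max_eq_right (by linarith [hpow x hx])
  have hχout : ∀ x, x ∉ Icc (-a) a → χ x = 0 := fun x hx => by
    refine max_eq_left (sub_nonpos.2 ?_)
    rw [show 2 * m + 2 = 2 * (m + 1) by ring, pow_mul]
    refine one_le_pow₀ ((one_le_sq_iff_one_le_abs _).2 ?_)
    rw [abs_div, abs_of_pos ha, one_le_div ha]
    by_contra! hlt
    exact hx (abs_le.1 hlt.le)
  have hχ0 : ∀ x, 0 ≤ χ x := fun x => le_max_left _ _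
  have hχ1 : ∀ x, χ x ≤ 1 := fun x => max_le zero_le_one (by linarith [hpow0 x])
  have hχc : Continuous χ := by fun_prop
  have huc : Continuous fun x => deriv F x * χ x := hdF.mul hχc
  set G₀ : ℝ → ℝ := fun x => ∫ t in (0 : ℝ)..x, deriv F t * χ t with hG₀
  have hG₀d : ∀ x, HasDerivAt G₀ (deriv F x * χ x) x := fun x =>
    intervalIntegral.integral_hasDerivAt_right (huc.intervalIntegrable _ _)
      (huc.stronglyMeasurableAtFilter _ _) huc.continuousAt
  have hG₀' : deriv G₀ = fun x => deriv F x * χ x := funext fun x => (hG₀d x).deriv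
  have hG₀1 : ContDiff ℝ 1 G₀ := by
    rw [contDiff_one_iff_deriv]
    exact ⟨fun x => (hG₀d x).differentiableAt, by rw [hG₀']; exact huc⟩
  obtain ⟨B', hB'⟩ := isCompact_Icc.exists_bound_of_continuousOn (s := Icc (-b) b)
    hG₀1.continuous.continuousOn
  obtain ⟨c, -, hc⟩ := exists_pMean hp hb hJ hJ0 hG₀1.continuous hB'
  have hbound := h (fun x => G₀ x - c) (hG₀1.sub contDiff_const) hc
  have hGcont : Continuous fun x => G₀ x - c := hG₀1.continuous.sub continuous_const
  refine ⟨fun x => G₀ x - c, hGcont.continuousOn, ⟨F 0 + c, fun x hx => ?_⟩, ?_⟩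
  · have hFi : F x - F 0 = ∫ t in (0 : ℝ)..x, deriv F t :=
      (intervalIntegral.integral_deriv_eq_sub
        (fun t _ => (hF.differentiable one_ne_zero).differentiableAt)
        (hdF.intervalIntegrable _ _)).symm
    have e1 : G₀ x - c - (F x - (F 0 + c)) = ∫ t in (0 : ℝ)..x, deriv F t * (χ t - 1) := by
      have : ∫ t in (0 : ℝ)..x, deriv F t * (χ t - 1) =
          (∫ t in (0 : ℝ)..x, deriv F t * χ t) - ∫ t in (0 : ℝ)..x, deriv F t := by
        rw [← intervalIntegral.integral_sub (huc.intervalIntegrable _ _)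
          (hdF.intervalIntegrable _ _)]
        congr 1; ext t; ring
      rw [this, ← hFi]; ring
    have hci : Continuous fun t => B * (t / a) ^ (2 * m + 2) := by fun_prop
    have e2 : ∫ t in -a..a, B * (t / a) ^ (2 * m + 2) = B * (2 * a / (2 * m + 3)) := by
      rw [intervalIntegral.integral_const_mul]
      simp only [div_pow]
      rw [intervalIntegral.integral_div, integral_pow]
      have : (-a) ^ (2 * m + 2 + 1) = -a ^ (2 * m + 2 + 1) := Odd.neg_pow ⟨m + 1, by ring⟩ a
      rw [this, pow_succ]
      push_cast
      field_simp
      ring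
    rw [e1, ← Real.norm_eq_abs]
    calc ‖∫ t in (0 : ℝ)..x, deriv F t * (χ t - 1)‖
        ≤ |∫ t in (0 : ℝ)..x, B * (t / a) ^ (2 * m + 2)| := by
          refine intervalIntegral.norm_integral_le_abs_of_norm_le ?_ (hci.intervalIntegrable _ _)
          refine (ae_restrict_iff' measurableSet_uIoc).2
            (Filter.Eventually.of_forall fun t ht => ?_)
          have ht' : t ∈ Icc (-a) a := by
            have := uIoc_subset_uIcc ht
            rcases le_total 0 x with h0 | h0
            · rw [uIcc_of_le h0] at this
              exact ⟨by linarith [this.1], this.2.trans hx.2⟩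
            · rw [uIcc_of_ge h0] at this
              exact ⟨hx.1.trans this.1, by linarith [this.2]⟩
          rw [hχin t ht', norm_mul]
          have : ‖1 - (t / a) ^ (2 * m + 2) - 1‖ = (t / a) ^ (2 * m + 2) := by
            rw [Real.norm_eq_abs,
              show 1 - (t / a) ^ (2 * m + 2) - 1 = -(t / a) ^ (2 * m + 2) by ring,
              abs_neg, abs_of_nonneg (hpow0 t)]
          rw [this]
          exact mul_le_mul_of_nonneg_right (hB t ht') (hpow0 t)
      _ ≤ ∫ t in -a..a, B * (t / a) ^ (2 * m + 2) := by
          rw [abs_le]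
          have hnn : ∀ t, 0 ≤ B * (t / a) ^ (2 * m + 2) := fun t => mul_nonneg hB0 (hpow0 t)
          rcases le_total 0 x with h0 | h0
          · have := intervalIntegral.integral_mono_interval (c := -a) (d := a) (μ := volume)
              (by linarith : -a ≤ 0) h0 hx.2 (Filter.Eventually.of_forall hnn)
              (hci.intervalIntegrable _ _)
            have := intervalIntegral.integral_nonneg (μ := volume) h0 fun t _ => hnn t
            constructor <;> linarith
          · have := intervalIntegral.integral_mono_interval (c := -a) (d := a) (μ := volume)
              hx.1 h0 ha.le (Filter.Eventually.of_forall hnn) (hci.intervalIntegrable _ _)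
            have := intervalIntegral.integral_nonneg (μ := volume) h0 fun t _ => hnn t
            rw [intervalIntegral.integral_symm x 0]
            constructor <;> linarith
      _ = B * (2 * a / (2 * m + 3)) := e2
      _ ≤ ε := by
          rw [div_lt_iff₀ hε] at hm
          rw [← mul_div_assoc, div_le_iff₀ (by positivity)]
          nlinarith
  · have hmono : ∫ x in -a..a, |G₀ x - c| ^ p * J x ≤ ∫ x in -b..b, |G₀ x - c| ^ p * J x :=
      intervalIntegral.integral_mono_interval (by linarith) (by linarith) hab
        ((ae_restrict_iff' measurableSet_Ioc).2 (Filter.Eventually.of_forall fun x hx =>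
          mul_nonneg (Real.rpow_nonneg (abs_nonneg _) _) (hJ0 x ⟨hx.1.le, hx.2⟩).le))
        ((continuousOn_abs_rpow_mul hp hJ hGcont.continuousOn).intervalIntegrable_neg_self hb)
    have hder : ∀ x, deriv (fun x => G₀ x - c) x = deriv F x * χ x := fun x => by
      rw [deriv_sub_const, hG₀']
    have hcF := continuousOn_abs_rpow_mul hp hJ huc.continuousOn
    have hE : ∫ x in -b..b, |deriv F x * χ x| ^ p * J x ≤ ∫ x in -a..a, |deriv F x| ^ p * J x := by
      have hz : ∀ x, x ∉ Icc (-a) a → |deriv F x * χ x| ^ p * J x = 0 := fun x hx => by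
        rw [hχout x hx]; simp [Real.zero_rpow (by linarith : p ≠ 0)]
      have hcut : ∫ x in -b..b, |deriv F x * χ x| ^ p * J x =
          ∫ x in -a..a, |deriv F x * χ x| ^ p * J x := by
        rw [intervalIntegral.integral_of_le (by linarith), intervalIntegral.integral_of_le
          (by linarith), ← integral_Icc_eq_integral_Ioc, ← integral_Icc_eq_integral_Ioc]
        exact setIntegral_eq_of_subset_of_forall_sdiff_eq_zero measurableSet_Icc hsub
          fun x hx => hz x hx.2
      rw [hcut]
      refine intervalIntegral.integral_mono_on (by linarith)
        ((hcF.mono hsub).intervalIntegrable_neg_self ha)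
        ((continuousOn_abs_rpow_mul hp hJa hdF.continuousOn).intervalIntegrable_neg_self ha)
        fun x hx => ?_
      refine mul_le_mul_of_nonneg_right (Real.rpow_le_rpow (abs_nonneg _) ?_ (by linarith))
        (hJa0 x hx).le
      rw [abs_mul, abs_of_nonneg (hχ0 x)]
      exact mul_le_of_le_one_right (abs_nonneg _) (hχ1 x)
    simp only [hder] at hbound
    have h0 := integral_abs_rpow_mul_nonneg (p := p) ha hJa0 (deriv F)
    have h1 : (1 : ℝ) ≤ (1 + ε) ^ (p - 1) := Real.one_le_rpow (by linarith) (by linarith)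
    calc μ * ∫ x in -a..a, |G₀ x - c| ^ p * J x
        ≤ μ * ∫ x in -b..b, |G₀ x - c| ^ p * J x := mul_le_mul_of_nonneg_left hmono hμ
      _ ≤ ∫ x in -a..a, |deriv F x| ^ p * J x := hbound.trans hE
      _ ≤ (1 + ε) ^ (p - 1) * ((∫ x in -a..a, |deriv F x| ^ p * J x) + ε * 0) := by
        rw [mul_zero, add_zero]; exact le_mul_of_one_le_left h0 h1

end weighted

/-! ### The Poincaré constant of a measure with a continuous density on an interval -/

section bridge

variable {p a : ℝ} {J : ℝ → ℝ} {j : ℝ → ℝ≥0∞}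

theorem withDensity_indicator_Icc_eq (hj : ∀ x ∈ Icc (-a) a, j x = ENNReal.ofReal (J x)) :
    volume.withDensity (indicator (Icc (-a) a) j) =
      (volume.restrict (Icc (-a) a)).withDensity fun x => ENNReal.ofReal (J x) := by
  rw [← withDensity_indicator measurableSet_Icc]
  congr 1
  exact indicator_congr hj

theorem integral_withDensity_indicator_Icc (ha : 0 < a) (hJ : ContinuousOn J (Icc (-a) a))
    (hJ0 : ∀ x ∈ Icc (-a) a, 0 < J x) (hj : ∀ x ∈ Icc (-a) a, j x = ENNReal.ofReal (J x))
    (g : ℝ → ℝ) :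
    ∫ x, g x ∂(volume.withDensity (indicator (Icc (-a) a) j)) = ∫ x in -a..a, g x * J x := by
  rw [withDensity_indicator_Icc_eq hj, integral_withDensity_eq_integral_toReal_smul₀
    (hJ.aemeasurable measurableSet_Icc).ennreal_ofReal
    (Filter.Eventually.of_forall fun _ => ENNReal.ofReal_lt_top),
    intervalIntegral.integral_of_le (by linarith), ← integral_Icc_eq_integral_Ioc]
  refine setIntegral_congr_fun measurableSet_Icc fun x hx => ?_
  simp only [smul_eq_mul]
  rw [ENNReal.toReal_ofReal (hJ0 x hx).le, mul_comm]

theorem lintegral_withDensity_indicator_Icc (hp : 1 < p) (ha : 0 < a)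
    (hJ : ContinuousOn J (Icc (-a) a)) (hJ0 : ∀ x ∈ Icc (-a) a, 0 < J x)
    (hj : ∀ x ∈ Icc (-a) a, j x = ENNReal.ofReal (J x)) {g : ℝ → ℝ} (hg : Continuous g) :
    ∫⁻ x, ‖g x‖ₑ ^ p ∂(volume.withDensity (indicator (Icc (-a) a) j)) =
      ENNReal.ofReal (∫ x in -a..a, |g x| ^ p * J x) := by
  have hint : IntegrableOn (fun x => |g x| ^ p * J x) (Icc (-a) a) :=
    (continuousOn_abs_rpow_mul hp hJ hg.continuousOn).integrableOn_Icc
  have hnn : ∀ᵐ x ∂(volume.restrict (Icc (-a) a)), (0 : ℝ) ≤ |g x| ^ p * J x :=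
    (ae_restrict_iff' measurableSet_Icc).2 (Filter.Eventually.of_forall fun x hx =>
      mul_nonneg (Real.rpow_nonneg (abs_nonneg _) _) (hJ0 x hx).le)
  rw [withDensity_indicator_Icc_eq hj, lintegral_withDensity_eq_lintegral_mul₀
    (hJ.aemeasurable measurableSet_Icc).ennreal_ofReal
    (by fun_prop), intervalIntegral.integral_of_le (by linarith), ← integral_Icc_eq_integral_Ioc,
    ofReal_integral_eq_lintegral_ofReal hint hnn]
  refine setLIntegral_congr_fun measurableSet_Icc fun x hx => ?_
  simp only [Pi.mul_apply]
  rw [← ofReal_norm, Real.norm_eq_abs, ENNReal.ofReal_rpow_of_nonneg (abs_nonneg _) (by linarith),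
    ← ENNReal.ofReal_mul (hJ0 x hx).le, mul_comm]

/-- Smooth functions with vanishing `p`-mean become admissible test functions after multiplication
by a cutoff that equals `1` near the interval. -/
theorem exists_pTestFunction (hp : 1 < p) (ha : 0 < a) (hJ : ContinuousOn J (Icc (-a) a))
    (hJ0 : ∀ x ∈ Icc (-a) a, 0 < J x) (hj : ∀ x ∈ Icc (-a) a, j x = ENNReal.ofReal (J x))
    {G : ℝ → ℝ} (hG : ContDiff ℝ ∞ G) (hM : ∫ x in -a..a, |G x| ^ (p - 2) * G x * J x = 0)
    (hN : 0 < ∫ x in -a..a, |G x| ^ p * J x) :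
    ∃ f ∈ pTestFunctions p (volume.withDensity (indicator (Icc (-a) a) j)),
      pRayleigh p (volume.withDensity (indicator (Icc (-a) a) j)) f =
        ENNReal.ofReal (∫ x in -a..a, |deriv G x| ^ p * J x) /
          ENNReal.ofReal (∫ x in -a..a, |G x| ^ p * J x) := by
  have haa : -a ≤ a := by linarith
  let χ : ContDiffBump (0 : ℝ) := ⟨a + 1, a + 2, by linarith, by linarith⟩
  have hfs : ContDiff ℝ ∞ fun x => χ x * G x := χ.contDiff.mul hG
  have hball : ∀ x ∈ Icc (-a) a, x ∈ Metric.ball (0 : ℝ) χ.rIn := fun x hx => by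
    rw [Metric.mem_ball, Real.dist_eq, sub_zero]
    exact (abs_le.2 hx).trans_lt (by change a < a + 1; linarith)
  have heq : ∀ x ∈ Icc (-a) a, (fun x => χ x * G x) =ᶠ[nhds x] G := fun x hx => by
    filter_upwards [χ.eventuallyEq_one_of_mem_ball (hball x hx)] with y hy
    simp [hy]
  have hval : ∀ x ∈ Icc (-a) a, χ x * G x = G x := fun x hx => (heq x hx).eq_of_nhds
  have hcongr : ∀ Φ : ℝ → ℝ → ℝ, ∫ x in -a..a, Φ (χ x * G x) x = ∫ x in -a..a, Φ (G x) x :=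
    fun Φ => intervalIntegral.integral_congr fun x hx => by
      rw [uIcc_of_le haa] at hx
      simp only [hval x hx]
  have hcongr' : ∫ x in -a..a, |deriv (fun x => χ x * G x) x| ^ p * J x =
      ∫ x in -a..a, |deriv G x| ^ p * J x :=
    intervalIntegral.integral_congr fun x hx => by
      rw [uIcc_of_le haa] at hx
      simp only [(heq x hx).deriv_eq]
  have hNe := hcongr fun y x => |y| ^ p * J x
  refine ⟨fun x => χ x * G x, ⟨?_, hfs, χ.hasCompactSupport.mul_right, ?_⟩, ?_⟩
  · intro h0
    have h0' : ∀ x, χ x * G x = 0 := fun x => congrFun h0 x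
    rw [← hNe] at hN
    simp [h0', Real.zero_rpow (by linarith : p ≠ 0)] at hN
  · rw [integral_withDensity_indicator_Icc ha hJ hJ0 hj]
    exact (hcongr fun y x => |y| ^ (p - 2) * y * J x).trans hM
  · have h1 := lintegral_withDensity_indicator_Icc hp ha hJ hJ0 hj hfs.continuous
    have h2 := lintegral_withDensity_indicator_Icc hp ha hJ hJ0 hj
      (hfs.continuous_deriv (by simp))
    rw [pRayleigh, h1, h2, hNe, hcongr', if_neg]
    rwa [ENNReal.ofReal_eq_zero, not_le]

theorem pPoincareConst_lt_top (hp : 1 < p) (ha : 0 < a) (hJ : ContinuousOn J (Icc (-a) a))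
    (hJ0 : ∀ x ∈ Icc (-a) a, 0 < J x) (hj : ∀ x ∈ Icc (-a) a, j x = ENNReal.ofReal (J x)) :
    pPoincareConst p (volume.withDensity (indicator (Icc (-a) a) j)) < ⊤ := by
  obtain ⟨c, -, hc⟩ := exists_pMean hp ha hJ hJ0 continuous_id (B := a) fun x hx => abs_le.2 hx
  have hN : 0 < ∫ x in -a..a, |x - c| ^ p * J x := by
    refine intervalIntegral.integral_pos (by linarith)
      (continuousOn_abs_rpow_mul hp hJ (F := fun x => x - c) (by fun_prop))
      (fun x hx => mul_nonneg (Real.rpow_nonneg (abs_nonneg _) _) (hJ0 x ⟨hx.1.le, hx.2⟩).le) ?_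
    have hpos : ∀ x ∈ Icc (-a) a, x ≠ c → 0 < |x - c| ^ p * J x := fun x hx hne =>
      mul_pos (Real.rpow_pos_of_pos (abs_pos.2 (sub_ne_zero.2 hne)) _) (hJ0 x hx)
    by_cases hac : a = c
    · exact ⟨-a, ⟨le_rfl, by linarith⟩, hpos _ ⟨le_rfl, by linarith⟩ (by linarith)⟩
    · exact ⟨a, ⟨by linarith, le_rfl⟩, hpos _ ⟨by linarith, le_rfl⟩ hac⟩
  obtain ⟨f, hf, hR⟩ := exists_pTestFunction hp ha hJ hJ0 hj (G := fun x => x - c)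
    (by fun_prop) hc hN
  refine (iInf₂_le f hf).trans_lt ?_
  rw [hR]
  exact ENNReal.div_lt_top ENNReal.ofReal_ne_top (ENNReal.ofReal_pos.2 hN).ne'

/-- Lower bounds for the Poincaré constant of a measure with continuous positive density on
`[-a, a]` are the same as Poincaré inequalities for `C¹` functions on that interval. -/
theorem ofReal_le_pPoincareConst_iff {μ : ℝ} (hp : 1 < p) (ha : 0 < a) (hμ : 0 ≤ μ)
    (hJ : ContinuousOn J (Icc (-a) a)) (hJ0 : ∀ x ∈ Icc (-a) a, 0 < J x)
    (hj : ∀ x ∈ Icc (-a) a, j x = ENNReal.ofReal (J x)) :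
    ENNReal.ofReal μ ≤ pPoincareConst p (volume.withDensity (indicator (Icc (-a) a) j)) ↔
      PoincareBound p a μ J := by
  have haa : -a ≤ a := by linarith
  constructor
  · intro h
    have hsmooth : ∀ G : ℝ → ℝ, ContDiff ℝ ∞ G →
        ∫ x in -a..a, |G x| ^ (p - 2) * G x * J x = 0 →
        μ * ∫ x in -a..a, |G x| ^ p * J x ≤ ∫ x in -a..a, |deriv G x| ^ p * J x := by
      intro G hG hM
      have hE := integral_abs_rpow_mul_nonneg (p := p) ha hJ0 (deriv G)
      rcases (integral_abs_rpow_mul_nonneg (p := p) ha hJ0 G).eq_or_lt with hN | hN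
      · rw [← hN, mul_zero]; exact hE
      · obtain ⟨f, hf, hR⟩ := exists_pTestFunction hp ha hJ hJ0 hj hG hM hN
        have := h.trans (iInf₂_le f hf)
        rw [hR, ENNReal.le_div_iff_mul_le (Or.inl (ENNReal.ofReal_pos.2 hN).ne')
          (Or.inl ENNReal.ofReal_ne_top), ← ENNReal.ofReal_mul hμ,
          ENNReal.ofReal_le_ofReal_iff hE] at this
        exact this
    -- A `C¹` function is approximated by a primitive of a polynomial close to its derivative.
    intro F hF hM
    refine mul_integral_le_of_forall_approx (C := ∫ x in -a..a, J x) hp ha hμ hJ hJ0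
      hF.continuous.continuousOn hM fun ε hε => ?_
    have hdF : Continuous (deriv F) := hF.continuous_deriv le_rfl
    obtain ⟨P, hP⟩ := exists_polynomial_near_of_continuousOn (-a) a (deriv F)
      hdF.continuousOn (min ε (ε / a)) (by positivity)
    set G₀ : ℝ → ℝ := fun x => ∫ t in (0 : ℝ)..x, P.eval t with hG₀
    have hG₀d : ∀ x, HasDerivAt G₀ (P.eval x) x := fun x =>
      intervalIntegral.integral_hasDerivAt_right (P.continuous.intervalIntegrable _ _)
        (P.continuous.stronglyMeasurableAtFilter _ _) P.continuous.continuousAt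
    have hG₀' : deriv G₀ = fun x => P.eval x := funext fun x => (hG₀d x).deriv
    have hG₀s : ContDiff ℝ ∞ G₀ := by
      rw [contDiff_infty_iff_deriv]
      refine ⟨fun x => (hG₀d x).differentiableAt, ?_⟩
      rw [hG₀']
      simpa [Polynomial.coe_aeval_eq_eval] using P.contDiff_aeval (𝕜 := ℝ) ∞
    obtain ⟨B, hB⟩ := isCompact_Icc.exists_bound_of_continuousOn (s := Icc (-a) a)
      hG₀s.continuous.continuousOn
    obtain ⟨c, -, hc⟩ := exists_pMean hp ha hJ hJ0 hG₀s.continuous hB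
    have hb := hsmooth (fun x => G₀ x - c) (hG₀s.sub contDiff_const) hc
    refine ⟨fun x => G₀ x - c, (hG₀s.continuous.sub continuous_const).continuousOn,
      ⟨F 0 + c, fun x hx => ?_⟩, hb.trans ?_⟩
    · have hmv := Convex.norm_image_sub_le_of_norm_hasDerivWithin_le (f := fun x => G₀ x - F x)
        (f' := fun x => P.eval x - deriv F x) (C := ε / a) (s := Icc (-a) a) (x := 0) (y := x)
        (fun y _ => ((hG₀d y).sub
          (hF.differentiable one_ne_zero).differentiableAt.hasDerivAt).hasDerivWithinAt)
        (fun y hy => ((hP y hy).trans_le (min_le_right _ _)).le) (convex_Icc _ _)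
        ⟨by linarith, ha.le⟩ hx
      have hG0 : G₀ 0 = 0 := by simp [hG₀]
      rw [hG0, Real.norm_eq_abs, Real.norm_eq_abs, sub_zero] at hmv
      calc |G₀ x - c - (F x - (F 0 + c))| = |G₀ x - F x - (0 - F 0)| := by congr 1; ring
        _ ≤ ε / a * |x| := hmv
        _ ≤ ε / a * a := by gcongr; exact abs_le.2 hx
        _ = ε := by field_simp
    · have hder : ∀ x, deriv (fun x => G₀ x - c) x = P.eval x := fun x => by
        rw [deriv_sub_const, hG₀']
      simp only [hder]
      have i1 := (continuousOn_abs_rpow_mul hp hJ hdF.continuousOn).intervalIntegrable_neg_self ha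
      have i2 := hJ.intervalIntegrable_neg_self ha
      rw [← intervalIntegral.integral_const_mul, ← intervalIntegral.integral_add i1
        (i2.const_mul ε), ← intervalIntegral.integral_const_mul]
      refine intervalIntegral.integral_mono_on haa
        ((continuousOn_abs_rpow_mul hp hJ P.continuous.continuousOn).intervalIntegrable_neg_self ha)
        ((i1.add (i2.const_mul ε)).const_mul _) fun x hx => ?_
      have hx1 : |P.eval x| ≤ |deriv F x| + ε := by
        have := (hP x hx).trans_le (min_le_left _ _)
        calc |P.eval x| = |(P.eval x - deriv F x) + deriv F x| := by ring_nf
          _ ≤ |P.eval x - deriv F x| + |deriv F x| := abs_add_le _ _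
          _ ≤ _ := by linarith
      have := mul_le_mul_of_nonneg_right
        ((Real.rpow_le_rpow (abs_nonneg _) hx1 (by linarith : (0 : ℝ) ≤ p)).trans
          (add_rpow_le hp (abs_nonneg (deriv F x)) hε.le)) (hJ0 x hx).le
      calc _ ≤ _ := this
        _ = _ := by ring
  · intro h
    refine le_iInf₂ fun f hf => ?_
    obtain ⟨-, hfs, -, hM⟩ := hf
    rw [pRayleigh]
    split_ifs with h0
    · exact le_top
    · rw [lintegral_withDensity_indicator_Icc hp ha hJ hJ0 hj hfs.continuous] at h0 ⊢
      rw [lintegral_withDensity_indicator_Icc hp ha hJ hJ0 hj (hfs.continuous_deriv (by simp)),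
        ENNReal.le_div_iff_mul_le (Or.inl h0) (Or.inl ENNReal.ofReal_ne_top),
        ← ENNReal.ofReal_mul hμ]
      rw [integral_withDensity_indicator_Icc ha hJ hJ0 hj] at hM
      exact ENNReal.ofReal_le_ofReal (h f (hfs.of_le (by simp)) hM)

end bridge

/-! ### The Riccati field of the `p`-Laplace eigenvalue equation -/

/-- The right-hand side of the Riccati equation `σ' = sigmaField p ν (ψ x) σ` satisfied by
`σ = ν f / f'` when `f` solves the one-dimensional weighted `p`-Laplace eigenvalue equation with
eigenvalue `ν ^ p` and `ψ` is the logarithmic derivative of the weight. -/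
noncomputable def sigmaField (p ν k s : ℝ) : ℝ := (ν * (p - 1 + |s| ^ p) + k * s) / (p - 1)

theorem sigmaField_neg (p ν k s : ℝ) : sigmaField p ν (-k) (-s) = sigmaField p ν k s := by
  simp [sigmaField]

/-- The differential form of Picone's inequality behind `mul_integral_le_of_sigmaField_mul_le`. -/
theorem picone_deriv_le {p ν s j k y u v : ℝ} (hp : 1 < p) (hν : 0 < ν) (hs : 0 < s) (hj : 0 ≤ j)
    (hy : 0 ≤ y) (h : sigmaField p ν k s * y ≤ 1) :
    (k * j * y * s ^ (1 - p) + j * ((1 - p) * s ^ (1 - p - 1))) * |u| ^ p +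
      j * s ^ (1 - p) * (p * |u| ^ (p - 2) * u * (v * y)) ≤
      (ν / ν ^ p * (|v| ^ p * j) - ν * (|u| ^ p * j)) * y := by
  have hsp : 0 < s ^ p := Real.rpow_pos_of_pos hs p
  have hνp : 0 < ν ^ p := Real.rpow_pos_of_pos hν p
  have e1 : s ^ (1 - p) = s / s ^ p := by rw [Real.rpow_sub hs, Real.rpow_one]
  have e2 : s ^ (1 - p - 1) = 1 / s ^ p := by
    rw [show 1 - p - 1 = -p by ring, Real.rpow_neg hs.le, one_div]
  have hU : 0 ≤ |u| ^ p := Real.rpow_nonneg (abs_nonneg u) p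
  have h1 : (ν * (p - 1 + s ^ p) + k * s) * y ≤ p - 1 := by
    rw [sigmaField, abs_of_pos hs, div_mul_eq_mul_div, div_le_one (by linarith)] at h
    exact h
  have hyoung := mul_rpow_sub_one_le hp (div_nonneg (abs_nonneg v) hν.le)
    (div_nonneg (abs_nonneg u) hs.le)
  rw [Real.div_rpow (abs_nonneg _) hν.le, Real.div_rpow (abs_nonneg _) hs.le,
    Real.div_rpow (abs_nonneg _) hs.le, Real.rpow_sub_one hs.ne' p] at hyoung
  have h2 : |u| ^ (p - 2) * u * v ≤ |v| * |u| ^ (p - 1) := by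
    rw [← abs_abs_rpow_mul_self hp u, ← abs_mul, mul_comm]
    exact le_abs_self _
  have h3 : s / s ^ p * (p * (|u| ^ (p - 2) * u * v)) ≤
      ν * (|v| ^ p / ν ^ p + (p - 1) * (|u| ^ p / s ^ p)) := by
    calc s / s ^ p * (p * (|u| ^ (p - 2) * u * v)) ≤ s / s ^ p * (p * (|v| * |u| ^ (p - 1))) := by
          gcongr
      _ = ν * (p * (|v| / ν * (|u| ^ (p - 1) / (s ^ p / s)))) := by field_simp
      _ ≤ _ := by gcongr
  have h4 : (ν * (p - 1 + s ^ p) + k * s) * y * (j * |u| ^ p / s ^ p) ≤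
      (p - 1) * (j * |u| ^ p / s ^ p) := by gcongr
  have h5 := mul_le_mul_of_nonneg_left h3 (mul_nonneg hj hy)
  rw [e1, e2]
  have e3 : (ν * (p - 1 + s ^ p) + k * s) * y * (j * |u| ^ p / s ^ p) =
      ν * (p - 1) * y * j * (|u| ^ p / s ^ p) + ν * y * j * |u| ^ p +
        k * y * j * (s / s ^ p) * |u| ^ p := by field_simp
  rw [e3] at h4
  calc _ = k * y * j * (s / s ^ p) * |u| ^ p - (p - 1) * (j * |u| ^ p / s ^ p) +
        j * y * (s / s ^ p * (p * (|u| ^ (p - 2) * u * v))) := by ring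
    _ ≤ k * y * j * (s / s ^ p) * |u| ^ p - (p - 1) * (j * |u| ^ p / s ^ p) +
        j * y * (ν * (|v| ^ p / ν ^ p + (p - 1) * (|u| ^ p / s ^ p))) := by linarith
    _ = ν * (p - 1) * y * j * (|u| ^ p / s ^ p) + k * y * j * (s / s ^ p) * |u| ^ p -
        (p - 1) * (j * |u| ^ p / s ^ p) + ν / ν ^ p * (|v| ^ p * j) * y := by ring
    _ ≤ _ := by nlinarith

/-- A one-sided Poincaré inequality for functions vanishing at the left end of an interval. The
interval is parametrized by a function `Y` of the Riccati variable `s ∈ [0, S]`, which is required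
to be a subsolution of `dx/ds = 1 / sigmaField`. -/
theorem mul_integral_le_of_sigmaField_mul_le {p ν S : ℝ} (hp : 1 < p) (hν : 0 < ν) (hS : 0 < S)
    {Y Y' : ℝ → ℝ} (hYc : ContinuousOn Y (Icc 0 S)) (hY'c : ContinuousOn Y' (Icc 0 S))
    (hYd : ∀ s ∈ Ioo 0 S, HasDerivAt Y (Y' s) s) (hY' : ∀ s ∈ Icc 0 S, 0 ≤ Y' s)
    {J ψ : ℝ → ℝ} (hJ : ∀ x ∈ Icc (Y 0) (Y S), HasDerivAt J (ψ x * J x) x)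
    (hJ0 : ∀ x ∈ Icc (Y 0) (Y S), 0 < J x)
    (hle : ∀ s ∈ Ioo 0 S, sigmaField p ν (ψ (Y s)) s * Y' s ≤ 1)
    {F : ℝ → ℝ} (hF : ContDiff ℝ 1 F) (hF0 : F (Y 0) = 0) :
    ν ^ p * ∫ x in Y 0..Y S, |F x| ^ p * J x ≤ ∫ x in Y 0..Y S, |deriv F x| ^ p * J x := by
  have hmono : MonotoneOn Y (Icc 0 S) := by
    refine monotoneOn_of_hasDerivWithinAt_nonneg (f' := Y') (convex_Icc 0 S) hYc ?_ ?_ <;>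
      intro s hs <;> rw [interior_Icc] at hs
    · exact (hYd s hs).hasDerivWithinAt
    · exact hY' s ⟨hs.1.le, hs.2.le⟩
  have h0S : (0 : ℝ) ∈ Icc 0 S := ⟨le_rfl, hS.le⟩
  have hSS : S ∈ Icc 0 S := ⟨hS.le, le_rfl⟩
  have hmaps : MapsTo Y (Icc 0 S) (Icc (Y 0) (Y S)) := fun s hs =>
    ⟨hmono h0S hs hs.1, hmono hs hSS hs.2⟩
  have hYle : Y 0 ≤ Y S := hmono h0S hSS hS.le
  have hJc : ContinuousOn J (Icc (Y 0) (Y S)) := fun x hx =>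
    (hJ x hx).continuousAt.continuousWithinAt
  have hdF : Continuous (deriv F) := hF.continuous_deriv le_rfl
  have hFd : ∀ x, HasDerivAt F (deriv F x) x := fun x =>
    (hF.differentiable one_ne_zero).differentiableAt.hasDerivAt
  have hc1 : ContinuousOn (fun x => |F x| ^ p * J x) (Icc (Y 0) (Y S)) :=
    (hF.continuous.abs.rpow_const fun _ => Or.inr (by linarith)).continuousOn.mul hJc
  have hc2 : ContinuousOn (fun x => |deriv F x| ^ p * J x) (Icc (Y 0) (Y S)) :=
    (hdF.abs.rpow_const fun _ => Or.inr (by linarith)).continuousOn.mul hJc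
  set g : ℝ → ℝ := fun x => ν / ν ^ p * (|deriv F x| ^ p * J x) - ν * (|F x| ^ p * J x) with hg
  have hgc : ContinuousOn g (Icc (Y 0) (Y S)) :=
    (continuousOn_const.mul hc2).sub (continuousOn_const.mul hc1)
  set w : ℝ → ℝ := fun s => g (Y s) * Y' s with hw
  have hwc : ContinuousOn w (Icc 0 S) := (hgc.comp hYc hmaps).mul hY'c
  set T : ℝ → ℝ := fun s => ∫ t in (0 : ℝ)..s, w t with hT
  have hTS : T S = ν / ν ^ p * (∫ x in Y 0..Y S, |deriv F x| ^ p * J x) -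
      ν * ∫ x in Y 0..Y S, |F x| ^ p * J x := by
    have himg : Y '' uIcc 0 S ⊆ Icc (Y 0) (Y S) := by
      rw [uIcc_of_le hS.le]; exact hmaps.image_subset
    have := intervalIntegral.integral_comp_mul_deriv'' (a := 0) (b := S) (f := Y) (f' := Y')
      (g := g) (by rwa [uIcc_of_le hS.le])
      (fun s hs => by
        rw [min_eq_left hS.le, max_eq_right hS.le] at hs
        exact (hYd s hs).hasDerivWithinAt)
      (by rwa [uIcc_of_le hS.le]) (hgc.mono himg)
    have h' : T S = ∫ x in Y 0..Y S, g x := this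
    rw [h', hg, intervalIntegral.integral_sub, intervalIntegral.integral_const_mul,
      intervalIntegral.integral_const_mul]
    · exact ContinuousOn.intervalIntegrable (by
        rw [uIcc_of_le hYle]; exact continuousOn_const.mul hc2)
    · exact ContinuousOn.intervalIntegrable (by
        rw [uIcc_of_le hYle]; exact continuousOn_const.mul hc1)
  have hTc : ContinuousOn T (Icc 0 S) := by
    have := intervalIntegral.continuousOn_primitive_interval (a := 0) (b := S) (f := w)
      (μ := volume) (by rw [uIcc_of_le hS.le]; exact hwc.integrableOn_Icc)
    rwa [uIcc_of_le hS.le] at this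
  have hTd : ∀ s ∈ Ioo 0 S, HasDerivAt T (w s) s := fun s hs =>
    intervalIntegral.integral_hasDerivAt_right
      (ContinuousOn.intervalIntegrable (by
        rw [uIcc_of_le hs.1.le]; exact hwc.mono (Icc_subset_Icc_right hs.2.le)))
      ((hwc.mono Ioo_subset_Icc_self).stronglyMeasurableAtFilter isOpen_Ioo s hs)
      (hwc.continuousAt (Icc_mem_nhds hs.1 hs.2))
  -- `Q` is the boundary term of Picone's inequality; it vanishes at `s = 0` because `F` does.
  set Q : ℝ → ℝ := fun s => J (Y s) * s ^ (1 - p) * |F (Y s)| ^ p with hQ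
  have hFY : ∀ s ∈ Ioo 0 S, HasDerivAt (fun s => F (Y s)) (deriv F (Y s) * Y' s) s := fun s hs =>
    (hFd (Y s)).comp s (hYd s hs)
  have hQ0 : Q 0 = 0 := by simp [hQ, hF0, Real.zero_rpow (by linarith : p ≠ 0)]
  obtain ⟨BJ, hBJ⟩ := isCompact_Icc.exists_bound_of_continuousOn hJc
  obtain ⟨BL, hBL⟩ := isCompact_Icc.exists_bound_of_continuousOn
    ((hdF.comp_continuousOn hYc).mul hY'c)
  have hBJ0 : 0 ≤ BJ := (norm_nonneg _).trans (hBJ _ (hmaps h0S))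
  have hBL0 : 0 ≤ BL := (norm_nonneg _).trans (hBL _ h0S)
  have hFle : ∀ s ∈ Ioc 0 S, |F (Y s)| ≤ BL * s := fun s hs => by
    obtain ⟨t, ht, hts⟩ := exists_hasDerivAt_eq_slope (fun s => F (Y s))
      (fun s => deriv F (Y s) * Y' s) hs.1
      (hF.continuous.comp_continuousOn (hYc.mono (Icc_subset_Icc_right hs.2)))
      (fun t ht => hFY t ⟨ht.1, ht.2.trans_le hs.2⟩)
    rw [hF0, sub_zero, sub_zero, eq_div_iff hs.1.ne'] at hts
    rw [← hts, abs_mul, abs_of_pos hs.1]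
    exact mul_le_mul_of_nonneg_right (hBL t ⟨ht.1.le, ht.2.le.trans hs.2⟩) hs.1.le
  have hQle : ∀ s ∈ Ioc 0 S, |Q s| ≤ BJ * BL ^ p * s := fun s hs => by
    have hs' : s ∈ Icc 0 S := ⟨hs.1.le, hs.2⟩
    have h1 : |F (Y s)| ^ p ≤ BL ^ p * s ^ p := by
      rw [← Real.mul_rpow hBL0 hs.1.le]
      exact Real.rpow_le_rpow (abs_nonneg _) (hFle s hs) (by linarith)
    have h2 : s ^ (1 - p) * s ^ p = s := by
      rw [← Real.rpow_add hs.1]; simp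
    have h3 := hBJ _ (hmaps hs')
    have hsp : 0 ≤ s ^ (1 - p) := Real.rpow_nonneg hs.1.le _
    rw [hQ, abs_mul, abs_mul, abs_of_nonneg hsp,
      abs_of_nonneg (Real.rpow_nonneg (abs_nonneg (F (Y s))) p)]
    calc |J (Y s)| * s ^ (1 - p) * |F (Y s)| ^ p ≤ BJ * s ^ (1 - p) * (BL ^ p * s ^ p) := by
          gcongr; exact h3
      _ = BJ * BL ^ p * (s ^ (1 - p) * s ^ p) := by ring
      _ = _ := by rw [h2]
  have hQc : ContinuousOn Q (Icc 0 S) := by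
    intro s hs
    rcases hs.1.eq_or_lt with h0 | h0
    · rw [← h0, ContinuousWithinAt, hQ0]
      refine squeeze_zero_norm' (a := fun s => BJ * BL ^ p * s) ?_ ?_
      · refine Filter.eventually_of_mem self_mem_nhdsWithin fun t ht => ?_
        rcases ht.1.eq_or_lt with h | h
        · rw [← h, hQ0]; simp
        · exact hQle t ⟨h, ht.2⟩
      · have : Continuous fun s : ℝ => BJ * BL ^ p * s := by fun_prop
        simpa using (this.tendsto 0).mono_left nhdsWithin_le_nhds
    · refine ((hJc.comp hYc hmaps s hs).mul ?_).mul ?_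
      · exact continuousWithinAt_id.rpow_const (Or.inl h0.ne')
      · exact (hF.continuous.abs.rpow_const fun _ => Or.inr (by linarith)).continuousAt
          |>.comp_continuousWithinAt (hYc s hs)
  have hQS : 0 ≤ Q S := mul_nonneg (mul_nonneg (hJ0 _ (hmaps hSS)).le
    (Real.rpow_nonneg hS.le _)) (Real.rpow_nonneg (abs_nonneg _) _)
  have hmain : MonotoneOn (fun s => T s - Q s) (Icc 0 S) := by
    refine monotoneOn_of_hasDerivWithinAt_nonneg (convex_Icc 0 S)
      (f' := fun s => w s - ((ψ (Y s) * J (Y s) * Y' s * s ^ (1 - p) +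
        J (Y s) * ((1 - p) * s ^ (1 - p - 1))) * |F (Y s)| ^ p +
        J (Y s) * s ^ (1 - p) * (p * |F (Y s)| ^ (p - 2) * F (Y s) * (deriv F (Y s) * Y' s))))
      (hTc.sub hQc) ?_ ?_ <;> intro s hs <;> rw [interior_Icc] at hs <;>
      have hs' : s ∈ Icc 0 S := ⟨hs.1.le, hs.2.le⟩
    · have d1 : HasDerivAt (fun s => J (Y s)) (ψ (Y s) * J (Y s) * Y' s) s :=
        (hJ _ (hmaps hs')).comp s (hYd s hs)
      have d2 : HasDerivAt (fun s : ℝ => s ^ (1 - p)) ((1 - p) * s ^ (1 - p - 1)) s :=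
        Real.hasDerivAt_rpow_const (Or.inl hs.1.ne')
      have d3 : HasDerivAt (fun s => |F (Y s)| ^ p)
          (p * |F (Y s)| ^ (p - 2) * F (Y s) * (deriv F (Y s) * Y' s)) s :=
        HasDerivAt.comp (h₂ := fun t : ℝ => |t| ^ p) s (hasDerivAt_abs_rpow (F (Y s)) hp) (hFY s hs)
      exact ((hTd s hs).sub ((d1.mul d2).mul d3)).hasDerivWithinAt
    · have := picone_deriv_le (u := F (Y s)) (v := deriv F (Y s)) hp hν hs.1
        (hJ0 _ (hmaps hs')).le (hY' s hs') (hle s hs)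
      exact sub_nonneg.2 this
  have hfin := hmain h0S hSS hS.le
  have hT0 : T 0 = 0 := by simp [hT]
  simp only [hT0, hQ0, hTS] at hfin
  have hνp : 0 < ν ^ p := Real.rpow_pos_of_pos hν p
  have h1 : ν * ∫ x in Y 0..Y S, |F x| ^ p * J x ≤
      ν / ν ^ p * ∫ x in Y 0..Y S, |deriv F x| ^ p * J x := by linarith
  rw [div_mul_eq_mul_div, le_div_iff₀ hνp] at h1
  nlinarith

/-! ### Comparison for the scalar Riccati equation `u' = -K - c u²` -/

/-- Solutions of the Riccati equation are ordered as soon as they are ordered at one time. -/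
theorem riccati_le_of_le {K c t₀ t₁ s : ℝ} {u v : ℝ → ℝ} (hu : ContinuousOn u (Icc t₀ t₁))
    (hv : ContinuousOn v (Icc t₀ t₁)) (hud : ∀ t ∈ Ioo t₀ t₁, HasDerivAt u (-K - c * u t ^ 2) t)
    (hvd : ∀ t ∈ Ioo t₀ t₁, HasDerivAt v (-K - c * v t ^ 2) t) (hs : s ∈ Icc t₀ t₁)
    (h : u s ≤ v s) : ∀ t ∈ Icc t₀ t₁, u t ≤ v t := by
  obtain ⟨B, hB⟩ := isCompact_Icc.exists_bound_of_continuousOn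
    ((continuousOn_const (c := c)).mul (hu.add hv))
  have := nonneg_of_abs_deriv_le (D := fun t => v t - u t) (L := B) (hv.sub hu)
    (fun t ht => (hvd t ht).sub (hud t ht)) (fun t ht => by
      have hb := hB t ⟨ht.1.le, ht.2.le⟩
      rw [Real.norm_eq_abs] at hb
      rw [show -K - c * v t ^ 2 - (-K - c * u t ^ 2) = -(c * (u t + v t)) * (v t - u t) by ring,
        abs_mul, abs_neg]
      exact mul_le_mul_of_nonneg_right hb (abs_nonneg _)) hs (sub_nonneg.2 h)
  exact fun t ht => sub_nonneg.1 (this t ht)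

/-- If `u` has nonnegative symmetrized values about the midpoint of `[0, T]`, then the gap between
`u` and a larger solution of the same Riccati equation is at least as large at time `0` as at
time `T`. -/
theorem riccati_gap_le {K c T : ℝ} (hc : 0 ≤ c) (hT : 0 ≤ T) {u v : ℝ → ℝ}
    (hu : ∀ t ∈ Icc 0 T, HasDerivAt u (-K - c * u t ^ 2) t)
    (hv : ∀ t ∈ Icc 0 T, HasDerivAt v (-K - c * v t ^ 2) t) (h : u T ≤ v T)
    (hsym : ∀ t ∈ Icc 0 T, 0 ≤ u t + u (T - t)) : v T - u T ≤ v 0 - u 0 := by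
  have huc : ContinuousOn u (Icc 0 T) := fun t ht => (hu t ht).continuousAt.continuousWithinAt
  have hvc : ContinuousOn v (Icc 0 T) := fun t ht => (hv t ht).continuousAt.continuousWithinAt
  have huv := riccati_le_of_le huc hvc (fun t ht => hu t ⟨ht.1.le, ht.2.le⟩)
    (fun t ht => hv t ⟨ht.1.le, ht.2.le⟩) ⟨hT, le_rfl⟩ h
  obtain ⟨B, hB⟩ := isCompact_Icc.exists_bound_of_continuousOn (huc.add hvc)
  have hA : ∀ t ∈ Icc 0 T, HasDerivAt (fun t => v t - u t) (-(c * (u t + v t)) * (v t - u t)) t :=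
    fun t ht => ((hv t ht).sub (hu t ht)).congr_deriv (by ring)
  have hm : ∀ t ∈ Icc 0 (T / 2), T / 2 - t ∈ Icc 0 T := fun t ht =>
    ⟨by linarith [ht.2], by linarith [ht.1]⟩
  have hm' : ∀ t ∈ Icc 0 (T / 2), T / 2 + t ∈ Icc 0 T := fun t ht =>
    ⟨by linarith [ht.1], by linarith [ht.2]⟩
  -- The difference of the gaps at the two times symmetric about `T / 2`.
  have hD : ∀ t ∈ Icc 0 (T / 2), HasDerivAt
      (fun t => (v (T / 2 - t) - u (T / 2 - t)) - (v (T / 2 + t) - u (T / 2 + t)))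
      ((c * (u (T / 2 - t) + v (T / 2 - t))) * (v (T / 2 - t) - u (T / 2 - t)) +
        (c * (u (T / 2 + t) + v (T / 2 + t))) * (v (T / 2 + t) - u (T / 2 + t))) t := by
    intro t ht
    have h1 := (hA _ (hm t ht)).comp_const_sub (T / 2) t
    have h2 := (hA _ (hm' t ht)).comp_const_add (T / 2) t
    exact (h1.sub h2).congr_deriv (by ring)
  have key := nonneg_of_deriv_ge (t₀ := 0) (t₁ := T / 2) (L := c * B)
    (fun t ht => (hD t ht).continuousAt.continuousWithinAt)
    (fun t ht => hD t ⟨ht.1.le, ht.2.le⟩) (fun t ht hneg => ?_) (by simp) (T / 2)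
    ⟨by linarith, le_rfl⟩
  · simp only [sub_self, add_halves] at key
    linarith
  · have ht' : t ∈ Icc 0 (T / 2) := ⟨ht.1.le, ht.2.le⟩
    have e1 := huv _ (hm t ht')
    have e2 := huv _ (hm' t ht')
    have e3 := hsym _ (hm t ht')
    rw [show T - (T / 2 - t) = T / 2 + t by ring] at e3
    have e4 := (le_abs_self _).trans (hB _ (hm t ht'))
    change u _ + v _ ≤ B at e4
    have e5 : 0 ≤ c * (u (T / 2 - t) + v (T / 2 - t) + (u (T / 2 + t) + v (T / 2 + t))) *
        (v (T / 2 + t) - u (T / 2 + t)) :=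
      mul_nonneg (mul_nonneg hc (by linarith)) (by linarith)
    have e6 := mul_le_mul_of_nonpos_right (mul_le_mul_of_nonneg_left e4 hc) hneg.le
    linarith

/-! ### Comparison of Riccati trajectories for two weights -/

theorem abs_one_div_max_sub_le {A B ε : ℝ} (hε : 0 < ε) :
    |1 / max A ε - 1 / max B ε| ≤ |A - B| / ε ^ 2 := by
  have h1 : ε ≤ max A ε := le_max_right _ _
  have h2 : ε ≤ max B ε := le_max_right _ _
  have p1 := hε.trans_le h1
  have p2 := hε.trans_le h2
  rw [div_sub_div _ _ p1.ne' p2.ne', abs_div, abs_of_pos (mul_pos p1 p2), one_mul, mul_one]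
  refine div_le_div₀ (abs_nonneg _) ?_ (by positivity) (by rw [sq]; gcongr)
  rw [abs_sub_comm]
  exact abs_max_sub_max_le_abs _ _ _

theorem sigmaField_sub (p ν k k' s : ℝ) :
    sigmaField p ν k s - sigmaField p ν k' s = (k - k') * (s / (p - 1)) := by
  unfold sigmaField; ring

theorem sigmaField_le_sigmaField {p ν k k' s : ℝ} (hp : 1 < p) (hs : 0 ≤ s) (h : k ≤ k') :
    sigmaField p ν k s ≤ sigmaField p ν k' s := by
  rw [← sub_nonneg, sigmaField_sub]
  exact mul_nonneg (sub_nonneg.2 h) (div_nonneg hs (by linarith))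

/-- The logarithmic derivative of the weight along a Riccati trajectory solves the scalar equation
`u' = (-K - c u²) / sigmaField p ν u s`, for which comparison holds. The denominator is bounded from
below by `ε`. -/
theorem le_of_riccati_trajectory {p ν K c ε S : ℝ} (hp : 1 < p) (hε : 0 < ε) (hS : 0 ≤ S)
    {u v : ℝ → ℝ} (hu : ContinuousOn u (Icc 0 S)) (hv : ContinuousOn v (Icc 0 S))
    (hud : ∀ s ∈ Ioo 0 S,
      HasDerivAt u ((-K - c * u s ^ 2) * (1 / max (sigmaField p ν (u s) s) ε)) s)
    (hvd : ∀ s ∈ Ioo 0 S,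
      HasDerivAt v ((-K - c * v s ^ 2) * (1 / max (sigmaField p ν (v s) s) ε)) s)
    (h : u S ≤ v S) : ∀ s ∈ Icc 0 S, u s ≤ v s := by
  have hp1 : 0 < p - 1 := by linarith
  obtain ⟨B, hB⟩ := isCompact_Icc.exists_bound_of_continuousOn
    ((continuousOn_const (c := c)).mul (hu.add hv))
  obtain ⟨B', hB'⟩ := isCompact_Icc.exists_bound_of_continuousOn
    ((continuousOn_const (c := -K)).sub ((continuousOn_const (c := c)).mul (hu.pow 2)))
  have := nonneg_of_abs_deriv_le (D := fun t => v t - u t)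
    (L := B * (1 / ε) + B' * (S / (p - 1) / ε ^ 2)) (hv.sub hu)
    (fun t ht => (hvd t ht).sub (hud t ht)) (fun t ht => ?_) ⟨hS, le_rfl⟩ (sub_nonneg.2 h)
  · exact fun t ht => sub_nonneg.1 (this t ht)
  · have hb := hB t ⟨ht.1.le, ht.2.le⟩
    have hb' := hB' t ⟨ht.1.le, ht.2.le⟩
    rw [Real.norm_eq_abs] at hb hb'
    change |c * (u t + v t)| ≤ B at hb
    change |-K - c * u t ^ 2| ≤ B' at hb'
    have hB0 := (abs_nonneg _).trans hb
    have hB0' := (abs_nonneg _).trans hb'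
    have hinv : |1 / max (sigmaField p ν (v t) t) ε| ≤ 1 / ε := by
      rw [abs_of_pos (one_div_pos.2 (hε.trans_le (le_max_right _ _)))]
      exact one_div_le_one_div_of_le hε (le_max_right _ _)
    have hdiff := abs_one_div_max_sub_le (A := sigmaField p ν (v t) t)
      (B := sigmaField p ν (u t) t) hε
    rw [sigmaField_sub, abs_mul, abs_of_nonneg (div_nonneg ht.1.le hp1.le)] at hdiff
    have hdiff' : |1 / max (sigmaField p ν (v t) t) ε - 1 / max (sigmaField p ν (u t) t) ε| ≤
        S / (p - 1) / ε ^ 2 * |v t - u t| := by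
      refine hdiff.trans ?_
      have : |v t - u t| * (t / (p - 1)) ≤ |v t - u t| * (S / (p - 1)) := by
        gcongr; exact ht.2.le
      calc _ ≤ |v t - u t| * (S / (p - 1)) / ε ^ 2 := by gcongr
        _ = _ := by ring
    have e : (-K - c * v t ^ 2) * (1 / max (sigmaField p ν (v t) t) ε) -
        (-K - c * u t ^ 2) * (1 / max (sigmaField p ν (u t) t) ε) =
        -(c * (u t + v t)) * (v t - u t) * (1 / max (sigmaField p ν (v t) t) ε) +
        (-K - c * u t ^ 2) * (1 / max (sigmaField p ν (v t) t) ε -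
          1 / max (sigmaField p ν (u t) t) ε) := by ring
    rw [e]
    calc _ ≤ |-(c * (u t + v t)) * (v t - u t) * (1 / max (sigmaField p ν (v t) t) ε)| +
          |(-K - c * u t ^ 2) * (1 / max (sigmaField p ν (v t) t) ε -
          1 / max (sigmaField p ν (u t) t) ε)| := abs_add_le _ _
      _ = |c * (u t + v t)| * |v t - u t| * |1 / max (sigmaField p ν (v t) t) ε| +
          |-K - c * u t ^ 2| * |1 / max (sigmaField p ν (v t) t) ε -
          1 / max (sigmaField p ν (u t) t) ε| := by rw [abs_mul, abs_mul, abs_mul, abs_neg]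
      _ ≤ B * |v t - u t| * (1 / ε) + B' * (S / (p - 1) / ε ^ 2 * |v t - u t|) := by gcongr
      _ = _ := by ring

/-- Convexity of `k ↦ 1 / k`, in the form needed for four values that may include a negative
one. -/
theorem mul_add_one_div_sub_le {u u' v v' : ℝ} (h0 : 0 < u') (h1 : u' ≤ u) (h2 : u ≤ v)
    (h3 : v - u ≤ u' - v') : v' * (1 / u + 1 / u' - 1 / v) ≤ 1 := by
  have hu : 0 < u := h0.trans_le h1
  have hv : 0 < v := hu.trans_le h2
  have hinv : 1 / v ≤ 1 / u := one_div_le_one_div_of_le hu h2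
  rcases le_or_gt v' 0 with hv' | hv'
  · have : 0 ≤ 1 / u + 1 / u' - 1 / v := by
      have := (one_div_pos.2 h0).le
      linarith
    nlinarith
  · have e1 : 1 / u - 1 / v = (v - u) / (u * v) := by field_simp
    have e2 : 1 / v' - 1 / u' = (u' - v') / (u' * v') := by field_simp
    have hvu : v' ≤ u' := by linarith
    have : (v - u) / (u * v) ≤ (u' - v') / (u' * v') :=
      div_le_div₀ (by linarith) h3 (by positivity) (mul_le_mul h1 (by linarith) hv'.le hu.le)
    rw [← e1, ← e2] at this
    calc v' * (1 / u + 1 / u' - 1 / v) ≤ v' * (1 / v') := by gcongr; linarith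
      _ = 1 := by field_simp

/-- Extending by constants a function that is `C¹` on `[-a, a]` gives a Lipschitz function. -/
theorem exists_lipschitzWith_clamp {a : ℝ} (ha : 0 < a) {ψ ψ' : ℝ → ℝ}
    (hψ : ∀ x ∈ Icc (-a) a, HasDerivAt ψ (ψ' x) x) (hψ' : ContinuousOn ψ' (Icc (-a) a)) :
    ∃ L : NNReal, LipschitzWith L fun x => ψ (max (-a) (min a x)) := by
  obtain ⟨L, hL⟩ := isCompact_Icc.exists_bound_of_continuousOn hψ'
  have hL0 : 0 ≤ L := (norm_nonneg _).trans (hL a ⟨by linarith, le_rfl⟩)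
  have hmem : ∀ x, max (-a) (min a x) ∈ Icc (-a) a := fun x =>
    ⟨le_max_left _ _, max_le (by linarith) (min_le_left _ _)⟩
  refine ⟨⟨L, hL0⟩, LipschitzWith.of_dist_le_mul fun x y => ?_⟩
  have h1 := Convex.norm_image_sub_le_of_norm_hasDerivWithin_le (f := ψ) (f' := ψ') (C := L)
    (fun z hz => (hψ z hz).hasDerivWithinAt) hL (convex_Icc _ _) (hmem y) (hmem x)
  have h2 : |max (-a) (min a x) - max (-a) (min a y)| ≤ |x - y| := by
    calc _ ≤ |min a x - min a y| := by
            simpa using abs_max_sub_max_le_max (-a) (min a x) (-a) (min a y)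
      _ ≤ |x - y| := by simpa using abs_min_sub_min_le_max a x a y
  rw [Real.dist_eq, Real.dist_eq]
  exact h1.trans (mul_le_mul_of_nonneg_left h2 hL0)

theorem continuousOn_sigmaField {p ν : ℝ} (hp : 1 < p) {u v : ℝ → ℝ} {A : Set ℝ}
    (hu : ContinuousOn u A) (hv : ContinuousOn v A) :
    ContinuousOn (fun s => sigmaField p ν (u s) (v s)) A := by
  have h : ContinuousOn (fun s => |v s| ^ p) A := hv.abs.rpow_const fun _ _ => Or.inr (by linarith)
  unfold sigmaField
  fun_prop

theorem abs_one_div_max_sigmaField_sub_le {p ν S ε : ℝ} (hp : 1 < p) (hε : 0 < ε) {φ : ℝ → ℝ}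
    {L : NNReal} (hφ : LipschitzWith L φ) {s : ℝ} (hs : s ∈ Icc 0 S) (x y : ℝ) :
    |1 / max (sigmaField p ν (φ x) s) ε - 1 / max (sigmaField p ν (φ y) s) ε| ≤
      (L * (S / (p - 1)) / ε ^ 2) * |x - y| := by
  have hp1 : 0 < p - 1 := by linarith
  have h1 := hφ.dist_le_mul x y
  rw [Real.dist_eq, Real.dist_eq] at h1
  refine (abs_one_div_max_sub_le hε).trans ?_
  rw [sigmaField_sub, abs_mul, abs_of_nonneg (div_nonneg hs.1 hp1.le)]
  have h2 : s / (p - 1) ≤ S / (p - 1) := by gcongr; exact hs.2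
  have h3 : |φ x - φ y| * (s / (p - 1)) ≤ L * |x - y| * (S / (p - 1)) :=
    mul_le_mul h1 h2 (div_nonneg hs.1 hp1.le) (by positivity)
  calc |φ x - φ y| * (s / (p - 1)) / ε ^ 2 ≤ L * |x - y| * (S / (p - 1)) / ε ^ 2 := by
        gcongr
    _ = _ := by ring

/-- Riccati trajectories, parametrized by the Riccati variable, with prescribed end point. The
denominator of the vector field is truncated from below by `ε`. -/
theorem exists_riccati_trajectory {p ν S ε : ℝ} (hp : 1 < p) (hε : 0 < ε) (hS : 0 < S)
    {φ : ℝ → ℝ} {L : NNReal} (hφ : LipschitzWith L φ) (a : ℝ) :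
    ∃ Y : ℝ → ℝ, Y S = a ∧
      (∀ s ∈ Icc 0 S, HasDerivAt Y (1 / max (sigmaField p ν (φ (Y s)) s) ε) s) ∧
      ContinuousOn (fun s => 1 / max (sigmaField p ν (φ (Y s)) s) ε) (Icc 0 S) := by
  have hp1 : 0 < p - 1 := by linarith
  set cl : ℝ → ℝ := fun s => max 0 (min S s) with hcl
  have hclm : ∀ s, cl s ∈ Icc 0 S := fun s =>
    ⟨le_max_left _ _, max_le hS.le (min_le_left _ _)⟩
  have hcleq : ∀ s ∈ Icc 0 S, cl s = s := fun s hs => by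
    rw [hcl]; simp only; rw [min_eq_right hs.2, max_eq_right hs.1]
  obtain ⟨C, hC⟩ : ∃ C : NNReal, (C : ℝ) = L * (S / (p - 1)) / ε ^ 2 :=
    ⟨⟨_, by positivity⟩, rfl⟩
  obtain ⟨M, hM⟩ : ∃ M : NNReal, (M : ℝ) = 1 / ε := ⟨⟨_, by positivity⟩, rfl⟩
  obtain ⟨Y, hYS, hY⟩ := exists_hasDerivAt_of_bounded_lipschitz
    (F := fun s y => 1 / max (sigmaField p ν (φ y) (cl s)) ε)
    (M := M) (L := C)
    (fun s => LipschitzWith.of_dist_le_mul fun x y => by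
      rw [Real.dist_eq, Real.dist_eq, hC]
      exact abs_one_div_max_sigmaField_sub_le hp hε hφ (hclm s) x y)
    (fun y => by
      have h1 : Continuous cl := by fun_prop
      have h2 : Continuous fun s => sigmaField p ν (φ y) (cl s) := by
        rw [← continuousOn_univ]
        exact continuousOn_sigmaField hp continuousOn_const h1.continuousOn
      exact continuous_const.div (h2.max continuous_const)
        fun s => (hε.trans_le (le_max_right _ _)).ne')
    (fun s y => by
      rw [abs_of_pos (one_div_pos.2 (hε.trans_le (le_max_right _ _))), hM]
      exact one_div_le_one_div_of_le hε (le_max_right _ _)) S a (R := S + 1) (by linarith)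
  have hYd : ∀ s ∈ Icc 0 S, HasDerivAt Y (1 / max (sigmaField p ν (φ (Y s)) s) ε) s :=
    fun s hs => by
    have := hY s ⟨by linarith [hs.1], by linarith [hs.2]⟩
    simp only [hcleq s hs] at this
    exact this
  refine ⟨Y, hYS, hYd, ?_⟩
  have hYc : ContinuousOn Y (Icc 0 S) := fun s hs => (hYd s hs).continuousAt.continuousWithinAt
  have h2 : ContinuousOn (fun s => sigmaField p ν (φ (Y s)) s) (Icc 0 S) :=
    continuousOn_sigmaField hp (hφ.continuous.comp_continuousOn hYc) continuousOn_id
  exact continuousOn_const.div ((continuous_id.max continuous_const).comp_continuousOn h2)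
    fun s _ => (hε.trans_le (le_max_right _ _)).ne'

set_option maxHeartbeats 800000 in
/-- Given a Riccati trajectory `X` for the weight with logarithmic derivative `ψ₁`, running through
`[-a, a]` while the Riccati variable runs through `[-S, S]`, there is a subsolution for a second
weight whose logarithmic derivative `ψ₂` satisfies the same equation with `ψ₁ 0 ≤ ψ₂ 0`. The
subsolution is `Y` on `[0, S]` and `s ↦ -W (-s)` on `[-S, 0]`. The function `Y` is an exact
trajectory, and `W` is chosen so that `Y + W` equals the distance `X s - X (-s)`. -/
theorem exists_comparison_trajectory {p ν K c a S ε : ℝ} (hp : 1 < p) (hc : 0 ≤ c) (ha : 0 < a)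
    (hS : 0 < S) (hε : 0 < ε) {ψ₁ ψ₂ X : ℝ → ℝ}
    (hψ₁ : ∀ x ∈ Icc (-a) a, HasDerivAt ψ₁ (-K - c * ψ₁ x ^ 2) x)
    (hψ₂ : ∀ x ∈ Icc (-a) a, HasDerivAt ψ₂ (-K - c * ψ₂ x ^ 2) x)
    (h₁ : 0 ≤ ψ₁ 0) (h₁₂ : ψ₁ 0 ≤ ψ₂ 0) (hXc : ContinuousOn X (Icc (-S) S))
    (hXm : MapsTo X (Icc (-S) S) (Icc (-a) a))
    (hXd : ∀ s ∈ Ioo (-S) S, HasDerivAt X (1 / sigmaField p ν (ψ₁ (X s)) s) s)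
    (hXε : ∀ s ∈ Icc (-S) S, ε ≤ sigmaField p ν (ψ₁ (X s)) s)
    (hX₀ : X (-S) = -a) (hX₁ : X S = a) :
    ∃ Y Y' W W' : ℝ → ℝ, (ContinuousOn Y (Icc 0 S) ∧ ContinuousOn Y' (Icc 0 S) ∧
      (∀ s ∈ Ioo 0 S, HasDerivAt Y (Y' s) s) ∧ (∀ s ∈ Icc 0 S, 0 ≤ Y' s) ∧
      (∀ s ∈ Ioo 0 S, sigmaField p ν (ψ₂ (Y s)) s * Y' s ≤ 1) ∧ Y S = a) ∧
      (ContinuousOn W (Icc 0 S) ∧ ContinuousOn W' (Icc 0 S) ∧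
      (∀ s ∈ Ioo 0 S, HasDerivAt W (W' s) s) ∧ (∀ s ∈ Icc 0 S, 0 ≤ W' s) ∧
      (∀ s ∈ Ioo 0 S, sigmaField p ν (-ψ₂ (-W s)) s * W' s ≤ 1) ∧ W S = a) ∧
      W 0 = -Y 0 ∧ Y 0 ∈ Icc (-a) a := by
  have hp1 : 0 < p - 1 := by linarith
  have haa : -a ≤ a := by linarith
  have hsubS : Icc 0 S ⊆ Icc (-S) S := Icc_subset_Icc_left (by linarith)
  have hneg : ∀ s ∈ Icc 0 S, -s ∈ Icc (-S) S := fun s hs =>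
    ⟨by linarith [hs.2], by linarith [hs.1]⟩
  have hψ₁c : ContinuousOn ψ₁ (Icc (-a) a) := fun x hx =>
    (hψ₁ x hx).continuousAt.continuousWithinAt
  have hψ₂c : ContinuousOn ψ₂ (Icc (-a) a) := fun x hx =>
    (hψ₂ x hx).continuousAt.continuousWithinAt
  have hIoo : ∀ {x}, x ∈ Ioo (-a) a → x ∈ Icc (-a) a := fun h => ⟨h.1.le, h.2.le⟩
  have h0a : (0 : ℝ) ∈ Icc (-a) a := ⟨by linarith, ha.le⟩
  have haI : a ∈ Icc (-a) a := ⟨haa, le_rfl⟩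
  have hle : ∀ x ∈ Icc (-a) a, ψ₁ x ≤ ψ₂ x := riccati_le_of_le hψ₁c hψ₂c
    (fun x hx => hψ₁ x (hIoo hx)) (fun x hx => hψ₂ x (hIoo hx)) h0a h₁₂
  have hnegI : ∀ x ∈ Icc (-a) a, -x ∈ Icc (-a) a := fun x hx =>
    ⟨by linarith [hx.2], by linarith [hx.1]⟩
  -- The reflected solution starts below `ψ₁` because `0 ≤ ψ₁ 0`.
  have hrefl : ∀ x ∈ Icc (-a) a, -ψ₁ (-x) ≤ ψ₁ x := by
    refine riccati_le_of_le (u := fun x => -ψ₁ (-x)) (K := K) (c := c)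
      (hψ₁c.comp continuousOn_neg hnegI).neg hψ₁c
      (fun x hx => ?_) (fun x hx => hψ₁ x (hIoo hx)) h0a (by simpa using h₁)
    have := ((hψ₁ (-x) (hnegI x (hIoo hx))).scomp x (hasDerivAt_neg x)).fun_neg
    exact this.congr_deriv (by simp; ring)
  -- Extension of the second vector field to all of space, and its integral curve with value `a` at
  -- `S`.
  set t : ℝ → ℝ := fun x => max (-a) (min a x) with ht
  have htm : ∀ x, t x ∈ Icc (-a) a := fun x =>
    ⟨le_max_left _ _, max_le (by linarith) (min_le_left _ _)⟩
  have hteq : ∀ x ∈ Icc (-a) a, t x = x := fun x hx => by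
    rw [ht]; simp only; rw [min_eq_right hx.2, max_eq_right hx.1]
  obtain ⟨L₁, hLip₁⟩ : ∃ L : NNReal, LipschitzWith L fun x => ψ₁ (t x) :=
    exists_lipschitzWith_clamp ha hψ₁
    (continuousOn_const.sub (continuousOn_const.mul (hψ₁c.pow 2)))
  obtain ⟨L₂, hLip₂⟩ : ∃ L : NNReal, LipschitzWith L fun x => ψ₂ (t x) :=
    exists_lipschitzWith_clamp ha hψ₂
    (continuousOn_const.sub (continuousOn_const.mul (hψ₂c.pow 2)))
  obtain ⟨Y, hYS, hYd, hY'c⟩ :=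
    exists_riccati_trajectory (ν := ν) hp hε hS hLip₂ a
  set Y' : ℝ → ℝ := fun s => 1 / max (sigmaField p ν (ψ₂ (t (Y s))) s) ε with hY'
  have hYc : ContinuousOn Y (Icc 0 S) := fun s hs => (hYd s hs).continuousAt.continuousWithinAt
  have hY'pos : ∀ s, 0 < Y' s := fun s => one_div_pos.2 (hε.trans_le (le_max_right _ _))
  have hXmax : ∀ s ∈ Icc (-S) S, sigmaField p ν (ψ₁ (X s)) s =
      max (sigmaField p ν (ψ₁ (X s)) s) ε := fun s hs => (max_eq_left (hXε s hs)).symm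
  have hX'c : ContinuousOn (fun s => 1 / sigmaField p ν (ψ₁ (X s)) s) (Icc (-S) S) :=
    continuousOn_const.div (continuousOn_sigmaField hp (hψ₁c.comp hXc hXm) continuousOn_id)
      fun s hs => (hε.trans_le (hXε s hs)).ne'
  -- `X ≤ Y ≤ a` on `[0, S]`.
  have hXY : ∀ s ∈ Icc 0 S, 0 ≤ Y s - X s := by
    refine nonneg_of_deriv_le (L := -(L₁ * (S / (p - 1)) / ε ^ 2)) (hYc.sub (hXc.mono hsubS))
      (fun s hs => (hYd s ⟨hs.1.le, hs.2.le⟩).sub (hXd s ⟨by linarith [hs.1], hs.2⟩))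
      (fun s hs hlt => ?_) (by rw [hYS, hX₁, sub_self])
    have hs' : s ∈ Icc 0 S := ⟨hs.1.le, hs.2.le⟩
    have h1 := (abs_le.1 (abs_one_div_max_sigmaField_sub_le (ν := ν) hp hε hLip₁ hs' (Y s) (X s))).2
    rw [hteq _ (hXm (hsubS hs')), abs_of_neg hlt] at h1
    have h2 : Y' s ≤ 1 / max (sigmaField p ν (ψ₁ (t (Y s))) s) ε :=
      one_div_le_one_div_of_le (hε.trans_le (le_max_right _ _))
        (max_le_max_right _ (sigmaField_le_sigmaField hp hs'.1 (hle _ (htm _))))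
    rw [hXmax s (hsubS hs')]
    linarith
  have hYmono : MonotoneOn Y (Icc 0 S) :=
    monotoneOn_of_hasDerivWithinAt_nonneg (f' := Y') (convex_Icc 0 S) hYc
      (fun s hs => (hYd s (interior_subset hs)).hasDerivWithinAt) fun s _ => (hY'pos s).le
  have h0S : (0 : ℝ) ∈ Icc 0 S := ⟨le_rfl, hS.le⟩
  have hSS : S ∈ Icc 0 S := ⟨hS.le, le_rfl⟩
  have hYm : ∀ s ∈ Icc 0 S, Y s ∈ Icc (-a) a := fun s hs =>
    ⟨(hXm (hsubS hs)).1.trans (sub_nonneg.1 (hXY s hs)), hYS ▸ hYmono hs hSS hs.2⟩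
  -- The logarithmic derivatives along the three trajectories are ordered.
  set V : ℝ → ℝ := fun s => ψ₂ (Y s) with hV
  set U : ℝ → ℝ := fun s => ψ₁ (X s) with hU
  set U' : ℝ → ℝ := fun s => -ψ₁ (X (-s)) with hU'
  have hVc : ContinuousOn V (Icc 0 S) := hψ₂c.comp hYc hYm
  have hUc : ContinuousOn U (Icc 0 S) := hψ₁c.comp (hXc.mono hsubS) (hXm.mono_left hsubS)
  have hU'c : ContinuousOn U' (Icc 0 S) :=
    (hψ₁c.comp (hXc.comp continuousOn_neg hneg) fun s hs => hXm (hneg s hs)).neg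
  have hVd : ∀ s ∈ Ioo 0 S,
      HasDerivAt V ((-K - c * V s ^ 2) * (1 / max (sigmaField p ν (V s) s) ε)) s := fun s hs => by
    have hs' : s ∈ Icc 0 S := ⟨hs.1.le, hs.2.le⟩
    have h1 := hYd s hs'
    simp only [hteq _ (hYm s hs')] at h1
    exact (hψ₂ _ (hYm s hs')).comp s h1
  have hUd : ∀ s ∈ Ioo 0 S,
      HasDerivAt U ((-K - c * U s ^ 2) * (1 / max (sigmaField p ν (U s) s) ε)) s := fun s hs => by
    have hs' : s ∈ Icc (-S) S := ⟨by linarith [hs.1], hs.2.le⟩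
    have h1 := hXd s ⟨by linarith [hs.1], hs.2⟩
    rw [hXmax s hs'] at h1
    exact (hψ₁ _ (hXm hs')).comp s h1
  have hXnd : ∀ s ∈ Ioo 0 S,
      HasDerivAt (fun s => X (-s)) (-(1 / sigmaField p ν (U' s) s)) s := fun s hs => by
    have h1 := (hXd (-s) ⟨by linarith [hs.2], by linarith [hs.1]⟩).scomp s (hasDerivAt_neg s)
    rw [← sigmaField_neg, neg_neg] at h1
    simpa [Function.comp_def] using h1
  have hU'ε : ∀ s ∈ Icc 0 S, ε ≤ sigmaField p ν (U' s) s := fun s hs => by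
    have := hXε (-s) (hneg s hs)
    rwa [← sigmaField_neg, neg_neg] at this
  have hU'd : ∀ s ∈ Ioo 0 S,
      HasDerivAt U' ((-K - c * U' s ^ 2) * (1 / max (sigmaField p ν (U' s) s) ε)) s :=
    fun s hs => by
    have hs' : s ∈ Icc 0 S := ⟨hs.1.le, hs.2.le⟩
    have h1 := ((hψ₁ _ (hXm (hneg s hs'))).comp s (hXnd s hs)).neg
    rw [max_eq_left (hU'ε s hs')]
    refine h1.congr_deriv ?_
    simp only [hU']; ring
  have hUV : ∀ s ∈ Icc 0 S, U s ≤ V s := le_of_riccati_trajectory hp hε hS.le hUc hVc hUd hVd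
    (by simp only [hU, hV, hX₁, hYS]; exact hle a haI)
  have hU'U : ∀ s ∈ Icc 0 S, U' s ≤ U s := le_of_riccati_trajectory hp hε hS.le hU'c hUc hU'd hUd
    (by simp only [hU, hU', hX₁, hX₀]; exact hrefl a haI)
  have hVε : ∀ s ∈ Icc 0 S, ε ≤ sigmaField p ν (V s) s := fun s hs =>
    (hXε s (hsubS hs)).trans (sigmaField_le_sigmaField hp hs.1 (hUV s hs))
  have hY'eq : ∀ s ∈ Icc 0 S, Y' s = 1 / sigmaField p ν (V s) s := fun s hs => by
    simp only [hY', hteq _ (hYm s hs)]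
    rw [max_eq_left (hVε s hs)]
  -- The left half of the comparison trajectory.
  set W : ℝ → ℝ := fun s => X s - X (-s) - Y s with hW
  set W' : ℝ → ℝ := fun s => 1 / sigmaField p ν (U s) s + 1 / sigmaField p ν (U' s) s - Y' s
    with hW'
  have hWc : ContinuousOn W (Icc 0 S) :=
    ((hXc.mono hsubS).sub (hXc.comp continuousOn_neg hneg)).sub hYc
  have hW'c : ContinuousOn W' (Icc 0 S) :=
    ((hX'c.mono hsubS).add (continuousOn_const.div (continuousOn_sigmaField hp hU'c
      continuousOn_id) fun s hs => (hε.trans_le (hU'ε s hs)).ne')).sub hY'c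
  have hWd : ∀ s ∈ Ioo 0 S, HasDerivAt W (W' s) s := fun s hs =>
    (((hXd s ⟨by linarith [hs.1], hs.2⟩).sub (hXnd s hs)).sub
      (hYd s ⟨hs.1.le, hs.2.le⟩)).congr_deriv (by simp only [hW', hU, hU']; ring)
  have hW'0 : ∀ s ∈ Icc 0 S, 0 ≤ W' s := fun s hs => by
    have h1 : Y' s ≤ 1 / sigmaField p ν (U s) s := by
      rw [hY'eq s hs]
      exact one_div_le_one_div_of_le (hε.trans_le (hXε s (hsubS hs)))
        (sigmaField_le_sigmaField hp hs.1 (hUV s hs))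
    have h2 := one_div_pos.2 (hε.trans_le (hU'ε s hs))
    simp only [hW']; linarith
  have hWS : W S = a := by simp only [hW, hX₀, hX₁, hYS]; ring
  have hW0 : W 0 = -Y 0 := by simp [hW]
  have hWmono : MonotoneOn W (Icc 0 S) := by
    refine monotoneOn_of_hasDerivWithinAt_nonneg (f' := W') (convex_Icc 0 S) hWc
      (fun s hs => ?_) fun s hs => hW'0 s (interior_subset hs)
    rw [interior_Icc] at hs
    exact (hWd s hs).hasDerivWithinAt
  have hWm : ∀ s ∈ Icc 0 S, -W s ∈ Icc (-a) a := fun s hs => by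
    have h1 := hWmono hs hSS hs.2
    have h2 := hWmono h0S hs hs.1
    have h3 := (hYm 0 h0S).2
    constructor <;> linarith
  refine ⟨Y, Y', W, W', ⟨hYc, hY'c, fun s hs => hYd s ⟨hs.1.le, hs.2.le⟩,
    fun s _ => (hY'pos s).le, fun s hs => ?_, hYS⟩, ⟨hWc, hW'c, hWd, hW'0, fun s hs => ?_, hWS⟩,
    hW0, hYm 0 h0S⟩
  · have hs' : s ∈ Icc 0 S := ⟨hs.1.le, hs.2.le⟩
    rw [hY'eq s hs']
    exact (mul_one_div_cancel (hε.trans_le (hVε s hs')).ne').le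
  · have hs' : s ∈ Icc 0 S := ⟨hs.1.le, hs.2.le⟩
    have hT : 0 ≤ X s - X (-s) := by
      have hXmono : MonotoneOn X (Icc (-S) S) := by
        refine monotoneOn_of_hasDerivWithinAt_nonneg
          (f' := fun s => 1 / sigmaField p ν (ψ₁ (X s)) s) (convex_Icc (-S) S) hXc
          (fun r hr => ?_) fun r hr =>
            (one_div_pos.2 (hε.trans_le (hXε r (interior_subset hr)))).le
        rw [interior_Icc] at hr
        exact (hXd r hr).hasDerivWithinAt
      exact sub_nonneg.2 (hXmono (hneg s hs') (hsubS hs') (by linarith [hs.1]))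
    have hx := hXm (hsubS hs')
    have hx' := hXm (hneg s hs')
    have hy := hYm s hs'
    have hw := hWm s hs'
    -- Compare `ψ₁` on `[X (-s), X s]` with `ψ₂` on the interval of the same length ending at `Y s`.
    set T := X s - X (-s) with hTdef
    have hWT : -W s + T = Y s := by simp only [hW, hTdef]; ring
    have hsegX : ∀ r ∈ Icc 0 T, X (-s) + r ∈ Icc (-a) a := fun r hr =>
      ⟨by linarith [hx'.1, hr.1], by linarith [hx.2, hr.2]⟩
    have hsegX' : ∀ r ∈ Icc 0 T, X s - r ∈ Icc (-a) a := fun r hr =>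
      ⟨by linarith [hx'.1, hr.2], by linarith [hx.2, hr.1]⟩
    have hsegY : ∀ r ∈ Icc 0 T, -W s + r ∈ Icc (-a) a := fun r hr =>
      ⟨by linarith [hw.1, hr.1], by linarith [hy.2, hr.2]⟩
    have d1 : ∀ r ∈ Icc 0 T, HasDerivAt (fun r => ψ₁ (X (-s) + r))
        (-K - c * ψ₁ (X (-s) + r) ^ 2) r := fun r hr => (hψ₁ _ (hsegX r hr)).comp_const_add _ _
    have d2 : ∀ r ∈ Icc 0 T, HasDerivAt (fun r => ψ₂ (-W s + r))
        (-K - c * ψ₂ (-W s + r) ^ 2) r := fun r hr => (hψ₂ _ (hsegY r hr)).comp_const_add _ _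
    have d3 : ∀ r ∈ Icc 0 T, HasDerivAt (fun r => -ψ₁ (X s - r))
        (-K - c * (-ψ₁ (X s - r)) ^ 2) r := fun r hr =>
      ((hψ₁ _ (hsegX' r hr)).comp_const_sub _ _).neg.congr_deriv (by ring)
    have eX : X (-s) + T = X s := by rw [hTdef]; ring
    have eX' : X s - T = X (-s) := by rw [hTdef]; ring
    have hsym := riccati_le_of_le (fun r hr => (d3 r hr).continuousAt.continuousWithinAt)
      (fun r hr => (d1 r hr).continuousAt.continuousWithinAt)
      (fun r hr => d3 r ⟨hr.1.le, hr.2.le⟩) (fun r hr => d1 r ⟨hr.1.le, hr.2.le⟩)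
      (s := T) ⟨hT, le_rfl⟩ (by rw [eX, eX']; exact hU'U s hs')
    have hgap := riccati_gap_le hc hT d1 d2 (by rw [eX, hWT]; exact hUV s hs')
      (fun r hr => by
        have := hsym r hr
        rw [show X (-s) + (T - r) = X s - r by rw [hTdef]; ring]
        linarith)
    rw [eX, hWT, add_zero, add_zero] at hgap
    have hs1 : 0 ≤ s / (p - 1) := div_nonneg hs.1.le hp1.le
    rw [mul_comm]
    simp only [hW', hY'eq s hs']
    rw [mul_comm]
    refine mul_add_one_div_sub_le (hε.trans_le (hU'ε s hs'))
      (sigmaField_le_sigmaField hp hs.1.le (hU'U s hs'))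
      (sigmaField_le_sigmaField hp hs.1.le (hUV s hs')) ?_
    rw [sigmaField_sub, sigmaField_sub]
    refine mul_le_mul_of_nonneg_right ?_ hs1
    simp only [hU, hU', hV]
    linarith

/-- The Poincaré inequality with constant `ν ^ p` for the comparison weight. -/
theorem PoincareBound.of_trajectory {p ν K c a S ε : ℝ} (hp : 1 < p) (hν : 0 < ν) (hc : 0 ≤ c)
    (ha : 0 < a) (hS : 0 < S) (hε : 0 < ε) {ψ₁ ψ₂ X J : ℝ → ℝ}
    (hψ₁ : ∀ x ∈ Icc (-a) a, HasDerivAt ψ₁ (-K - c * ψ₁ x ^ 2) x)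
    (hψ₂ : ∀ x ∈ Icc (-a) a, HasDerivAt ψ₂ (-K - c * ψ₂ x ^ 2) x)
    (h₁ : 0 ≤ ψ₁ 0) (h₁₂ : ψ₁ 0 ≤ ψ₂ 0) (hXc : ContinuousOn X (Icc (-S) S))
    (hXm : MapsTo X (Icc (-S) S) (Icc (-a) a))
    (hXd : ∀ s ∈ Ioo (-S) S, HasDerivAt X (1 / sigmaField p ν (ψ₁ (X s)) s) s)
    (hXε : ∀ s ∈ Icc (-S) S, ε ≤ sigmaField p ν (ψ₁ (X s)) s)
    (hX₀ : X (-S) = -a) (hX₁ : X S = a)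
    (hJ : ∀ x ∈ Icc (-a) a, HasDerivAt J (ψ₂ x * J x) x) (hJ0 : ∀ x ∈ Icc (-a) a, 0 < J x) :
    PoincareBound p a (ν ^ p) J := by
  obtain ⟨Y, Y', W, W', ⟨hYc, hY'c, hYd, hY'0, hYle, hYS⟩, ⟨hWc, hW'c, hWd, hW'0, hWle, hWS⟩,
    hW0, hY0⟩ := exists_comparison_trajectory hp hc ha hS hε hψ₁ hψ₂ h₁ h₁₂ hXc hXm hXd hXε hX₀ hX₁
  have hJc : ContinuousOn J (Icc (-a) a) := fun x hx => (hJ x hx).continuousAt.continuousWithinAt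
  intro F hF hM
  set b := Y 0 with hb
  -- Replacing `F` by `F - F b` increases the left-hand side, and the two halves decouple.
  have hFb : ContDiff ℝ 1 fun x => F x - F b := hF.sub contDiff_const
  have hdFb : ∀ x, deriv (fun x => F x - F b) x = deriv F x := fun x => deriv_sub_const _
  have hmin := integral_abs_rpow_le_sub hp ha hJc hJ0 hF.continuous.continuousOn hM (F b)
  have hsub1 : Icc (-a) b ⊆ Icc (-a) a := Icc_subset_Icc_right hY0.2
  have hsub2 : Icc b a ⊆ Icc (-a) a := Icc_subset_Icc_left hY0.1
  have hright := mul_integral_le_of_sigmaField_mul_le hp hν hS hYc hY'c hYd hY'0 (J := J) (ψ := ψ₂)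
    (fun x hx => hJ x (hsub2 (by rwa [hYS] at hx))) (fun x hx => hJ0 x (hsub2 (by rwa [hYS] at hx)))
    hYle hFb (by simp [hb])
  rw [hYS] at hright
  have hnegm : ∀ x ∈ Icc (W 0) (W S), -x ∈ Icc (-a) a := fun x hx => by
    rw [hW0, hWS] at hx
    exact ⟨by linarith [hx.2], by linarith [hx.1, hY0.2]⟩
  have hleft := mul_integral_le_of_sigmaField_mul_le hp hν hS hWc hW'c hWd hW'0
    (J := fun x => J (-x)) (ψ := fun x => -ψ₂ (-x))
    (fun x hx => by
      have := (hJ (-x) (hnegm x hx)).scomp x (hasDerivAt_neg x)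
      simpa [Function.comp_def] using this)
    (fun x hx => hJ0 _ (hnegm x hx)) hWle (F := fun x => F (-x) - F b)
    ((hF.comp contDiff_neg).sub contDiff_const) (by simp [hW0, hb])
  rw [hWS, hW0] at hleft
  have hdn : ∀ x, |deriv (fun x => F (-x) - F b) x| = |deriv F (-x)| := fun x => by
    rw [deriv_sub_const, deriv_comp_neg, abs_neg]
  have e1 : ∫ x in -b..a, |F (-x) - F b| ^ p * J (-x) = ∫ x in -a..b, |F x - F b| ^ p * J x := by
    have := intervalIntegral.integral_comp_neg (a := -b) (b := a)
      (f := fun x => |F x - F b| ^ p * J x)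
    rwa [neg_neg] at this
  have e2 : ∫ x in -b..a, |deriv F (-x)| ^ p * J (-x) = ∫ x in -a..b, |deriv F x| ^ p * J x := by
    have := intervalIntegral.integral_comp_neg (a := -b) (b := a)
      (f := fun x => |deriv F x| ^ p * J x)
    rwa [neg_neg] at this
  simp only [hdn, e1, e2] at hleft
  simp only [hdFb] at hright
  have hc1 := continuousOn_abs_rpow_mul hp hJc hFb.continuous.continuousOn
  have hc2 := continuousOn_abs_rpow_mul hp hJc (hF.continuous_deriv le_rfl).continuousOn
  have hint : ∀ g : ℝ → ℝ, ContinuousOn g (Icc (-a) a) →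
      (∫ x in -a..b, g x) + ∫ x in b..a, g x = ∫ x in -a..a, g x := fun g hg =>
    intervalIntegral.integral_add_adjacent_intervals
      (ContinuousOn.intervalIntegrable (by rw [uIcc_of_le hY0.1]; exact hg.mono hsub1))
      (ContinuousOn.intervalIntegrable (by rw [uIcc_of_le hY0.2]; exact hg.mono hsub2))
  rw [← hint _ hc2]
  have hνp : 0 ≤ ν ^ p := Real.rpow_nonneg hν.le p
  have := mul_le_mul_of_nonneg_left hmin hνp
  rw [← hint _ hc1] at this
  linarith

/-! ### Solving the boundary value problem by shooting -/

/-- The shooting method: if the end value of the solution of an initial value problem is at most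
`x₁` for the smallest parameter and at least `x₁` for the largest one, then it is `x₁` for some
parameter in between. -/
theorem exists_shooting {F : ℝ → ℝ → ℝ → ℝ} {ν₀ ν₁ t₀ t₁ x₀ x₁ C : ℝ} {L M : NNReal}
    (hν : ν₀ ≤ ν₁) (ht : t₀ < t₁)
    (hlip : ∀ ν ∈ Icc ν₀ ν₁, ∀ t, LipschitzWith L (F ν t))
    (hcont : ∀ ν ∈ Icc ν₀ ν₁, ∀ x, Continuous fun t => F ν t x)
    (hM : ∀ ν ∈ Icc ν₀ ν₁, ∀ t x, |F ν t x| ≤ M)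
    (hF : ∀ ν ν' t x, |F ν t x - F ν' t x| ≤ C * |ν - ν'|)
    (h₀ : ∀ y : ℝ → ℝ, y t₀ = x₀ → (∀ t ∈ Icc t₀ t₁, HasDerivAt y (F ν₀ t (y t)) t) → y t₁ ≤ x₁)
    (h₁ : ∀ y : ℝ → ℝ, y t₀ = x₀ → (∀ t ∈ Icc t₀ t₁, HasDerivAt y (F ν₁ t (y t)) t) → x₁ ≤ y t₁) :
    ∃ ν ∈ Icc ν₀ ν₁, ∃ y : ℝ → ℝ, y t₀ = x₀ ∧ y t₁ = x₁ ∧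
      ∀ t ∈ Icc t₀ t₁, HasDerivAt y (F ν t (y t)) t := by
  have hex : ∀ ν ∈ Icc ν₀ ν₁, ∃ y : ℝ → ℝ, y t₀ = x₀ ∧
      ∀ t ∈ Icc t₀ t₁, HasDerivAt y (F ν t (y t)) t := fun ν hmem => by
    obtain ⟨y, hy0, hy⟩ := exists_hasDerivAt_of_bounded_lipschitz (hlip ν hmem) (hcont ν hmem)
      (hM ν hmem) t₀ x₀ (R := t₁ - t₀ + 1) (by linarith)
    exact ⟨y, hy0, fun t h => hy t ⟨by linarith [h.1], by linarith [h.2]⟩⟩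
  choose! y hy0 hy using hex
  have hyc : ∀ ν ∈ Icc ν₀ ν₁, ContinuousOn (y ν) (Icc t₀ t₁) := fun ν hmem t h =>
    (hy ν hmem t h).continuousAt.continuousWithinAt
  have hdist : ∀ ν ∈ Icc ν₀ ν₁, ∀ ν' ∈ Icc ν₀ ν₁,
      dist (y ν t₁) (y ν' t₁) ≤ gronwallBound 0 L (C * |ν - ν'|) (t₁ - t₀) := by
    intro ν hmem ν' hmem'
    have := dist_le_of_approx_trajectories_ODE (v := F ν') (K := L) (f := y ν) (g := y ν')
      (a := t₀) (b := t₁) (f' := fun t => F ν t (y ν t)) (g' := fun t => F ν' t (y ν' t))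
      (εf := C * |ν - ν'|) (εg := 0) (δ := 0) (hlip ν' hmem') (hyc ν hmem)
      (fun t h => (hy ν hmem t ⟨h.1, h.2.le⟩).hasDerivWithinAt)
      (fun t _ => by rw [Real.dist_eq]; exact hF _ _ _ _) (hyc ν' hmem')
      (fun t h => (hy ν' hmem' t ⟨h.1, h.2.le⟩).hasDerivWithinAt)
      (fun t _ => by simp) (by rw [hy0 ν hmem, hy0 ν' hmem', dist_self]) t₁ ⟨ht.le, le_rfl⟩
    rwa [add_zero] at this
  have hcon : ContinuousOn (fun ν => y ν t₁) (Icc ν₀ ν₁) := by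
    intro ν hmem
    rw [ContinuousWithinAt, tendsto_iff_dist_tendsto_zero]
    refine squeeze_zero' (Filter.Eventually.of_forall fun _ => dist_nonneg)
      (Filter.eventually_of_mem self_mem_nhdsWithin fun ν' hmem' => hdist ν' hmem' ν hmem) ?_
    have h1 : Continuous fun ν' => gronwallBound 0 L (C * |ν' - ν|) (t₁ - t₀) :=
      (gronwallBound_continuous_ε 0 L (t₁ - t₀)).comp (by fun_prop)
    have h2 := (h1.tendsto ν).mono_left (nhdsWithin_le_nhds (s := Icc ν₀ ν₁))
    simpa [gronwallBound_ε0_δ0] using h2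
  have hm₀ : ν₀ ∈ Icc ν₀ ν₁ := ⟨le_rfl, hν⟩
  have hm₁ : ν₁ ∈ Icc ν₀ ν₁ := ⟨hν, le_rfl⟩
  obtain ⟨ν, hmem, hνx⟩ := intermediate_value_Icc hν hcon
    ⟨h₀ _ (hy0 _ hm₀) (hy _ hm₀), h₁ _ (hy0 _ hm₁) (hy _ hm₁)⟩
  exact ⟨ν, hmem, y ν, hy0 ν hmem, hνx, hy ν hmem⟩

/-- For every large `S` there is an eigenvalue parameter `ν`, bounded below independently of `S`,
for which the Riccati equation `σ' = sigmaField p ν (ψ x) σ` has a solution on `[-a, a]` running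
from `-S` to `S`. -/
theorem exists_sigma_solution {p a : ℝ} (hp : 1 < p) (ha : 0 < a) {ψ : ℝ → ℝ}
    (hψ : ContinuousOn ψ (Icc (-a) a)) :
    ∃ ν₀ > 0, ∀ᶠ S in Filter.atTop, ∃ ν ≥ ν₀, ∃ σ : ℝ → ℝ, σ (-a) = -S ∧ σ a = S ∧
      (∀ x ∈ Icc (-a) a, HasDerivAt σ (sigmaField p ν (ψ x) (σ x)) x) ∧
      0 < sigmaField p ν (ψ (-a)) (-S) ∧ 0 < sigmaField p ν (ψ a) S := by
  have hp1 : 0 < p - 1 := by linarith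
  have haa : -a ≤ a := by linarith
  obtain ⟨Ψ', hΨ'⟩ := isCompact_Icc.exists_bound_of_continuousOn hψ
  obtain ⟨Ψ, hΨ0, hΨ⟩ : ∃ Ψ : ℝ, 0 ≤ Ψ ∧ ∀ x ∈ Icc (-a) a, |ψ x| ≤ Ψ :=
    ⟨Ψ', (norm_nonneg _).trans (hΨ' a ⟨haa, le_rfl⟩), hΨ'⟩
  set t : ℝ → ℝ := fun x => max (-a) (min a x) with ht
  have htm : ∀ x, t x ∈ Icc (-a) a := fun x =>
    ⟨le_max_left _ _, max_le haa (min_le_left _ _)⟩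
  have hteq : ∀ x ∈ Icc (-a) a, t x = x := fun x hx => by
    rw [ht]; simp only; rw [min_eq_right hx.2, max_eq_right hx.1]
  have htc : Continuous t := by fun_prop
  have hφc : Continuous fun x => ψ (t x) := hψ.comp_continuous htc htm
  -- `η * exp (lam * (x + a))` is a supersolution with values in `[η, 1]` on `[-a, a]`.
  set lam : ℝ := (Ψ + 1) / (p - 1) with hlam
  have hlam0 : 0 < lam := by positivity
  set η : ℝ := Real.exp (-(lam * (2 * a))) with hη
  have hη0 : 0 < η := Real.exp_pos _
  refine ⟨η / p, by positivity, ?_⟩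
  set ν₀ : ℝ := η / p with hν₀
  have hν₀0 : 0 < ν₀ := by positivity
  have hev : ∀ᶠ S : ℝ in Filter.atTop, Ψ / ν₀ < S ^ (p - 1) :=
    (tendsto_rpow_atTop hp1).eventually_gt_atTop _
  filter_upwards [hev, Filter.eventually_ge_atTop 1] with S hS hS1
  have hS0 : 0 < S := by linarith
  have hSS : -S ≤ S := by linarith
  -- The field is positive at `±S`, so that solutions cannot leave `[-S, S]` and return.
  have hposS : ∀ ν ≥ ν₀, ∀ k, |k| ≤ Ψ → Ψ * S < ν * (p - 1 + S ^ p) := fun ν hν k hk => by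
    have h1 : Ψ < ν₀ * S ^ (p - 1) := by rwa [div_lt_iff₀' hν₀0] at hS
    have h2 : S ^ p = S ^ (p - 1) * S := by
      rw [← Real.rpow_add_one hS0.ne']; ring_nf
    have h3 : Ψ * S < ν₀ * S ^ p := by
      rw [h2, ← mul_assoc]; exact mul_lt_mul_of_pos_right h1 hS0
    have h4 : ν₀ * S ^ p ≤ ν * S ^ p :=
      mul_le_mul_of_nonneg_right hν (Real.rpow_nonneg hS0.le _)
    have h5 : 0 ≤ ν * (p - 1) := mul_nonneg (hν₀0.le.trans hν) hp1.le
    linarith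
  have hposR : ∀ ν ≥ ν₀, ∀ k, |k| ≤ Ψ → 0 < sigmaField p ν k S := fun ν hν k hk => by
    have h1 := hposS ν hν k hk
    have h2 : -(Ψ * S) ≤ k * S := by
      rw [← neg_mul]; exact mul_le_mul_of_nonneg_right (abs_le.1 hk).1 hS0.le
    rw [sigmaField, abs_of_pos hS0]
    exact div_pos (by linarith) hp1
  have hposL : ∀ ν ≥ ν₀, ∀ k, |k| ≤ Ψ → 0 < sigmaField p ν k (-S) := fun ν hν k hk => by
    have := hposR ν hν (-k) (by rwa [abs_neg])
    rwa [← sigmaField_neg, neg_neg] at this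
  -- Truncation of the Riccati variable to `[-S, S]`.
  set cl : ℝ → ℝ := fun s => max (-S) (min S s) with hcl
  have hclm : ∀ s, cl s ∈ Icc (-S) S := fun s =>
    ⟨le_max_left _ _, max_le hSS (min_le_left _ _)⟩
  have hcleq : ∀ s ∈ Icc (-S) S, cl s = s := fun s hs => by
    rw [hcl]; simp only; rw [min_eq_right hs.2, max_eq_right hs.1]
  have hcll : ∀ x y, |cl x - cl y| ≤ |x - y| := fun x y => by
    calc _ ≤ |min S x - min S y| := by
            simpa using abs_max_sub_max_le_max (-S) (min S x) (-S) (min S y)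
      _ ≤ |x - y| := by simpa using abs_min_sub_min_le_max S x S y
  have hclS : ∀ s, |cl s| ≤ S := fun s => abs_le.2 (hclm s)
  have hclp : ∀ s, |cl s| ^ p ≤ S ^ p := fun s =>
    Real.rpow_le_rpow (abs_nonneg _) (hclS s) (by linarith)
  have hclp0 : ∀ s, 0 ≤ |cl s| ^ p := fun s => Real.rpow_nonneg (abs_nonneg _) _
  obtain ⟨P, hP⟩ := exists_lipschitzWith_clamp hS0 (ψ := fun s => |s| ^ p)
    (ψ' := fun s => p * |s| ^ (p - 2) * s) (fun x _ => hasDerivAt_abs_rpow x hp)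
    (by
      have : Continuous fun s : ℝ => |s| ^ (p - 2) * s := continuous_abs_rpow_mul_self hp
      simp only [mul_assoc]
      exact (this.const_mul p).continuousOn)
  -- For the parameter `ν₁` the solution has slope at least `S / a`.
  set ν₁ : ℝ := S / a + Ψ * S / (p - 1) + ν₀ with hν₁
  have hν₁0 : 0 < ν₁ := by positivity
  have hν₀₁ : ν₀ ≤ ν₁ := by
    have : 0 ≤ S / a + Ψ * S / (p - 1) := by positivity
    linarith
  set F : ℝ → ℝ → ℝ → ℝ := fun ν x s => sigmaField p ν (ψ (t x)) (cl s) with hF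
  have hψt : ∀ x, |ψ (t x)| ≤ Ψ := fun x => hΨ _ (htm x)
  obtain ⟨L, hL⟩ : ∃ L : NNReal, (L : ℝ) = (ν₁ * P + Ψ) / (p - 1) := ⟨⟨_, by positivity⟩, rfl⟩
  obtain ⟨M, hM⟩ : ∃ M : NNReal, (M : ℝ) = (ν₁ * (p - 1 + S ^ p) + Ψ * S) / (p - 1) :=
    ⟨⟨_, by positivity⟩, rfl⟩
  have hlip : ∀ ν ∈ Icc ν₀ ν₁, ∀ x, LipschitzWith L (F ν x) := fun ν hν x =>
    LipschitzWith.of_dist_le_mul fun r s => by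
      have h1 := hP.dist_le_mul r s
      rw [Real.dist_eq, Real.dist_eq] at h1
      have e : F ν x r - F ν x s =
          (ν * (|cl r| ^ p - |cl s| ^ p) + ψ (t x) * (cl r - cl s)) / (p - 1) := by
        simp only [hF, sigmaField]; ring
      rw [Real.dist_eq, Real.dist_eq, hL, e, abs_div, abs_of_pos hp1, div_mul_eq_mul_div]
      refine div_le_div_of_nonneg_right ?_ hp1.le
      refine (abs_add_le _ _).trans ?_
      rw [abs_mul, abs_mul, abs_of_nonneg (hν₀0.le.trans hν.1)]
      have h2 : ν * |(|cl r| ^ p - |cl s| ^ p)| ≤ ν₁ * (P * |r - s|) :=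
        mul_le_mul hν.2 h1 (abs_nonneg _) hν₁0.le
      have h3 : |ψ (t x)| * |cl r - cl s| ≤ Ψ * |r - s| :=
        mul_le_mul (hψt x) (hcll r s) (abs_nonneg _) hΨ0
      linarith
  have hψcl : ∀ x s, |ψ (t x) * cl s| ≤ Ψ * S := fun x s => by
    rw [abs_mul]; exact mul_le_mul (hψt x) (hclS s) (abs_nonneg _) hΨ0
  have hend : ∀ y : ℝ → ℝ, ∀ x ∈ Icc (-a) a, y x ∈ Icc (-S) S → ∀ ν,
      F ν x (y x) = sigmaField p ν (ψ x) (y x) := fun y x hx hy ν => by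
    simp only [hF, hteq x hx, hcleq _ hy]
  obtain ⟨ν, hν, y, hy0, hy1, hy⟩ := exists_shooting (F := F) (x₀ := -S) (x₁ := S) (M := M)
    (C := (p - 1 + S ^ p) / (p - 1)) hν₀₁ (by linarith : -a < a) hlip
    (fun ν _ s => by
      simp only [hF, sigmaField]
      exact (continuous_const.add (hφc.mul continuous_const)).div_const _)
    (fun ν hν x s => by
      rw [hM]
      simp only [hF, sigmaField]
      rw [abs_div, abs_of_pos hp1]
      refine div_le_div_of_nonneg_right ((abs_add_le _ _).trans ?_) hp1.le
      rw [abs_mul, abs_of_nonneg (hν₀0.le.trans hν.1),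
        abs_of_nonneg (by linarith [hclp0 s] : 0 ≤ p - 1 + |cl s| ^ p)]
      have := mul_le_mul hν.2 (by linarith [hclp s] : p - 1 + |cl s| ^ p ≤ p - 1 + S ^ p)
        (by linarith [hclp0 s]) hν₁0.le
      linarith [hψcl x s])
    (fun ν ν' x s => by
      have e : F ν x s - F ν' x s = (p - 1 + |cl s| ^ p) / (p - 1) * (ν - ν') := by
        simp only [hF, sigmaField]; ring
      rw [e, abs_mul, abs_of_nonneg (div_nonneg (by linarith [hclp0 s]) hp1.le)]
      refine mul_le_mul_of_nonneg_right (div_le_div_of_nonneg_right ?_ hp1.le) (abs_nonneg _)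
      linarith [hclp s])
    (fun y hy0 hy => by
      have hβd : ∀ x, HasDerivAt (fun x => η * Real.exp (lam * (x + a)))
          (lam * (η * Real.exp (lam * (x + a)))) x := fun x =>
        (((((hasDerivAt_id x).add_const a).const_mul lam).exp).const_mul η).congr_deriv
          (by simp; ring)
      have hβ1 : η * Real.exp (lam * (a + a)) = 1 := by
        rw [hη, ← Real.exp_add]; simp; ring
      have hle := nonneg_of_deriv_ge (L := L) (t₀ := -a) (t₁ := a)
        (D := fun x => η * Real.exp (lam * (x + a)) - y x)
        (fun x hx => ((hβd x).sub (hy x hx)).continuousAt.continuousWithinAt)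
        (fun x hx => (hβd x).sub (hy x ⟨hx.1.le, hx.2.le⟩))
        (fun x hx hneg => by
          set β := η * Real.exp (lam * (x + a)) with hβ
          have hβη : η ≤ β := by
            have : (1 : ℝ) ≤ Real.exp (lam * (x + a)) :=
              Real.one_le_exp (mul_nonneg hlam0.le (by linarith [hx.1]))
            exact le_mul_of_one_le_right hη0.le this
          have hβle : β ≤ 1 := by
            rw [← hβ1, hβ]
            have : lam * (x + a) ≤ lam * (a + a) := by gcongr; exact hx.2.le
            gcongr
          have hβ0 : 0 < β := hη0.trans_le hβη
          have h1 := (hlip ν₀ ⟨le_rfl, hν₀₁⟩ x).dist_le_mul β (y x)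
          rw [Real.dist_eq, Real.dist_eq, abs_of_neg hneg] at h1
          have h2 : F ν₀ x β ≤ lam * β := by
            have hβS : cl β = β := hcleq β ⟨by linarith, by linarith⟩
            simp only [hF, sigmaField, hβS]
            rw [hlam, div_mul_eq_mul_div (Ψ + 1) (p - 1) β, abs_of_pos hβ0]
            refine div_le_div_of_nonneg_right ?_ hp1.le
            have h3 : β ^ p ≤ 1 := Real.rpow_le_one hβ0.le hβle (by linarith)
            have h4 : ψ (t x) * β ≤ Ψ * β :=
              mul_le_mul_of_nonneg_right ((le_abs_self _).trans (hψt x)) hβ0.le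
            have h5 : ν₀ * (p - 1 + β ^ p) ≤ ν₀ * p := by gcongr; linarith
            have h6 : ν₀ * p = η := by rw [hν₀]; field_simp
            linarith
          have h3 := (abs_le.1 h1).1
          linarith)
        (by
          have := mul_pos hη0 (Real.exp_pos (lam * (-a + a)))
          simp only [hy0]
          linarith) a ⟨haa, le_rfl⟩
      simp only [hβ1] at hle
      linarith)
    (fun y hy0 hy => by
      have hle := nonneg_of_deriv_ge (L := 0) (t₀ := -a) (t₁ := a)
        (D := fun x => y x - (-S + S / a * (x + a)))
        (D' := fun x => F ν₁ x (y x) - S / a)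
        (fun x hx => ((hy x hx).continuousAt.sub (by fun_prop)).continuousWithinAt)
        (fun x hx => (hy x ⟨hx.1.le, hx.2.le⟩).sub
          ((((((hasDerivAt_id x).add_const a).const_mul (S / a))).const_add (-S)).congr_deriv
            (by simp)))
        (fun x hx _ => by
          have h1 := (abs_le.1 (hψcl x (y x))).1
          have h2 : 0 ≤ ν₁ * |cl (y x)| ^ p := mul_nonneg hν₁0.le (hclp0 _)
          have h3 : S / a ≤ F ν₁ x (y x) := by
            simp only [hF, sigmaField]
            rw [le_div_iff₀ hp1]
            have : ν₁ * (p - 1) = S / a * (p - 1) + Ψ * S + ν₀ * (p - 1) := by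
              rw [hν₁]; field_simp
            have h4 : 0 ≤ ν₀ * (p - 1) := by positivity
            linarith
          linarith)
        (by rw [hy0]; simp) a ⟨haa, le_rfl⟩
      have e : -S + S / a * (a + a) = S := by field_simp; ring
      rw [e] at hle
      linarith)
  have hyc : ContinuousOn y (Icc (-a) a) := fun x hx => (hy x hx).continuousAt.continuousWithinAt
  -- The truncation is not active along the solution found.
  have hlow := nonneg_of_deriv_ge (L := 0) (t₀ := -a) (t₁ := a) (D := fun x => y x + S)
    (hyc.add continuousOn_const) (fun x hx => (hy x ⟨hx.1.le, hx.2.le⟩).add_const S)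
    (fun x hx hneg => by
      have : cl (y x) = -S := by
        simp only [hcl]; rw [min_eq_right (by linarith), max_eq_left (by linarith)]
      simp only [hF, this, zero_mul]
      exact (hposL ν hν.1 _ (hψt x)).le) (by rw [hy0]; simp)
  have hupp := nonneg_of_deriv_le (L := 0) (t₀ := -a) (t₁ := a) (D := fun x => S - y x)
    (continuousOn_const.sub hyc) (fun x hx => (hy x ⟨hx.1.le, hx.2.le⟩).const_sub S)
    (fun x hx hneg => by
      have : cl (y x) = S := by
        simp only [hcl]; rw [min_eq_left (by linarith), max_eq_right (by linarith)]
      simp only [hF, this, zero_mul]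
      linarith [hposR ν hν.1 _ (hψt x)]) (by rw [hy1]; simp)
  refine ⟨ν, hν.1, y, hy0, hy1, fun x hx => ?_, hposL ν hν.1 _ (hΨ _ ⟨le_rfl, haa⟩),
    hposR ν hν.1 _ (hΨ _ ⟨haa, le_rfl⟩)⟩
  rw [← hend y x hx ⟨by linarith [hlow x hx], by linarith [hupp x hx]⟩]
  exact hy x hx

/-- The Riccati variable is strictly increasing at the points where it is nonnegative, provided it
is so at the right end. The derivative `ψ'` has constant sign, which decides whether a failure is
propagated to the right end or to a zero of `σ`; either is impossible. -/
theorem sigmaField_pos_of_nonneg {p ν K c a : ℝ} (hp : 1 < p) (hν : 0 < ν) {ψ σ : ℝ → ℝ}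
    (hψ : ∀ x ∈ Icc (-a) a, HasDerivAt ψ (-K - c * ψ x ^ 2) x)
    (hσ : ∀ x ∈ Icc (-a) a, HasDerivAt σ (sigmaField p ν (ψ x) (σ x)) x)
    (hl : σ (-a) ≤ 0) (hr : 0 < sigmaField p ν (ψ a) (σ a)) {x : ℝ} (hx : x ∈ Icc (-a) a)
    (hσx : 0 ≤ σ x) : 0 < sigmaField p ν (ψ x) (σ x) := by
  have hp1 : 0 < p - 1 := by linarith
  have hψc : ContinuousOn ψ (Icc (-a) a) := fun x hx => (hψ x hx).continuousAt.continuousWithinAt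
  have hσc : ContinuousOn σ (Icc (-a) a) := fun x hx => (hσ x hx).continuousAt.continuousWithinAt
  by_contra! hneg
  set D : ℝ → ℝ := fun x => sigmaField p ν (ψ x) (σ x) with hD
  set ρ : ℝ → ℝ := fun x => -K - c * ψ x ^ 2 with hρ
  set A : ℝ → ℝ := fun x => (ν * (p * |σ x| ^ (p - 2) * σ x) + ψ x) / (p - 1) with hA
  have hDc : ContinuousOn D (Icc (-a) a) := continuousOn_sigmaField hp hψc hσc
  have hDd : ∀ x ∈ Icc (-a) a, HasDerivAt D (A x * D x + ρ x * σ x / (p - 1)) x := fun x hx => by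
    have h1 : HasDerivAt (fun x => |σ x| ^ p) (p * |σ x| ^ (p - 2) * σ x * D x) x :=
      HasDerivAt.comp (h₂ := fun t : ℝ => |t| ^ p) x (hasDerivAt_abs_rpow (σ x) hp) (hσ x hx)
    have h2 := ((((h1.const_add (p - 1)).const_mul ν).add
      ((hψ x hx).mul (hσ x hx))).div_const (p - 1))
    refine h2.congr_deriv ?_
    simp only [hA, hD, hρ]; ring
  have hAc : ContinuousOn A (Icc (-a) a) := by
    have : ContinuousOn (fun x => |σ x| ^ (p - 2) * σ x) (Icc (-a) a) :=
      (continuous_abs_rpow_mul_self hp).comp_continuousOn hσc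
    simp only [hA, mul_assoc]
    fun_prop
  obtain ⟨B, hB⟩ := isCompact_Icc.exists_bound_of_continuousOn hAc
  obtain ⟨B', hB'⟩ := isCompact_Icc.exists_bound_of_continuousOn hψc
  simp only [Real.norm_eq_abs] at hB hB'
  have hρc : ContinuousOn ρ (Icc (-a) a) := by simp only [hρ]; fun_prop
  have hρd : ∀ x ∈ Icc (-a) a, HasDerivAt ρ (-(2 * c * ψ x) * ρ x) x := fun x hx =>
    ((((hψ x hx).pow 2).const_mul c).const_sub (-K)).congr_deriv (by simp only [hρ]; simp; ring)
  obtain ⟨Bρ, hBρ⟩ := isCompact_Icc.exists_bound_of_continuousOn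
    ((continuousOn_const (c := 2 * c)).mul hψc).neg
  have hρs : (∀ y ∈ Icc (-a) a, 0 ≤ ρ y) ∨ ∀ y ∈ Icc (-a) a, 0 ≤ -ρ y := by
    have hb : ∀ y ∈ Ioo (-a) a, |-(2 * c * ψ y) * ρ y| ≤ Bρ * |ρ y| := fun y hy => by
      rw [abs_mul]
      exact mul_le_mul_of_nonneg_right (hBρ y ⟨hy.1.le, hy.2.le⟩) (abs_nonneg _)
    rcases le_total 0 (ρ x) with h | h
    · exact Or.inl (nonneg_of_abs_deriv_le hρc (fun y hy => hρd y ⟨hy.1.le, hy.2.le⟩) hb hx h)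
    · exact Or.inr (nonneg_of_abs_deriv_le (D := fun y => -ρ y) hρc.neg
        (fun y hy => (hρd y ⟨hy.1.le, hy.2.le⟩).neg)
        (fun y hy => by rw [abs_neg, abs_neg]; exact hb y hy) hx (by linarith))
  -- Once nonnegative, `σ` stays nonnegative.
  have hσ0 : ∀ z ∈ Icc (-a) a, 0 ≤ σ z → ∀ y ∈ Icc z a, 0 ≤ σ y := fun z hz hσz => by
    refine nonneg_of_deriv_ge (L := B' / (p - 1)) (hσc.mono (Icc_subset_Icc_left hz.1))
      (fun y hy => hσ y ⟨hz.1.trans hy.1.le, hy.2.le⟩) (fun y hy hσy => ?_) hσz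
    have h1 := (abs_le.1 (hB' y ⟨hz.1.trans hy.1.le, hy.2.le⟩)).2
    rw [sigmaField, div_mul_eq_mul_div]
    refine div_le_div_of_nonneg_right ?_ hp1.le
    have h2 : 0 ≤ ν * (p - 1 + |σ y| ^ p) :=
      mul_nonneg hν.le (add_nonneg hp1.le (Real.rpow_nonneg (abs_nonneg _) _))
    have h3 := mul_le_mul_of_nonpos_right h1 hσy.le
    linarith
  rcases hρs with hρs | hρs
  -- `ψ' ≥ 0`: the failure propagates backwards to a zero `z` of `σ`, where `D z = ν`.
  · obtain ⟨z, hz, hσz⟩ := intermediate_value_Icc hx.1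
      (hσc.mono (Icc_subset_Icc_right hx.2)) ⟨hl, hσx⟩
    have hz' : z ∈ Icc (-a) a := ⟨hz.1, hz.2.trans hx.2⟩
    have hmem : ∀ {y}, y ∈ Icc z x → y ∈ Icc (-a) a := fun hy =>
      ⟨hz.1.trans hy.1, hy.2.trans hx.2⟩
    have := nonneg_of_deriv_le (D := fun y => -D y) (L := -B) (t₀ := z) (t₁ := x)
      (hDc.mono fun y hy => hmem hy).neg (fun y hy => (hDd y (hmem ⟨hy.1.le, hy.2.le⟩)).neg)
      (fun y hy hDy => by
        have hy' := hmem ⟨hy.1.le, hy.2.le⟩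
        have h1 := (abs_le.1 (hB y hy')).1
        have h2 : 0 ≤ ρ y * σ y / (p - 1) := div_nonneg
          (mul_nonneg (hρs y hy') (hσ0 z hz' hσz.ge y ⟨hy.1.le, hy'.2⟩)) hp1.le
        nlinarith) (by linarith) z ⟨le_rfl, hz.2⟩
    have hDz : D z = ν := by
      simp only [hD, sigmaField, hσz]
      simp [Real.zero_rpow (by linarith : p ≠ 0)]
      field_simp
    linarith
  -- `ψ' ≤ 0`: the failure propagates forwards to `a`.
  · have hmem : ∀ {y}, y ∈ Icc x a → y ∈ Icc (-a) a := fun hy => ⟨hx.1.trans hy.1, hy.2⟩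
    have := nonneg_of_deriv_ge (D := fun y => -D y) (L := B) (t₀ := x) (t₁ := a)
      (hDc.mono fun y hy => hmem hy).neg (fun y hy => (hDd y (hmem ⟨hy.1.le, hy.2.le⟩)).neg)
      (fun y hy hDy => by
        have hy' := hmem ⟨hy.1.le, hy.2.le⟩
        have h1 := (abs_le.1 (hB y hy')).2
        have h2 : ρ y * σ y / (p - 1) ≤ 0 := div_nonpos_of_nonpos_of_nonneg
          (mul_nonpos_of_nonpos_of_nonneg (by linarith [hρs y hy'])
            (hσ0 x hx hσx y ⟨hy.1.le, hy'.2⟩)) hp1.le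
        nlinarith) (by linarith) a ⟨hx.2, le_rfl⟩
    linarith

/-- The two-sided form of `sigmaField_pos_of_nonneg`: negative values of `σ` are treated by
reflecting the interval. -/
theorem sigmaField_pos {p ν K c a : ℝ} (hp : 1 < p) (hν : 0 < ν) {ψ σ : ℝ → ℝ}
    (hψ : ∀ x ∈ Icc (-a) a, HasDerivAt ψ (-K - c * ψ x ^ 2) x)
    (hσ : ∀ x ∈ Icc (-a) a, HasDerivAt σ (sigmaField p ν (ψ x) (σ x)) x)
    (hl : σ (-a) ≤ 0) (hr : 0 ≤ σ a) (hl' : 0 < sigmaField p ν (ψ (-a)) (σ (-a)))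
    (hr' : 0 < sigmaField p ν (ψ a) (σ a)) {x : ℝ} (hx : x ∈ Icc (-a) a) :
    0 < sigmaField p ν (ψ x) (σ x) := by
  rcases le_total 0 (σ x) with h | h
  · exact sigmaField_pos_of_nonneg hp hν hψ hσ hl hr' hx h
  · have hm : ∀ {x}, x ∈ Icc (-a) a → -x ∈ Icc (-a) a := fun hx =>
      ⟨by linarith [hx.2], by linarith [hx.1]⟩
    have := sigmaField_pos_of_nonneg (K := K) (c := c) (ψ := fun x => -ψ (-x))
      (σ := fun x => -σ (-x)) hp hν
      (fun x hx => ((hψ (-x) (hm hx)).scomp x (hasDerivAt_neg x)).neg.congr_deriv (by simp; ring))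
      (fun x hx => ((hσ (-x) (hm hx)).scomp x (hasDerivAt_neg x)).neg.congr_deriv
        (by simp [sigmaField_neg]))
      (by simpa using hr) (by simpa [sigmaField_neg] using hl') (hm hx) (by simpa using h)
    simpa [sigmaField_neg] using this

/-- The inverse function of a solution of `σ' = D > 0` on an interval. -/
theorem exists_inverse_trajectory {a S : ℝ} (ha : 0 < a) {σ D : ℝ → ℝ}
    (hσ : ∀ x ∈ Icc (-a) a, HasDerivAt σ (D x) x) (hDc : ContinuousOn D (Icc (-a) a))
    (hD : ∀ x ∈ Icc (-a) a, 0 < D x) (hl : σ (-a) = -S) (hr : σ a = S) :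
    ∃ (ε : ℝ) (X : ℝ → ℝ), 0 < ε ∧ ContinuousOn X (Icc (-S) S) ∧
      MapsTo X (Icc (-S) S) (Icc (-a) a) ∧ (∀ s ∈ Icc (-S) S, σ (X s) = s) ∧
      (∀ s ∈ Ioo (-S) S, HasDerivAt X (1 / D (X s)) s) ∧ (∀ s ∈ Icc (-S) S, ε ≤ D (X s)) ∧
      X (-S) = -a ∧ X S = a := by
  have haa : -a ≤ a := by linarith
  have hσc : ContinuousOn σ (Icc (-a) a) := fun x hx => (hσ x hx).continuousAt.continuousWithinAt
  have hla : -a ∈ Icc (-a) a := ⟨le_rfl, haa⟩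
  have hra : a ∈ Icc (-a) a := ⟨haa, le_rfl⟩
  obtain ⟨x₀, hx₀, hmin⟩ := isCompact_Icc.exists_isMinOn ⟨a, hra⟩ hDc
  set ε := D x₀ with hε
  have hε0 : 0 < ε := hD x₀ hx₀
  have hεle : ∀ x ∈ Icc (-a) a, ε ≤ D x := fun x hx => hmin hx
  have hmono : MonotoneOn (fun x => σ x - ε * x) (Icc (-a) a) := by
    refine monotoneOn_of_hasDerivWithinAt_nonneg (f' := fun x => D x - ε) (convex_Icc _ _)
      (hσc.sub (by fun_prop)) (fun x hx => ?_)
      fun x hx => sub_nonneg.2 (hεle x (interior_subset hx))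
    exact ((hσ x (interior_subset hx)).sub
      (((hasDerivAt_id x).const_mul ε).congr_deriv (mul_one ε))).hasDerivWithinAt
  have hexp : ∀ x ∈ Icc (-a) a, ∀ y ∈ Icc (-a) a, ε * |x - y| ≤ |σ x - σ y| := by
    have : ∀ x ∈ Icc (-a) a, ∀ y ∈ Icc (-a) a, x ≤ y → ε * |x - y| ≤ |σ x - σ y| := by
      intro x hx y hy hxy
      have := hmono hx hy hxy
      simp only at this
      have h2 : 0 ≤ ε * (y - x) := mul_nonneg hε0.le (by linarith)
      rw [abs_of_nonpos (by linarith : x - y ≤ 0), abs_of_nonpos (by linarith : σ x - σ y ≤ 0)]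
      linarith
    intro x hx y hy
    rcases le_total x y with h | h
    · exact this x hx y hy h
    · rw [abs_sub_comm, abs_sub_comm (σ x)]; exact this y hy x hx h
  have hinj : ∀ x ∈ Icc (-a) a, ∀ y ∈ Icc (-a) a, σ x = σ y → x = y := fun x hx y hy h => by
    have := hexp x hx y hy
    rw [h, sub_self, abs_zero] at this
    have h0 : |x - y| ≤ 0 := by
      by_contra! h
      exact absurd this (not_le.2 (mul_pos hε0 h))
    exact sub_eq_zero.1 (abs_eq_zero.1 (le_antisymm h0 (abs_nonneg _)))
  have hex : ∀ s ∈ Icc (-S) S, ∃ x ∈ Icc (-a) a, σ x = s := fun s hs =>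
    intermediate_value_Icc haa hσc (by rwa [hl, hr])
  choose! X hXm hXσ using hex
  have hS : S ∈ Icc (-S) S ∧ -S ∈ Icc (-S) S := by
    have : -S ≤ S := by
      rw [← hl, ← hr]
      have := hmono hla hra haa
      simp only at this
      have h2 : 0 ≤ ε * a := by positivity
      linarith
    exact ⟨⟨this, le_rfl⟩, le_rfl, this⟩
  have hXl : ∀ s ∈ Icc (-S) S, ∀ r ∈ Icc (-S) S, |X s - X r| ≤ 1 / ε * |s - r| := by
    intro s hs r hr
    have := hexp _ (hXm s hs) _ (hXm r hr)
    rw [hXσ s hs, hXσ r hr] at this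
    rw [one_div, inv_mul_eq_div, le_div_iff₀ hε0]
    linarith
  have hXc : ContinuousOn X (Icc (-S) S) := by
    have : LipschitzOnWith (1 / ε).toNNReal X (Icc (-S) S) :=
      LipschitzOnWith.of_dist_le_mul fun s hs r hr => by
        rw [Real.coe_toNNReal _ (by positivity)]; exact hXl s hs r hr
    exact this.continuousOn
  refine ⟨ε, X, hε0, hXc, hXm, hXσ, fun s hs => ?_, fun s hs => hεle _ (hXm s hs),
    hinj _ (hXm _ hS.2) _ hla (by rw [hXσ _ hS.2, hl]),
    hinj _ (hXm _ hS.1) _ hra (by rw [hXσ _ hS.1, hr])⟩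
  have hs' : s ∈ Icc (-S) S := ⟨hs.1.le, hs.2.le⟩
  rw [one_div]
  refine HasDerivAt.of_local_left_inverse (hXc.continuousAt (Icc_mem_nhds hs.1 hs.2))
    (hσ _ (hXm s hs')) (hD _ (hXm s hs')).ne' ?_
  filter_upwards [Icc_mem_nhds hs.1 hs.2] with r hr using hXσ r hr

/-! ### Approximate eigenfunctions from the Riccati equation -/

/-- A solution of the Riccati equation comes from a solution `F` of the weighted `p`-Laplace
eigenvalue equation: `F' = ν u` and `(J u ^ (p - 1))' = -ν |F| ^ (p - 2) F J`, with `F = σ u`. -/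
theorem exists_eigenfunction_of_sigma {p ν a : ℝ} (hp : 1 < p) (ha : 0 < a) {ψ σ J : ℝ → ℝ}
    (hψ : ContinuousOn ψ (Icc (-a) a))
    (hσ : ∀ x ∈ Icc (-a) a, HasDerivAt σ (sigmaField p ν (ψ x) (σ x)) x)
    (hJ : ∀ x ∈ Icc (-a) a, HasDerivAt J (ψ x * J x) x) :
    ∃ F u : ℝ → ℝ, ContDiff ℝ 1 F ∧ (∀ x, deriv F x = ν * u x) ∧ (∀ x, 0 < u x) ∧ Continuous u ∧
      (∀ x ∈ Icc (-a) a, F x = σ x * u x) ∧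
      ∀ x ∈ Icc (-a) a, HasDerivAt (fun x => J x * u x ^ (p - 1))
        (-ν * (|F x| ^ (p - 2) * F x * J x)) x := by
  have hp1 : 0 < p - 1 := by linarith
  have haa : -a ≤ a := by linarith
  have hσc : ContinuousOn σ (Icc (-a) a) := fun x hx => (hσ x hx).continuousAt.continuousWithinAt
  set t : ℝ → ℝ := fun x => max (-a) (min a x) with ht
  have htm : ∀ x, t x ∈ Icc (-a) a := fun x =>
    ⟨le_max_left _ _, max_le haa (min_le_left _ _)⟩
  have hteq : ∀ x ∈ Icc (-a) a, t x = x := fun x hx => by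
    rw [ht]; simp only; rw [min_eq_right hx.2, max_eq_right hx.1]
  have htc : Continuous t := by fun_prop
  have hψt : Continuous fun x => ψ (t x) := hψ.comp_continuous htc htm
  have hσt : Continuous fun x => σ (t x) := hσc.comp_continuous htc htm
  set k : ℝ → ℝ := fun x => -(1 / (p - 1)) * (ψ (t x) + ν * (|σ (t x)| ^ (p - 2) * σ (t x))) with hk
  have hkc : Continuous k :=
    continuous_const.mul (hψt.add (continuous_const.mul
      ((continuous_abs_rpow_mul_self hp).comp hσt)))
  set u : ℝ → ℝ := fun x => Real.exp (∫ y in -a..x, k y) with hu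
  have hud : ∀ x, HasDerivAt u (u x * k x) x := fun x =>
    (intervalIntegral.integral_hasDerivAt_right (hkc.intervalIntegrable _ _)
      hkc.aestronglyMeasurable.stronglyMeasurableAtFilter hkc.continuousAt).exp
  have huc : Continuous u := continuous_iff_continuousAt.2 fun x => (hud x).continuousAt
  have hu0 : ∀ x, 0 < u x := fun x => Real.exp_pos _
  set F : ℝ → ℝ := fun x => σ (-a) * u (-a) + ∫ y in -a..x, ν * u y with hF
  have huc' : Continuous fun y => ν * u y := continuous_const.mul huc
  have hFd : ∀ x, HasDerivAt F (ν * u x) x := fun x =>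
    (intervalIntegral.integral_hasDerivAt_right (huc'.intervalIntegrable _ _)
      huc'.aestronglyMeasurable.stronglyMeasurableAtFilter huc'.continuousAt).const_add _
  -- `F` is the extension of `σ u` to a global `C¹` function.
  have hFσ : ∀ x ∈ Icc (-a) a, F x = σ x * u x := by
    have hd : ∀ x ∈ Icc (-a) a, HasDerivAt (fun x => F x - σ x * u x) 0 x := fun x hx => by
      refine ((hFd x).sub ((hσ x hx).mul (hud x))).congr_deriv ?_
      have := abs_rpow_mul_self_mul_self hp (σ x)
      simp only [hk, hteq x hx, sigmaField]
      rw [← this]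
      field_simp
      ring
    have := nonneg_of_abs_deriv_le (L := 0) (D := fun x => F x - σ x * u x)
      (fun x hx => (hd x hx).continuousAt.continuousWithinAt) (fun x hx => hd x ⟨hx.1.le, hx.2.le⟩)
      (fun x _ => by simp) (s := -a) ⟨le_rfl, haa⟩ (by simp [hF])
    have h' := nonneg_of_abs_deriv_le (L := 0) (D := fun x => -(F x - σ x * u x))
      (D' := fun _ => -0)
      (fun x hx => (hd x hx).neg.continuousAt.continuousWithinAt)
      (fun x hx => (hd x ⟨hx.1.le, hx.2.le⟩).neg)
      (fun x _ => by simp) (s := -a) ⟨le_rfl, haa⟩ (by simp [hF])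
    intro x hx
    linarith [this x hx, h' x hx]
  have hdF : deriv F = fun x => ν * u x := funext fun x => (hFd x).deriv
  refine ⟨F, u, contDiff_one_iff_deriv.2 ⟨fun x => (hFd x).differentiableAt, hdF ▸ huc'⟩,
    fun x => (hFd x).deriv, hu0, huc, hFσ, fun x hx => ?_⟩
  have h1 : HasDerivAt (fun x => u x ^ (p - 1)) (u x * k x * (p - 1) * u x ^ (p - 1 - 1)) x :=
    (hud x).rpow_const (Or.inl (hu0 x).ne')
  refine ((hJ x hx).mul h1).congr_deriv ?_
  have e1 : u x ^ (p - 1 - 1) = u x ^ (p - 1) / u x := Real.rpow_sub_one (hu0 x).ne' _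
  have e2 : u x ^ (p - 2) * u x = u x ^ (p - 1) := by
    rw [← Real.rpow_add_one (hu0 x).ne']; ring_nf
  have e3 : |F x| ^ (p - 2) * F x = u x ^ (p - 1) * (|σ x| ^ (p - 2) * σ x) := by
    rw [hFσ x hx, abs_mul, Real.mul_rpow (abs_nonneg _) (abs_nonneg _), abs_of_pos (hu0 x), ← e2]
    ring
  have hu0x := (hu0 x).ne'
  rw [e1, e3]
  simp only [hk, hteq x hx]
  field_simp
  ring

/-- A trace inequality: the boundary values of a `C^1` function are controlled by its weighted
Sobolev norm. -/
theorem mul_abs_rpow_right_le {p a j : ℝ} (hp : 1 < p) (ha : 0 < a) (hj : 0 ≤ j) {J F : ℝ → ℝ}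
    (hJ : ContinuousOn J (Icc (-a) a)) (hjJ : ∀ x ∈ Icc (-a) a, j ≤ J x) (hF : ContDiff ℝ 1 F) :
    j * |F a| ^ p ≤ (1 / (2 * a) + p) *
      ((∫ x in -a..a, |F x| ^ p * J x) + ∫ x in -a..a, |deriv F x| ^ p * J x) := by
  have haa : -a ≤ a := by linarith
  have hdF : Continuous (deriv F) := hF.continuous_deriv le_rfl
  have hFd : ∀ x, HasDerivAt F (deriv F x) x := fun x =>
    (hF.differentiable one_ne_zero).differentiableAt.hasDerivAt
  have hd : ∀ x, HasDerivAt (fun x => (x + a) / (2 * a) * |F x| ^ p)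
      (1 / (2 * a) * |F x| ^ p + (x + a) / (2 * a) * (p * |F x| ^ (p - 2) * F x * deriv F x)) x :=
    fun x => (((hasDerivAt_id x).add_const a).div_const (2 * a)).mul
      (HasDerivAt.comp (h₂ := fun t : ℝ => |t| ^ p) x (hasDerivAt_abs_rpow (F x) hp) (hFd x))
  have hc1 : Continuous fun x => |F x| ^ p :=
    hF.continuous.abs.rpow_const fun _ => Or.inr (by linarith)
  have hc2 : Continuous fun x => |F x| ^ (p - 2) * F x :=
    (continuous_abs_rpow_mul_self hp).comp hF.continuous
  have hcd : Continuous fun x => 1 / (2 * a) * |F x| ^ p +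
      (x + a) / (2 * a) * (p * |F x| ^ (p - 2) * F x * deriv F x) := by
    have : ∀ x, p * |F x| ^ (p - 2) * F x * deriv F x = p * (|F x| ^ (p - 2) * F x) * deriv F x :=
      fun x => by ring
    simp only [this]
    fun_prop
  have hftc := intervalIntegral.integral_eq_sub_of_hasDerivAt (a := -a) (b := a)
    (fun x _ => hd x) (hcd.intervalIntegrable _ _)
  have e : (a + a) / (2 * a) = 1 := by field_simp; ring
  rw [e, neg_add_cancel, zero_div, zero_mul, one_mul, sub_zero] at hftc
  have i1 := (continuousOn_abs_rpow_mul hp hJ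
    hF.continuous.continuousOn).intervalIntegrable_neg_self ha
  have i2 := (continuousOn_abs_rpow_mul hp hJ hdF.continuousOn).intervalIntegrable_neg_self ha
  rw [← hftc, ← intervalIntegral.integral_const_mul, ← intervalIntegral.integral_add i1 i2,
    ← intervalIntegral.integral_const_mul]
  refine intervalIntegral.integral_mono_on haa ((hcd.intervalIntegrable _ _).const_mul j)
    ((i1.add i2).const_mul _) fun x hx => ?_
  have hy := mul_rpow_sub_one_le hp (abs_nonneg (deriv F x)) (abs_nonneg (F x))
  have h1 : |F x| ^ (p - 2) * F x * deriv F x ≤ |deriv F x| * |F x| ^ (p - 1) := by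
    rw [← abs_abs_rpow_mul_self hp (F x), ← abs_mul, mul_comm]
    exact le_abs_self _
  have hA : 0 ≤ |F x| ^ p := Real.rpow_nonneg (abs_nonneg _) _
  have hB : 0 ≤ |deriv F x| ^ p := Real.rpow_nonneg (abs_nonneg _) _
  have h2 : p * |F x| ^ (p - 2) * F x * deriv F x ≤ p * (|F x| ^ p + |deriv F x| ^ p) := by
    have h3 := mul_le_mul_of_nonneg_left h1 (by linarith : (0 : ℝ) ≤ p)
    nlinarith
  have hw0 : 0 ≤ (x + a) / (2 * a) := div_nonneg (by linarith [hx.1]) (by linarith)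
  have hw1 : (x + a) / (2 * a) ≤ 1 := by
    rw [div_le_one (by linarith)]; linarith [hx.2]
  have hs : 0 ≤ p * (|F x| ^ p + |deriv F x| ^ p) := by positivity
  have h4 : 1 / (2 * a) * |F x| ^ p + (x + a) / (2 * a) * (p * |F x| ^ (p - 2) * F x * deriv F x) ≤
      (1 / (2 * a) + p) * (|F x| ^ p + |deriv F x| ^ p) := by
    have h5 := mul_le_mul_of_nonneg_left h2 hw0
    have h6 := mul_le_mul_of_nonneg_right hw1 hs
    have h7 : 0 ≤ 1 / (2 * a) * |deriv F x| ^ p := by positivity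
    linarith
  calc _ ≤ j * ((1 / (2 * a) + p) * (|F x| ^ p + |deriv F x| ^ p)) :=
        mul_le_mul_of_nonneg_left h4 hj
    _ ≤ J x * ((1 / (2 * a) + p) * (|F x| ^ p + |deriv F x| ^ p)) :=
        mul_le_mul_of_nonneg_right (hjJ x hx) (by positivity)
    _ = _ := by ring

theorem mul_abs_rpow_left_le {p a j : ℝ} (hp : 1 < p) (ha : 0 < a) (hj : 0 ≤ j) {J F : ℝ → ℝ}
    (hJ : ContinuousOn J (Icc (-a) a)) (hjJ : ∀ x ∈ Icc (-a) a, j ≤ J x) (hF : ContDiff ℝ 1 F) :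
    j * |F (-a)| ^ p ≤ (1 / (2 * a) + p) *
      ((∫ x in -a..a, |F x| ^ p * J x) + ∫ x in -a..a, |deriv F x| ^ p * J x) := by
  have hm : MapsTo (fun x : ℝ => -x) (Icc (-a) a) (Icc (-a) a) := fun x hx =>
    ⟨by linarith [hx.2], by linarith [hx.1]⟩
  have := mul_abs_rpow_right_le hp ha hj (J := fun x => J (-x)) (F := fun x => F (-x))
    (hJ.comp continuousOn_neg hm) (fun x hx => hjJ _ (hm hx)) (hF.comp contDiff_neg)
  simp only [deriv_comp_neg, abs_neg] at this
  rwa [intervalIntegral.integral_comp_neg (fun x => |F x| ^ p * J x),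
    intervalIntegral.integral_comp_neg (fun x => |deriv F x| ^ p * J x), neg_neg] at this

/-- The energy identity of an approximate eigenfunction, together with the Poincaré inequality for
its translate of vanishing `p`-mean. The number `U` bounds the boundary values of `u`. -/
theorem PoincareBound.energy_estimate {p ν a S μ B U : ℝ} (hp : 1 < p) (hν : 0 < ν) (ha : 0 < a)
    (hS : 0 < S) (hμ : 0 ≤ μ) {J F u : ℝ → ℝ} (hJ : ContinuousOn J (Icc (-a) a))
    (hJ0 : ∀ x ∈ Icc (-a) a, 0 < J x) (hJB : ∀ x ∈ Icc (-a) a, J x ≤ B)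
    (h : PoincareBound p a μ J) (hF : ContDiff ℝ 1 F) (hdF : ∀ x, deriv F x = ν * u x)
    (hu0 : ∀ x, 0 < u x) (hu : Continuous u)
    (hg : ∀ x ∈ Icc (-a) a, HasDerivAt (fun x => J x * u x ^ (p - 1))
      (-ν * (|F x| ^ (p - 2) * F x * J x)) x)
    (hl : F (-a) = -S * u (-a)) (hr : F a = S * u a) (hUl : u (-a) ≤ U) (hUr : u a ≤ U) :
    (∫ x in -a..a, |deriv F x| ^ p * J x) ≤
        ν ^ p * (∫ x in -a..a, |F x| ^ p * J x) + ν ^ (p - 1) * (S * (2 * B * U ^ p)) ∧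
      μ * (∫ x in -a..a, |F x| ^ p * J x) ≤
        (∫ x in -a..a, |deriv F x| ^ p * J x) + μ * p / ν * (S * (B * U ^ p)) := by
  have haa : -a ≤ a := by linarith
  have hla : -a ∈ Icc (-a) a := ⟨le_rfl, haa⟩
  have hra : a ∈ Icc (-a) a := ⟨haa, le_rfl⟩
  have hU : 0 < U := (hu0 a).trans_le hUr
  have hB : 0 < B := (hJ0 a hra).trans_le (hJB a hra)
  have hUp : U ^ (p - 1) * U = U ^ p := by rw [← Real.rpow_add_one hU.ne']; ring_nf
  have hup : ∀ x, u x ^ (p - 1) * u x = u x ^ p := fun x => by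
    rw [← Real.rpow_add_one (hu0 x).ne']; ring_nf
  have hνp : ν ^ (p - 1) * ν = ν ^ p := by rw [← Real.rpow_add_one hν.ne']; ring_nf
  have hupc : Continuous fun x => u x ^ p := hu.rpow_const fun _ => Or.inr (by linarith)
  have hFd : ∀ x, HasDerivAt F (ν * u x) x := fun x =>
    hdF x ▸ (hF.differentiable one_ne_zero).differentiableAt.hasDerivAt
  have iN := (continuousOn_abs_rpow_mul hp hJ
    hF.continuous.continuousOn).intervalIntegrable_neg_self ha
  have iM := (continuousOn_abs_rpow_mul_self_mul hp hJ
    hF.continuous.continuousOn).intervalIntegrable_neg_self ha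
  have iu : IntervalIntegrable (fun x => u x ^ p * J x) volume (-a) a :=
    (hupc.continuousOn.mul hJ).intervalIntegrable_neg_self ha
  set N := ∫ x in -a..a, |F x| ^ p * J x with hN
  have hE : (∫ x in -a..a, |deriv F x| ^ p * J x) = ν ^ p * ∫ x in -a..a, u x ^ p * J x := by
    rw [← intervalIntegral.integral_const_mul]
    congr 1; ext x
    rw [hdF, abs_mul, abs_of_pos hν, abs_of_pos (hu0 x), Real.mul_rpow hν.le (hu0 x).le, mul_assoc]
  set E := ∫ x in -a..a, |deriv F x| ^ p * J x with hEdef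
  have hbd : ∀ x ∈ Icc (-a) a, u x ≤ U → J x * u x ^ (p - 1) ∈ Icc 0 (B * U ^ (p - 1)) :=
    fun x hx hxU => ⟨mul_nonneg (hJ0 x hx).le (Real.rpow_nonneg (hu0 x).le _),
      mul_le_mul (hJB x hx) (Real.rpow_le_rpow (hu0 x).le hxU (by linarith))
        (Real.rpow_nonneg (hu0 x).le _) hB.le⟩
  have gl := hbd (-a) hla hUl
  have gr := hbd a hra hUr
  -- Integration of `(F J u ^ (p - 1))'`.
  have hftc := intervalIntegral.integral_eq_sub_of_hasDerivAt (a := -a) (b := a)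
    (f := fun x => F x * (J x * u x ^ (p - 1)))
    (f' := fun x => ν * (u x ^ p * J x) - ν * (|F x| ^ p * J x))
    (fun x hx => by
      rw [uIcc_of_le haa] at hx
      refine ((hFd x).mul (hg x hx)).congr_deriv ?_
      rw [← hup, ← abs_rpow_mul_self_mul_self hp (F x)]
      ring) ((iu.const_mul ν).sub (iN.const_mul ν))
  rw [intervalIntegral.integral_sub (iu.const_mul ν) (iN.const_mul ν),
    intervalIntegral.integral_const_mul, intervalIntegral.integral_const_mul, ← hN] at hftc
  have hUb : ∀ x ∈ Icc (-a) a, u x ≤ U → u x * (J x * u x ^ (p - 1)) ≤ B * U ^ p :=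
    fun x hx hxU => by
      rw [← hUp, show B * (U ^ (p - 1) * U) = U * (B * U ^ (p - 1)) by ring]
      exact mul_le_mul hxU (hbd x hx hxU).2 (hbd x hx hxU).1 hU.le
  refine ⟨?_, ?_⟩
  · have h1 : F a * (J a * u a ^ (p - 1)) - F (-a) * (J (-a) * u (-a) ^ (p - 1)) ≤
        S * (2 * B * U ^ p) := by
      rw [hl, hr]
      have := mul_le_mul_of_nonneg_left (hUb a hra hUr) hS.le
      have := mul_le_mul_of_nonneg_left (hUb (-a) hla hUl) hS.le
      linarith
    rw [← hftc] at h1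
    have h2 := mul_le_mul_of_nonneg_left h1 (Real.rpow_nonneg hν.le (p - 1))
    rw [hE, ← hνp]
    linarith
  · -- The `p`-mean of `F` is controlled by the boundary values of `J u ^ (p - 1)`.
    have hMf := intervalIntegral.integral_eq_sub_of_hasDerivAt (a := -a) (b := a)
      (fun x hx => hg x (by rwa [uIcc_of_le haa] at hx)) (iM.const_mul (-ν))
    rw [intervalIntegral.integral_const_mul] at hMf
    set M := ∫ x in -a..a, |F x| ^ (p - 2) * F x * J x with hM
    have hMle : |M| ≤ B * U ^ (p - 1) / ν := by
      have e : |M| * ν = |M * ν| := by rw [abs_mul, abs_of_pos hν]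
      rw [le_div_iff₀ hν, e, abs_le]
      constructor <;> linarith [gl.1, gl.2, gr.1, gr.2]
    have hmono : Monotone F := monotone_of_deriv_nonneg (hF.differentiable one_ne_zero) fun x => by
      rw [hdF]; exact mul_nonneg hν.le (hu0 x).le
    obtain ⟨c, hc, hMc⟩ := exists_pMean hp ha hJ hJ0 hF.continuous (B := S * U) fun x hx => by
      have h1 := hmono hx.1
      have h2 := hmono hx.2
      have h3 := mul_le_mul_of_nonneg_left hUl hS.le
      have h4 := mul_le_mul_of_nonneg_left hUr hS.le
      rw [abs_le]
      constructor <;> linarith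
    have hP := h (fun x => F x - c) (hF.sub contDiff_const) hMc
    simp only [deriv_sub_const] at hP
    have hcon := integral_abs_rpow_sub_le hp ha hJ hJ0 hF.continuous.continuousOn c
    rw [← hN, ← hM] at hcon
    have hcM : c * M ≤ S * U * (B * U ^ (p - 1) / ν) :=
      (le_abs_self _).trans ((abs_mul c M).le.trans (mul_le_mul hc hMle (abs_nonneg _)
        (mul_nonneg hS.le hU.le)))
    have h5 : p * c * M ≤ p * (S * U * (B * U ^ (p - 1) / ν)) := by
      rw [mul_assoc]; exact mul_le_mul_of_nonneg_left hcM (by linarith)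
    have h6 := mul_le_mul_of_nonneg_left (hcon.trans' (sub_le_sub_left h5 N)) hμ
    have h7 : μ * (p * (S * U * (B * U ^ (p - 1) / ν))) = μ * p / ν * (S * (B * U ^ p)) := by
      rw [← hUp]; ring
    linarith

/-- A Poincaré constant is at most the eigenvalue parameters `ν ^ p` of the approximating boundary
value problems, up to an error that vanishes as `S → ∞`. -/
theorem PoincareBound.le_eigenvalue_add {p a μ ν₀ δ : ℝ} (hp : 1 < p) (ha : 0 < a) (hν₀ : 0 < ν₀)
    (hδ : 0 < δ) {ψ J : ℝ → ℝ} (hψ : ContinuousOn ψ (Icc (-a) a))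
    (hJ : ∀ x ∈ Icc (-a) a, HasDerivAt J (ψ x * J x) x) (hJ0 : ∀ x ∈ Icc (-a) a, 0 < J x)
    (h : PoincareBound p a μ J) :
    ∀ᶠ S in Filter.atTop, ∀ ν ≥ ν₀, ∀ σ : ℝ → ℝ, σ (-a) = -S → σ a = S →
      (∀ x ∈ Icc (-a) a, HasDerivAt σ (sigmaField p ν (ψ x) (σ x)) x) → μ ≤ ν ^ p + δ := by
  have hp1 : 0 < p - 1 := by linarith
  have haa : -a ≤ a := by linarith
  have hla : -a ∈ Icc (-a) a := ⟨le_rfl, haa⟩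
  have hra : a ∈ Icc (-a) a := ⟨haa, le_rfl⟩
  have hJc : ContinuousOn J (Icc (-a) a) := fun x hx => (hJ x hx).continuousAt.continuousWithinAt
  rcases le_or_gt μ 0 with hμ | hμ
  · exact Filter.Eventually.of_forall fun S ν hν σ _ _ _ =>
      hμ.trans (add_nonneg (Real.rpow_nonneg (hν₀.le.trans hν) p) hδ.le)
  obtain ⟨x₀, hx₀, hmin⟩ := isCompact_Icc.exists_isMinOn ⟨a, hra⟩ hJc
  obtain ⟨x₁, hx₁, hmax⟩ := isCompact_Icc.exists_isMaxOn ⟨a, hra⟩ hJc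
  set j := J x₀ with hj
  set B := J x₁ with hB
  have hj0 : 0 < j := hJ0 x₀ hx₀
  have hB0 : 0 < B := hJ0 x₁ hx₁
  set T := (1 / (2 * a) + p) / j with hT
  have hT0 : 0 < T := by positivity
  set C₁ := 2 * B * (μ / ν₀) with hC₁
  set C₂ := μ * p / ν₀ * B with hC₂
  have hC₁0 : 0 < C₁ := by positivity
  have hC₂0 : 0 < C₂ := by positivity
  have hκ : Filter.Tendsto (fun S : ℝ => S ^ (1 - p)) Filter.atTop (nhds 0) := by
    have := tendsto_rpow_neg_atTop hp1
    simpa using this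
  have hκ₁ := hκ.eventually_lt_const (show 0 < 1 / (2 * (T * C₁)) by positivity)
  have hκ₂ := hκ.eventually_lt_const (show 0 < δ / ((C₁ + C₂) * (2 * T * (1 + μ))) by positivity)
  filter_upwards [hκ₁, hκ₂, Filter.eventually_gt_atTop 0] with S hS₁ hS₂ hS ν hν σ hl hr hσ
  by_contra! hlt
  have hν0 : 0 < ν := hν₀.trans_le hν
  obtain ⟨F, u, hF, hdF, hu0, hu, hFσ, hg⟩ := exists_eigenfunction_of_sigma hp ha hψ hσ hJ
  set U := max (u (-a)) (u a) with hU
  have hU0 : 0 < U := (hu0 a).trans_le (le_max_right _ _)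
  have hFl : F (-a) = -S * u (-a) := by rw [hFσ _ hla, hl]
  have hFr : F a = S * u a := by rw [hFσ _ hra, hr]
  obtain ⟨h1, h2⟩ := h.energy_estimate (B := B) (U := U) (S := S) hp hν0 ha hS hμ.le hJc hJ0
    (fun x hx => hmax hx) hF hdF hu0 hu hg hFl hFr (le_max_left _ _) (le_max_right _ _)
  have hN0 := integral_abs_rpow_mul_nonneg (p := p) ha hJ0 F
  have tl := mul_abs_rpow_left_le hp ha hj0.le hJc (fun x hx => hmin hx) hF
  have tr := mul_abs_rpow_right_le hp ha hj0.le hJc (fun x hx => hmin hx) hF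
  set N := ∫ x in -a..a, |F x| ^ p * J x
  set E := ∫ x in -a..a, |deriv F x| ^ p * J x
  set Z := (S * U) ^ p with hZ
  have hZ0 : 0 < Z := Real.rpow_pos_of_pos (mul_pos hS hU0) p
  set κ := S ^ (1 - p) with hκdef
  have hκ0 : 0 < κ := Real.rpow_pos_of_pos hS _
  have hSU : S * U ^ p = κ * Z := by
    rw [hZ, hκdef, Real.mul_rpow hS.le hU0.le, ← mul_assoc, ← Real.rpow_add hS]
    simp
  -- `Z` is the larger boundary value of `|F| ^ p`, hence controlled by the Sobolev norm.
  have htr : Z ≤ T * (N + E) := by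
    rw [hT, div_mul_eq_mul_div, le_div_iff₀ hj0, mul_comm]
    rw [hFl, neg_mul, abs_neg, abs_of_pos (mul_pos hS (hu0 _))] at tl
    rw [hFr, abs_of_pos (mul_pos hS (hu0 _))] at tr
    rcases max_choice (u (-a)) (u a) with hm | hm
    · rw [hZ, hU, hm]; exact tl
    · rw [hZ, hU, hm]; exact tr
  have hνp : ν ^ p < μ := by linarith
  have hνp1 : ν ^ (p - 1) ≤ μ / ν₀ := by
    rw [Real.rpow_sub_one hν0.ne']
    exact div_le_div₀ hμ.le hνp.le hν₀ hν
  have h3 : ν ^ (p - 1) * (S * (2 * B * U ^ p)) ≤ C₁ * (κ * Z) := by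
    calc _ = 2 * B * ν ^ (p - 1) * (S * U ^ p) := by ring
      _ ≤ 2 * B * (μ / ν₀) * (S * U ^ p) := by gcongr
      _ = _ := by rw [hSU]
  have h4 : μ * p / ν * (S * (B * U ^ p)) ≤ C₂ * (κ * Z) := by
    calc _ = μ * p / ν * B * (S * U ^ p) := by ring
      _ ≤ μ * p / ν₀ * B * (S * U ^ p) := by gcongr
      _ = _ := by rw [hSU]
  have h5 : ν ^ p * N ≤ μ * N := mul_le_mul_of_nonneg_right hνp.le hN0
  have h6 : T * (C₁ * (κ * Z)) ≤ Z / 2 := by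
    rw [lt_div_iff₀ (by positivity)] at hS₁
    have := mul_le_mul_of_nonneg_right hS₁.le hZ0.le
    linarith
  have h7 : Z ≤ 2 * T * (1 + μ) * N := by
    have h8 : T * (N + E) ≤ T * (N + (μ * N + C₁ * (κ * Z))) := by gcongr; linarith
    linarith
  have hNpos : 0 < N := by
    by_contra! hN
    have : 2 * T * (1 + μ) * N ≤ 0 := mul_nonpos_of_nonneg_of_nonpos (by positivity) hN
    linarith
  have h9 : (C₁ + C₂) * (κ * Z) ≤ δ * N := by
    rw [lt_div_iff₀ (by positivity)] at hS₂
    calc (C₁ + C₂) * (κ * Z) ≤ (C₁ + C₂) * (κ * (2 * T * (1 + μ) * N)) := by gcongr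
      _ = κ * ((C₁ + C₂) * (2 * T * (1 + μ))) * N := by ring
      _ ≤ δ * N := by gcongr
  have h10 := mul_lt_mul_of_pos_right hlt hNpos
  linarith

/-- Comparison of Poincaré constants for two weights whose logarithmic derivatives solve the same
Riccati equation and are ordered and nonnegative at the centre of the interval. -/
theorem PoincareBound.of_riccati_le {p a μ K c : ℝ} (hp : 1 < p) (ha : 0 < a) (hc : 0 ≤ c)
    {ψ₁ ψ₂ J₁ J₂ : ℝ → ℝ} (hψ₁ : ∀ x ∈ Icc (-a) a, HasDerivAt ψ₁ (-K - c * ψ₁ x ^ 2) x)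
    (hψ₂ : ∀ x ∈ Icc (-a) a, HasDerivAt ψ₂ (-K - c * ψ₂ x ^ 2) x)
    (h₁ : 0 ≤ ψ₁ 0) (h₁₂ : ψ₁ 0 ≤ ψ₂ 0)
    (hJ₁ : ∀ x ∈ Icc (-a) a, HasDerivAt J₁ (ψ₁ x * J₁ x) x) (hJ₁0 : ∀ x ∈ Icc (-a) a, 0 < J₁ x)
    (hJ₂ : ∀ x ∈ Icc (-a) a, HasDerivAt J₂ (ψ₂ x * J₂ x) x) (hJ₂0 : ∀ x ∈ Icc (-a) a, 0 < J₂ x)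
    (h : PoincareBound p a μ J₁) : PoincareBound p a μ J₂ := by
  have hψ₁c : ContinuousOn ψ₁ (Icc (-a) a) := fun x hx =>
    (hψ₁ x hx).continuousAt.continuousWithinAt
  obtain ⟨ν₀, hν₀, hev⟩ := exists_sigma_solution hp ha hψ₁c
  intro F hF hM
  have hN0 := integral_abs_rpow_mul_nonneg (p := p) ha hJ₂0 F
  set N := ∫ x in -a..a, |F x| ^ p * J₂ x
  refine le_of_forall_pos_le_add fun η hη => ?_
  obtain ⟨S, hS, ⟨ν, hν, σ, hl, hr, hσ, hpl, hpr⟩, hle⟩ :=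
    ((Filter.eventually_gt_atTop 0).and (hev.and (h.le_eigenvalue_add (δ := η / (N + 1)) hp ha hν₀
      (by positivity) hψ₁c hJ₁ hJ₁0))).exists
  have hν0 : 0 < ν := lt_of_lt_of_le hν₀ hν
  have hσc : ContinuousOn σ (Icc (-a) a) := fun x hx => (hσ x hx).continuousAt.continuousWithinAt
  obtain ⟨ε, X, hε, hXc, hXm, hXσ, hXd, hXε, hX₀, hX₁⟩ := exists_inverse_trajectory ha hσ
    (continuousOn_sigmaField hp hψ₁c hσc)
    (fun x hx => sigmaField_pos hp hν0 hψ₁ hσ (by rw [hl]; linarith) (by rw [hr]; exact hS.le)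
      (by rwa [hl]) (by rwa [hr]) hx) hl hr
  have hB := PoincareBound.of_trajectory hp hν0 hc ha hS hε hψ₁ hψ₂ h₁ h₁₂ hXc hXm
    (fun s hs => by
      have := hXd s hs
      rwa [hXσ s ⟨hs.1.le, hs.2.le⟩] at this)
    (fun s hs => by
      have := hXε s hs
      rwa [hXσ s hs] at this) hX₀ hX₁ hJ₂ hJ₂0 F hF hM
  have hμ := mul_le_mul_of_nonneg_right (hle ν hν σ hl hr hσ) hN0
  have h1 : η / (N + 1) * N ≤ η := by
    rw [div_mul_eq_mul_div, div_le_iff₀ (by linarith)]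
    nlinarith
  linarith

/-- The comparison `PoincareBound.of_riccati_le` up to reflection of the interval. -/
theorem PoincareBound.of_riccati_abs_le {p a μ K c : ℝ} (hp : 1 < p) (ha : 0 < a) (hc : 0 ≤ c)
    {ψ₁ ψ₂ J₁ J₂ : ℝ → ℝ} (hψ₁ : ∀ x ∈ Icc (-a) a, HasDerivAt ψ₁ (-K - c * ψ₁ x ^ 2) x)
    (hψ₂ : ∀ x ∈ Icc (-a) a, HasDerivAt ψ₂ (-K - c * ψ₂ x ^ 2) x) (h₁₂ : |ψ₁ 0| ≤ |ψ₂ 0|)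
    (hJ₁ : ∀ x ∈ Icc (-a) a, HasDerivAt J₁ (ψ₁ x * J₁ x) x) (hJ₁0 : ∀ x ∈ Icc (-a) a, 0 < J₁ x)
    (hJ₂ : ∀ x ∈ Icc (-a) a, HasDerivAt J₂ (ψ₂ x * J₂ x) x) (hJ₂0 : ∀ x ∈ Icc (-a) a, 0 < J₂ x)
    (h : PoincareBound p a μ J₁) : PoincareBound p a μ J₂ := by
  have hm : ∀ {x}, x ∈ Icc (-a) a → -x ∈ Icc (-a) a := fun hx =>
    ⟨by linarith [hx.2], by linarith [hx.1]⟩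
  have hψr : ∀ ψ : ℝ → ℝ, (∀ x ∈ Icc (-a) a, HasDerivAt ψ (-K - c * ψ x ^ 2) x) →
      ∀ x ∈ Icc (-a) a, HasDerivAt (fun x => -ψ (-x)) (-K - c * (-ψ (-x)) ^ 2) x :=
    fun ψ hψ x hx =>
      ((hψ (-x) (hm hx)).scomp x (hasDerivAt_neg x)).fun_neg.congr_deriv (by simp; ring)
  have hJr : ∀ ψ J : ℝ → ℝ, (∀ x ∈ Icc (-a) a, HasDerivAt J (ψ x * J x) x) →
      ∀ x ∈ Icc (-a) a, HasDerivAt (fun x => J (-x)) (-ψ (-x) * J (-x)) x :=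
    fun ψ J hJ x hx => ((hJ (-x) (hm hx)).scomp x (hasDerivAt_neg x)).congr_deriv (by simp)
  have key : ∀ ψ J : ℝ → ℝ, (∀ x ∈ Icc (-a) a, HasDerivAt ψ (-K - c * ψ x ^ 2) x) →
      (∀ x ∈ Icc (-a) a, HasDerivAt J (ψ x * J x) x) → (∀ x ∈ Icc (-a) a, 0 < J x) → 0 ≤ ψ 0 →
      ψ 0 ≤ |ψ₂ 0| → PoincareBound p a μ J → PoincareBound p a μ J₂ := by
    intro ψ J hψ hJ hJ0 h0 hle hJμ
    rcases abs_cases (ψ₂ 0) with ⟨e, -⟩ | ⟨e, -⟩ <;> rw [e] at hle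
    · exact hJμ.of_riccati_le hp ha hc hψ hψ₂ h0 hle hJ hJ0 hJ₂ hJ₂0
    · have := (hJμ.of_riccati_le hp ha hc hψ (hψr ψ₂ hψ₂) h0 (by simpa using hle) hJ hJ0
        (hJr ψ₂ J₂ hJ₂) fun x hx => hJ₂0 _ (hm hx)).comp_neg
      simpa using this
  rcases abs_cases (ψ₁ 0) with ⟨e, h0⟩ | ⟨e, h0⟩ <;> rw [e] at h₁₂
  · exact key ψ₁ J₁ hψ₁ hJ₁ hJ₁0 h0 h₁₂ h
  · exact key _ _ (hψr ψ₁ hψ₁) (hJr ψ₁ J₁ hJ₁) (fun x hx => hJ₁0 _ (hm hx))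
      (by simpa using h0.le) (by simpa using h₁₂) h.comp_neg

/-! ### The model densities -/

theorem hasDerivAt_modelSin (δ x : ℝ) : HasDerivAt (modelSin δ) (modelCos δ x) x := by
  rcases lt_trichotomy 0 δ with h | rfl | h
  · have hs : √δ ≠ 0 := (Real.sqrt_pos.2 h).ne'
    have e : modelSin δ = fun x => Real.sin (√δ * x) / √δ := by
      ext y; simp [modelSin, h]
    rw [e]
    refine ((((hasDerivAt_id x).const_mul (√δ)).sin).div_const (√δ)).congr_deriv ?_
    simp [modelCos, h]
    field_simp
  · have e : modelSin 0 = fun x => x := by ext y; simp [modelSin]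
    rw [e]
    simpa [modelCos] using hasDerivAt_id' x
  · have hs : √(-δ) ≠ 0 := (Real.sqrt_pos.2 (neg_pos.2 h)).ne'
    have e : modelSin δ = fun x => Real.sinh (√(-δ) * x) / √(-δ) := by
      ext y; simp [modelSin, h.le.not_gt, h.ne]
    rw [e]
    refine ((((hasDerivAt_id x).const_mul (√(-δ))).sinh).div_const (√(-δ))).congr_deriv ?_
    simp [modelCos, h.le.not_gt, h.ne]
    field_simp

theorem hasDerivAt_modelCos (δ x : ℝ) : HasDerivAt (modelCos δ) (-δ * modelSin δ x) x := by
  rcases lt_trichotomy 0 δ with h | rfl | h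
  · have hs : √δ ≠ 0 := (Real.sqrt_pos.2 h).ne'
    have e : modelCos δ = fun x => Real.cos (√δ * x) := by
      ext y; simp [modelCos, h]
    rw [e]
    refine (((hasDerivAt_id x).const_mul (√δ)).cos).congr_deriv ?_
    simp only [modelSin, h, if_true, id, mul_one]
    field_simp
    rw [Real.sq_sqrt h.le]
    ring
  · have e : modelCos 0 = fun _ => 1 := by ext y; simp [modelCos]
    rw [e]
    simpa using hasDerivAt_const x (1 : ℝ)
  · have hs : √(-δ) ≠ 0 := (Real.sqrt_pos.2 (neg_pos.2 h)).ne'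
    have e : modelCos δ = fun x => Real.cosh (√(-δ) * x) := by
      ext y; simp [modelCos, h.le.not_gt, h.ne]
    rw [e]
    refine (((hasDerivAt_id x).const_mul (√(-δ))).cosh).congr_deriv ?_
    simp only [modelSin, h.le.not_gt, h.ne, if_false, id, mul_one]
    field_simp
    rw [Real.sq_sqrt (neg_pos.2 h).le]
    ring

theorem modelSin_zero (δ : ℝ) : modelSin δ 0 = 0 := by simp [modelSin]

theorem modelCos_zero (δ : ℝ) : modelCos δ 0 = 1 := by simp [modelCos]

theorem modelSin_neg (δ x : ℝ) : modelSin δ (-x) = -modelSin δ x := by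
  simp only [modelSin, mul_neg, Real.sin_neg, Real.sinh_neg]
  split_ifs <;> ring

theorem modelCos_neg (δ x : ℝ) : modelCos δ (-x) = modelCos δ x := by
  simp [modelCos]

/-- The base of the model density for `N = n < ∞`. -/
noncomputable def modelBase (K n h x : ℝ) : ℝ :=
  modelCos (modelDelta K n) x + h / (n - 1) * modelSin (modelDelta K n) x

/-- The derivative of `modelBase`. -/
noncomputable def modelBaseDeriv (K n h x : ℝ) : ℝ :=
  -modelDelta K n * modelSin (modelDelta K n) x + h / (n - 1) * modelCos (modelDelta K n) x

theorem hasDerivAt_modelBase (K n h x : ℝ) :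
    HasDerivAt (modelBase K n h) (modelBaseDeriv K n h x) x :=
  (hasDerivAt_modelCos _ x).add ((hasDerivAt_modelSin _ x).const_mul _)

theorem hasDerivAt_modelBaseDeriv (K n h x : ℝ) :
    HasDerivAt (modelBaseDeriv K n h) (-modelDelta K n * modelBase K n h x) x :=
  (((hasDerivAt_modelSin _ x).const_mul _).add ((hasDerivAt_modelCos _ x).const_mul _)).congr_deriv
    (by simp only [modelBase]; ring)

theorem continuous_modelBase (K n h : ℝ) : Continuous (modelBase K n h) :=
  continuous_iff_continuousAt.2 fun x => (hasDerivAt_modelBase K n h x).continuousAt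

theorem modelBase_apply_zero (K n h : ℝ) : modelBase K n h 0 = 1 := by
  simp [modelBase, modelCos_zero, modelSin_zero]

theorem modelDensity_coe {n : ℝ} (hn : n ≠ 1) (K h x : ℝ) :
    modelDensity K (n : WithTop ℝ) h x =
      ENNReal.ofReal (cutAtZeros (modelBase K n h) x) ^ (n - 1) := by
  simp only [modelDensity, if_neg hn]
  rfl

theorem modelDensity_top (K h x : ℝ) :
    modelDensity K ⊤ h x = ENNReal.ofReal (Real.exp (h * x - K / 2 * x ^ 2)) := rfl

theorem cutAtZeros_of_pos {w : ℝ → ℝ} {b x : ℝ} (hw : ∀ y ∈ Ioo (-b) b, 0 < w y)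
    (hx : x ∈ Ioo (-b) b) : cutAtZeros w x = w x := by
  suffices hmem : zeroLeft w ≤ (x : EReal) ∧ (x : EReal) ≤ zeroRight w from
    indicator_of_mem (s := {x : ℝ | zeroLeft w ≤ (x : EReal) ∧ (x : EReal) ≤ zeroRight w}) hmem w
  refine ⟨sSup_le ?_, le_sInf ?_⟩
  · rintro _ ⟨y, ⟨hy, hwy⟩, rfl⟩
    by_contra! hlt
    have hxy : x < y := by exact_mod_cast hlt
    exact (hw y ⟨hx.1.trans hxy, hy.trans_lt (by linarith [hx.1, hx.2])⟩).ne' hwy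
  · rintro _ ⟨y, ⟨hy, hwy⟩, rfl⟩
    by_contra! hlt
    have hxy : y < x := by exact_mod_cast hlt
    exact (hw y ⟨by linarith [hx.1, hx.2], hxy.trans hx.2⟩).ne' hwy

theorem cutAtZeros_of_gt {w : ℝ → ℝ} {z x : ℝ} (hz : 0 < z) (hwz : w z = 0) (hx : z < x) :
    cutAtZeros w x = 0 := by
  refine indicator_of_notMem (fun hmem => ?_) w
  have h1 : zeroRight w ≤ (z : EReal) := sInf_le ⟨z, ⟨hz, hwz⟩, rfl⟩
  have h2 : (x : EReal) ≤ z := hmem.2.trans h1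
  exact absurd hx (not_lt.2 (by exact_mod_cast h2))

theorem cutAtZeros_of_lt {w : ℝ → ℝ} {z x : ℝ} (hz : z ≤ 0) (hwz : w z = 0) (hx : x < z) :
    cutAtZeros w x = 0 := by
  refine indicator_of_notMem (fun hmem => ?_) w
  have h1 : (z : EReal) ≤ zeroLeft w := le_sSup ⟨z, ⟨hz, hwz⟩, rfl⟩
  have h2 : (z : EReal) ≤ x := h1.trans hmem.1
  exact absurd hx (not_lt.2 (by exact_mod_cast h2))

theorem mem_support_withDensity {f : ℝ → ℝ≥0∞} {x : ℝ} (hf : ContinuousAt f x) (h0 : 0 < f x) :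
    x ∈ (volume.withDensity f).support := by
  rw [Measure.mem_support_iff_forall]
  intro U hU
  obtain ⟨c, hc0, hc⟩ := exists_between h0
  obtain ⟨V, hVsub, hVo, hxV⟩ := mem_nhds_iff.1 (Filter.inter_mem hU (hf (lt_mem_nhds hc)))
  calc 0 < c * volume V := ENNReal.mul_pos hc0.ne' (hVo.measure_pos _ ⟨x, hxV⟩).ne'
    _ = ∫⁻ _ in V, c := by rw [setLIntegral_const]
    _ ≤ ∫⁻ y in V, f y := setLIntegral_mono' hVo.measurableSet fun y hy => (hVsub hy).2.le
    _ = volume.withDensity f V := (withDensity_apply _ hVo.measurableSet).symm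
    _ ≤ volume.withDensity f U := measure_mono fun y hy => (hVsub hy).1

theorem mem_densitySupport {f : ℝ → ℝ≥0∞} {x : ℝ} (hf : ContinuousAt f x) (h0 : f x ≠ 0)
    (h1 : f x ≠ ⊤) : x ∈ densitySupport f :=
  ⟨mem_support_withDensity hf (pos_iff_ne_zero.2 h0),
    mem_support_withDensity hf.inv (ENNReal.inv_pos.2 h1)⟩

/-- On an open set where the density is constantly `0` or constantly `∞` there is no support. -/
theorem disjoint_densitySupport {f : ℝ → ℝ≥0∞} {U : Set ℝ} (hU : IsOpen U)
    (h : (∀ x ∈ U, f x = 0) ∨ ∀ x ∈ U, f x = ⊤) : Disjoint U (densitySupport f) := by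
  rw [disjoint_left]
  intro x hx hmem
  rcases h with h | h
  · refine Measure.subset_compl_support_of_isOpen (μ := volume.withDensity f) hU ?_ hx hmem.1
    rw [withDensity_apply _ hU.measurableSet, setLIntegral_congr_fun hU.measurableSet h]
    simp
  · refine Measure.subset_compl_support_of_isOpen
      (μ := volume.withDensity fun x => (f x)⁻¹) hU ?_ hx hmem.2
    rw [withDensity_apply _ hU.measurableSet, setLIntegral_congr_fun hU.measurableSet
      (g := fun _ => 0) fun x hx => by simp [h x hx]]
    simp

/-- On the regular parameter domain the base of the density has no zeros. -/
theorem modelBase_pos_of_mem_regDomain {K n h d : ℝ} {D : WithTop ℝ} (hn : n ≠ 1)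
    (hq : (h, d) ∈ regDomain K n D) : ∀ x ∈ Icc (-(d / 2)) (d / 2), 0 < modelBase K n h x := by
  obtain ⟨hd, -, hsub⟩ := hq
  simp only at hd hsub
  intro x hx
  by_contra! hle
  obtain ⟨z, hz, hwz⟩ : ∃ z ∈ Icc (-(d / 2)) (d / 2), modelBase K n h z = 0 := by
    have := isPreconnected_Icc.intermediate_value₂ (a := x) (b := 0) hx
      ⟨by linarith, by linarith⟩ (continuous_modelBase K n h).continuousOn
      (continuousOn_const (c := (0 : ℝ))) hle (by rw [modelBase_apply_zero]; norm_num)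
    exact this
  have hd0 : ∀ y, cutAtZeros (modelBase K n h) y = 0 →
      (n > 1 → modelDensity K n h y = 0) ∧ (n < 1 → modelDensity K n h y = ⊤) := fun y hy => by
    rw [modelDensity_coe hn, hy, ENNReal.ofReal_zero]
    exact ⟨fun h => ENNReal.zero_rpow_of_pos (by linarith),
      fun h => ENNReal.zero_rpow_of_neg (by linarith)⟩
  have hdisj : ∀ U : Set ℝ, IsOpen U → (∀ y ∈ U, cutAtZeros (modelBase K n h) y = 0) →
      Disjoint U (densitySupport (modelDensity K n h)) := fun U hU h0 => by
    refine disjoint_densitySupport hU ?_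
    rcases lt_or_gt_of_ne hn with hlt | hgt
    · exact Or.inr fun y hy => (hd0 y (h0 y hy)).2 hlt
    · exact Or.inl fun y hy => (hd0 y (h0 y hy)).1 hgt
  -- `z` cannot be interior to the support, since the density is trivial beyond `z`.
  obtain ⟨ε, hε, hball⟩ := Metric.isOpen_iff.1 isOpen_interior z (hsub hz)
  rcases lt_or_ge 0 z with hz0 | hz0
  · have := hdisj (Ioi z) isOpen_Ioi fun y hy => cutAtZeros_of_gt hz0 hwz hy
    exact Set.disjoint_left.1 this (show z + ε / 2 ∈ Ioi z by simpa using hε)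
      (interior_subset (hball (by
        rw [Metric.mem_ball, Real.dist_eq, add_sub_cancel_left, abs_of_pos] <;> linarith)))
  · have := hdisj (Iio z) isOpen_Iio fun y hy => cutAtZeros_of_lt hz0 hwz hy
    exact Set.disjoint_left.1 this (show z - ε / 2 ∈ Iio z by simpa using hε)
      (interior_subset (hball (by
        rw [Metric.mem_ball, Real.dist_eq, sub_sub_cancel_left, abs_neg, abs_of_pos] <;> linarith)))

theorem exists_Ioo_forall_pos {w : ℝ → ℝ} (hw : Continuous w) {a : ℝ} (ha : 0 < a)
    (h : ∀ x ∈ Icc (-a) a, 0 < w x) : ∃ b > a, ∀ x ∈ Ioo (-b) b, 0 < w x := by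
  obtain ⟨δ, hδ, hsub⟩ := isCompact_Icc.exists_cthickening_subset_open
    (isOpen_lt continuous_const hw) (show Icc (-a) a ⊆ {x | 0 < w x} from h)
  refine ⟨a + δ, by linarith, fun x hx => hsub ?_⟩
  refine Metric.mem_cthickening_of_dist_le x (max (-a) (min a x)) δ _
    ⟨le_max_left _ _, max_le (by linarith) (min_le_left _ _)⟩ ?_
  rw [Real.dist_eq, abs_le]
  rcases le_total a x with h1 | h1
  · rw [min_eq_left h1, max_eq_right (by linarith)]
    constructor <;> linarith [hx.2]
  · rw [min_eq_right h1]
    rcases le_total (-a) x with h2 | h2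
    · rw [max_eq_right h2]; constructor <;> linarith
    · rw [max_eq_left h2]; constructor <;> linarith [hx.1]

theorem mem_regDomain_of_modelBase_pos {K n h d : ℝ} {D : WithTop ℝ} (hn : n ≠ 1) (hd : 0 < d)
    (hdD : (d : WithTop ℝ) ≤ D) (hw : ∀ x ∈ Icc (-(d / 2)) (d / 2), 0 < modelBase K n h x) :
    (h, d) ∈ regDomain K n D := by
  refine ⟨hd, hdD, ?_⟩
  obtain ⟨b, hb, hwb⟩ := exists_Ioo_forall_pos (continuous_modelBase K n h) (half_pos hd) hw
  refine Subset.trans (b := Ioo (-b) b) (fun x hx => ⟨by linarith [hx.1], by linarith [hx.2]⟩)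
    (interior_maximal (fun x hx => ?_) isOpen_Ioo)
  have heq : ∀ y ∈ Ioo (-b) b, modelDensity K n h y =
      ENNReal.ofReal (modelBase K n h y) ^ (n - 1) := fun y hy => by
    rw [modelDensity_coe hn, cutAtZeros_of_pos hwb hy]
  have h0 : ENNReal.ofReal (modelBase K n h x) ≠ 0 := (ENNReal.ofReal_pos.2 (hwb x hx)).ne'
  have hc : ContinuousAt (modelDensity K n h) x := by
    refine ContinuousAt.congr (f := fun y => ENNReal.ofReal (modelBase K n h y) ^ (n - 1)) ?_
      (Filter.eventually_of_mem (Ioo_mem_nhds hx.1 hx.2) fun y hy => (heq y hy).symm)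
    exact (ENNReal.continuous_rpow_const.comp
      (ENNReal.continuous_ofReal.comp (continuous_modelBase K n h))).continuousAt
  refine mem_densitySupport hc ?_ ?_ <;> rw [heq x hx]
  · exact (ENNReal.rpow_pos (pos_iff_ne_zero.2 h0) ENNReal.ofReal_ne_top).ne'
  · exact ENNReal.rpow_ne_top_of_ne_zero h0 ENNReal.ofReal_ne_top

theorem mem_regDomain_top {K h d : ℝ} {D : WithTop ℝ} (hd : 0 < d)
    (hdD : (d : WithTop ℝ) ≤ D) : (h, d) ∈ regDomain K ⊤ D := by
  refine ⟨hd, hdD, ?_⟩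
  have : densitySupport (modelDensity K ⊤ h) = univ := eq_univ_of_forall fun x => by
    refine mem_densitySupport (Continuous.continuousAt ?_) ?_ ?_
    · exact ENNReal.continuous_ofReal.comp (by fun_prop)
    · rw [modelDensity_top]; exact (ENNReal.ofReal_pos.2 (Real.exp_pos _)).ne'
    · rw [modelDensity_top]; exact ENNReal.ofReal_ne_top
  simp [this]

/-- Symmetrization: the centred density is regular on every interval on which some density with
the same parameters `K` and `N` is. -/
theorem zero_mem_regDomain {K h d : ℝ} {N D : WithTop ℝ} (hN : N ≠ 1)
    (hq : (h, d) ∈ regDomain K N D) : (0, d) ∈ regDomain K N D := by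
  induction N using WithTop.recTopCoe with
  | top => exact mem_regDomain_top hq.1 hq.2.1
  | coe n =>
    have hn : n ≠ 1 := fun h => hN (by rw [h]; rfl)
    refine mem_regDomain_of_modelBase_pos hn hq.1 hq.2.1 fun x hx => ?_
    have h1 := modelBase_pos_of_mem_regDomain hn hq x hx
    have h2 := modelBase_pos_of_mem_regDomain hn hq (-x) ⟨by linarith [hx.2], by linarith [hx.1]⟩
    simp only [modelBase, modelSin_neg, modelCos_neg, zero_div, zero_mul] at h1 h2 ⊢
    linarith

/-- The coefficient `1 / (N - 1)` of the Riccati equation for the logarithmic derivative of the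
model density; it is `0` for `N = ∞`. -/
noncomputable def riccatiCoeff : WithTop ℝ → ℝ
  | ⊤ => 0
  | (n : ℝ) => 1 / (n - 1)

theorem riccatiCoeff_nonneg {N : WithTop ℝ} (hN : 1 < N) : 0 ≤ riccatiCoeff N := by
  induction N using WithTop.recTopCoe with
  | top => exact le_rfl
  | coe n =>
    have : 1 < n := by exact_mod_cast hN
    exact one_div_nonneg.2 (by linarith)

/-- On the regular parameter domain the model density is a smooth positive function, whose
logarithmic derivative `ψ` solves a Riccati equation with initial value `h`. -/
theorem exists_modelDensity_eq {K h d : ℝ} {N D : WithTop ℝ} (hN : N ≠ 1)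
    (hq : (h, d) ∈ regDomain K N D) :
    ∃ J ψ : ℝ → ℝ, (∀ x ∈ Icc (-(d / 2)) (d / 2), 0 < J x) ∧
      (∀ x ∈ Icc (-(d / 2)) (d / 2), modelDensity K N h x = ENNReal.ofReal (J x)) ∧
      (∀ x ∈ Icc (-(d / 2)) (d / 2), HasDerivAt J (ψ x * J x) x) ∧
      (∀ x ∈ Icc (-(d / 2)) (d / 2), HasDerivAt ψ (-K - riccatiCoeff N * ψ x ^ 2) x) ∧
      ψ 0 = h := by
  induction N using WithTop.recTopCoe with
  | top =>
    refine ⟨fun x => Real.exp (h * x - K / 2 * x ^ 2), fun x => h - K * x,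
      fun x _ => Real.exp_pos _, fun x _ => modelDensity_top K h x, fun x _ => ?_, fun x _ => ?_,
      by simp⟩
    · refine ((((hasDerivAt_id x).const_mul h).sub
        (((hasDerivAt_id x).pow 2).const_mul (K / 2))).exp).congr_deriv ?_
      simp
      ring
    · exact (((hasDerivAt_id x).const_mul K).const_sub h).congr_deriv (by simp [riccatiCoeff])
  | coe n =>
    have hn : n ≠ 1 := fun h => hN (by rw [h]; rfl)
    have hn1 : n - 1 ≠ 0 := sub_ne_zero.2 hn
    have hw := modelBase_pos_of_mem_regDomain hn hq
    obtain ⟨b, hb, hwb⟩ := exists_Ioo_forall_pos (continuous_modelBase K n h) (half_pos hq.1) hw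
    refine ⟨fun x => modelBase K n h x ^ (n - 1),
      fun x => (n - 1) * (modelBaseDeriv K n h x / modelBase K n h x),
      fun x hx => Real.rpow_pos_of_pos (hw x hx) _, fun x hx => ?_, fun x hx => ?_,
      fun x hx => ?_, ?_⟩
    · rw [modelDensity_coe hn, cutAtZeros_of_pos hwb
        ⟨by linarith [hx.1, hb], by linarith [hx.2, hb]⟩, ENNReal.ofReal_rpow_of_pos (hw x hx)]
    · refine ((hasDerivAt_modelBase K n h x).rpow_const (Or.inl (hw x hx).ne')).congr_deriv ?_
      rw [Real.rpow_sub_one (hw x hx).ne' (n - 1)]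
      ring
    · have hw0 := (hw x hx).ne'
      refine (((hasDerivAt_modelBaseDeriv K n h x).div (hasDerivAt_modelBase K n h x)
        hw0).const_mul (n - 1)).congr_deriv ?_
      have hK : -K = -((n - 1) * modelDelta K n) := by
        rw [modelDelta, if_neg hn]; field_simp
      have hc : riccatiCoeff (n : WithTop ℝ) = 1 / (n - 1) := rfl
      rw [hc, hK]
      field_simp
    · simp only [modelBase_apply_zero, modelBaseDeriv, modelSin_zero, modelCos_zero]
      field_simp
      simp

/-- A lower bound for the Poincaré constant of one model measure transfers to another one as soon
as the corresponding Poincaré inequality does. -/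
theorem modelLambda_le_modelLambda {p K h₁ h₂ d₁ d₂ : ℝ} {N : WithTop ℝ} (hp : 1 < p)
    {J₁ J₂ : ℝ → ℝ} (hd₁ : 0 < d₁) (hd₂ : 0 < d₂)
    (hJ₁ : ContinuousOn J₁ (Icc (-(d₁ / 2)) (d₁ / 2)))
    (hJ₁0 : ∀ x ∈ Icc (-(d₁ / 2)) (d₁ / 2), 0 < J₁ x)
    (hj₁ : ∀ x ∈ Icc (-(d₁ / 2)) (d₁ / 2), modelDensity K N h₁ x = ENNReal.ofReal (J₁ x))
    (hJ₂ : ContinuousOn J₂ (Icc (-(d₂ / 2)) (d₂ / 2)))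
    (hJ₂0 : ∀ x ∈ Icc (-(d₂ / 2)) (d₂ / 2), 0 < J₂ x)
    (hj₂ : ∀ x ∈ Icc (-(d₂ / 2)) (d₂ / 2), modelDensity K N h₂ x = ENNReal.ofReal (J₂ x))
    (h : ∀ μ, 0 ≤ μ → PoincareBound p (d₁ / 2) μ J₁ → PoincareBound p (d₂ / 2) μ J₂) :
    modelLambda p K N h₁ d₁ ≤ modelLambda p K N h₂ d₂ := by
  have hfin : modelLambda p K N h₁ d₁ < ⊤ :=
    pPoincareConst_lt_top hp (half_pos hd₁) hJ₁ hJ₁0 hj₁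
  rw [← ENNReal.ofReal_toReal hfin.ne]
  refine (ofReal_le_pPoincareConst_iff hp (half_pos hd₂) ENNReal.toReal_nonneg hJ₂ hJ₂0 hj₂).2
    (h _ ENNReal.toReal_nonneg ?_)
  refine (ofReal_le_pPoincareConst_iff hp (half_pos hd₁) ENNReal.toReal_nonneg hJ₁ hJ₁0 hj₁).1 ?_
  rw [ENNReal.ofReal_toReal hfin.ne]
  rfl

theorem mainTheorem8 (p : ℝ) (hp : 1 < p) (K : ℝ) (N : WithTop ℝ) (hN : N ≤ 0 ∨ 1 < N)
    (D : WithTop ℝ) (hD : 0 < D) :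
    (∀ q ∈ regDomain K N D, modelLambda p K N q.1 q.2 < ⊤) ∧
    (∀ h₀ ∈ Prod.fst '' regDomain K N D,
      AntitoneOn (fun d => modelLambda p K N h₀ d) {d | (h₀, d) ∈ regDomain K N D}) ∧
    (1 < N → ∀ d₀ ∈ Prod.snd '' regDomain K N D,
      (∀ h₁ ∈ {h | (h, d₀) ∈ regDomain K N D}, ∀ h₂ ∈ {h | (h, d₀) ∈ regDomain K N D},
        |h₁| ≤ |h₂| → modelLambda p K N h₁ d₀ ≤ modelLambda p K N h₂ d₀) ∧
      (0, d₀) ∈ regDomain K N D ∧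
      ∀ h ∈ {h | (h, d₀) ∈ regDomain K N D},
        modelLambda p K N 0 d₀ ≤ modelLambda p K N h d₀) := by
  have hN1 : N ≠ 1 := by
    rintro rfl
    rcases hN with h | h
    · exact absurd h (not_le.2 (by exact_mod_cast zero_lt_one (α := ℝ)))
    · exact lt_irrefl _ h
  have hmono : 1 < N → ∀ d₀ h₁ h₂, (h₁, d₀) ∈ regDomain K N D → (h₂, d₀) ∈ regDomain K N D →
      |h₁| ≤ |h₂| → modelLambda p K N h₁ d₀ ≤ modelLambda p K N h₂ d₀ := by
    intro hN' d₀ h₁ h₂ hq₁ hq₂ hle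
    obtain ⟨J₁, ψ₁, hJ₁0, hj₁, hJ₁, hψ₁, e₁⟩ := exists_modelDensity_eq hN1 hq₁
    obtain ⟨J₂, ψ₂, hJ₂0, hj₂, hJ₂, hψ₂, e₂⟩ := exists_modelDensity_eq hN1 hq₂
    have hd : 0 < d₀ := hq₁.1
    exact modelLambda_le_modelLambda hp hd hd
      (fun x hx => (hJ₁ x hx).continuousAt.continuousWithinAt) hJ₁0 hj₁
      (fun x hx => (hJ₂ x hx).continuousAt.continuousWithinAt) hJ₂0 hj₂ fun μ _ h =>
      h.of_riccati_abs_le hp (half_pos hd) (riccatiCoeff_nonneg hN') hψ₁ hψ₂ (by rwa [e₁, e₂])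
        hJ₁ hJ₁0 hJ₂ hJ₂0
  refine ⟨?_, ?_, ?_⟩
  · rintro ⟨h, d⟩ hq
    obtain ⟨J, ψ, hJ0, hj, hJ, -, -⟩ := exists_modelDensity_eq hN1 hq
    exact pPoincareConst_lt_top hp (half_pos hq.1)
      (fun x hx => (hJ x hx).continuousAt.continuousWithinAt) hJ0 hj
  · intro h₀ _ d hq d' hq' hdd
    obtain ⟨J, ψ, hJ0, hj, hJ, -, -⟩ := exists_modelDensity_eq hN1 hq'
    have hJc : ContinuousOn J (Icc (-(d' / 2)) (d' / 2)) := fun x hx =>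
      (hJ x hx).continuousAt.continuousWithinAt
    have hsub : Icc (-(d / 2)) (d / 2) ⊆ Icc (-(d' / 2)) (d' / 2) :=
      Icc_subset_Icc (by linarith) (by linarith)
    exact modelLambda_le_modelLambda hp hq'.1 hq.1 hJc hJ0 hj (hJc.mono hsub)
      (fun x hx => hJ0 x (hsub hx)) (fun x hx => hj x (hsub hx)) fun μ hμ h =>
      h.mono_interval hp (half_pos hq.1) (by linarith) hμ hJc hJ0
  · rintro hN' _ ⟨⟨h, d₀⟩, hq, rfl⟩
    have h0 := zero_mem_regDomain hN1 hq
    exact ⟨fun h₁ hq₁ h₂ hq₂ hle => hmono hN' _ h₁ h₂ hq₁ hq₂ hle, h0,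
      fun h hq => hmono hN' _ 0 h h0 hq (by simp)⟩
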